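/- **Setting.** Let $n,N\ge 1$, $A,d>0$, $1<a<b$, $\Omega=(-A,A)^n\times(a,b)\subset\mathbb R^{n+1}$ with points $\mathbf x=(x_1,\dots,x_n,y)$, and $\mathbf x_\alpha=(\alpha,0,\dots,0)$ for $\alpha\in[-d,d]$. Let $\nu(\mathbf x,\alpha)=(\mathbf x-\mathbf x_\alpha)/|\mathbf x-\mathbf x_\alpha|$ with components $\nu_1,\dots,\nu_{n+1}$. Let $K\in C^2(\overline\Omega\times[-d,d]^2)$, $K\ge0$, and $\mu_s\in C^2(\mathbb R^{n+1})$, $\mu_s\ge 0$, $\mu_s=0$ outside $\Omega$. Let $\{\Psi_s\}_{s\ge0}$ be the Gram–Schmidt orthonormalization of $\{\alpha^s e^\alpha\}_{s\ge0}$ in $L^2(-d,d)$. For $w\in\mathbb R^N$ put $w(\alpha)=\sum_{s<N}w_s\Psi_s(\alpha)$. Define $N\times N$ matrices and a vector function, with indices $0\le k,s<N$, by $$(D_N)_{ks}(\mathbf x)=\int_{-d}^d\Big(\Psi_s'+\frac{\partial_\alpha\nu_{n+1}}{\nu_{n+1}}\Psi_s\Big)\Psi_k\,d\alpha,\qquad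 (A_i)_{ks}(\mathbf x)=\int_{-d}^d\Big(\frac{\nu_i}{\nu_{n+1}}\Psi_s'+\frac{\partial_\alpha\nu_i}{\nu_{n+1}}\Psi_s\Big)\Psi_k\,d\alpha\quad(1\le i\le n),$$ $$F_k(w,\mathbf x)=-\int_{-d}^d\frac{\mu_s(\mathbf x)}{\nu_{n+1}(\mathbf x,\alpha)}\,\partial_\alpha\Big[e^{-w(\alpha)}\int_{-d}^dK(\mathbf x,\alpha,\beta)e^{w(\beta)}d\beta\Big]\Psi_k(\alpha)\,d\alpha .$$ Let $m>1$ be an integer and $h=2A/m\ge h_0>0$. Replace $(-A,A)^n$ by the uniform grid with step $h$ (points with coordinates $-A+jh$, $0\le j\le m$; interior points have all $1\le j\le m-1$), keeping $y\in(a,b)$ continuous; this is $\Omega^h$. Its boundary $\partial\Omega^h$ consists of the grid points with $y=a$, those with $y=b$, and, for $y\in(a,b)$, the non-interior grid points. At interior grid points $W_{x_k}$ denotes the central difference with step $h$. $H^{1,h}_N$ is the space of $\mathbb R^N$-valued $W$ on the grid $\times[a,b]$ with finite norm $$\|W\|^2=\sum_{\text{interior grid points}}\ \sum_{k=1}^n\int_a^b\big(|W|^2+|W_{x_k}|^2+|W_y|^2\big)dy$$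 (at interior grid points $W$ is the continuous representative of an $H^1(a,b)$ function of $y$), $H^{1,h}_{N,0}$ is its subspace of functions vanishing on $\partial\Omega^h$, and $L^{2,h}$ is normed by $\|f\|^2_{L^{2,h}}=\sum_{\text{interior}}\int_a^b f^2dy$. Put $B(R,P)=\{W\in H_N^{1,h}:W|_{\partial\Omega^h}=P,\ \|W\|<R\}$, let $\overline{B(R,P)}$ be the same set with $\|W\|\le R$, and $$J_\lambda(W)=\sum_{\text{interior}}\int_a^b\Big|D_NW_y+\sum_{i=1}^nA_iW_{x_i}+F(W,\cdot)\Big|^2e^{2\lambda y}\,dy .$$ $J_\lambda'(W)\in H^{1,h}_{N,0}$ is the Fréchet derivative of $J_\lambda$ at $W$ with respect to increments in $H^{1,h}_{N,0}$, represented through the scalar product of $H^{1,h}_N$. The coefficient recovered from $W=(w_0,\dots,w_{N-1})$, with $w(\cdot,\alpha)=\sum_s w_s\Psi_s(\alpha)$, is $$a^h[W]=-\frac1{2d}\int_{-d}^d\Big(\sum_{i=1}^n\nu_iw_{x_i}+\nu_{n+1}w_y\Big)d\alpha+\frac1{2d}\int_{-d}^d e^{-w(\cdot,\alpha)}\mu_s\int_{-d}^dK(\cdot,\alpha,\beta)e^{w(\cdot,\beta)}d\beta\,d\alpha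 .$$ **Theorem 4.5** (global convergence of gradient descent). There is $a_0=a_0(A,d,N)>1$ such that the following holds whenever $a\ge a_0$. Below, "the parameters" are $n,A,d,N,a,b,h_0$ and upper bounds for $\|K\|_{C^1(\overline\Omega\times[-d,d]^2)}$ and $\sup\mu_s$. There is a number $\lambda_1(R)\ge1$ for each $R>0$, depending only on $R$ and the parameters, such that for all $\lambda\ge\lambda_1(R)$ and all boundary data $P$ the functional $J_\lambda$ is strictly convex on $\overline{B(R,P)}$, i.e. $J_\lambda'$ exists there and $$J_\lambda(W_2)-J_\lambda(W_1)-\big(J_\lambda'(W_1),W_2-W_1\big)\ge c\,e^{2\lambda a}\|W_2-W_1\|^2,\qquad W_1,W_2\in\overline{B(R,P)},$$ with $c>0$ depending only on $R$ and the parameters. Moreover, for every $R>0$ and every $\lambda_2\ge\lambda_1(2R)$ there is a constant $C_3>0$, depending only on $R$, $\lambda_2$ and the parameters, with the following property. Let $P^h,P^{h*}$ be boundary data on $\partial\Omega^h$, and let $S^h,S^{h*}\in H^{1,h}_N$ satisfy $S^h|_{\partial\Omega^h}=P^h$, $S^{h*}|_{\partial\Omega^h}=P^{h*}$, $\|S^h\|<R$,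 $\|S^{h*}\|<R$ and $\|S^h-S^{h*}\|<\delta$, where $\delta>0$. Let $\alpha\in(0,R)$ and let $W^{h*}\in B((R-\alpha)/3,P^{h*})$ be an exact solution: $D_NW^{h*}_y+\sum_iA_iW^{h*}_{x_i}+F(W^{h*},\cdot)=0$ at the interior grid points, for a.e. $y\in(a,b)$. Assume $C_3\delta<\alpha/3$. Then $J_{\lambda_2}$ has a unique minimizer $W_{\min}$ on $\overline{B(R,P^h)}$, and for every sufficiently small $\gamma>0$ there is $\theta=\theta(\gamma)\in(0,1)$ such that for every starting point $W_0\in B(R/3,P^h)$ the gradient descent sequence $W_k=W_{k-1}-\gamma J_{\lambda_2}'(W_{k-1})$, $k\ge1$, is well defined, stays in $B(R,P^h)$, and satisfies for all $k\ge0$ $$\|W_k-W_{\min}\|\le\theta^k\|W_0-W_{\min}\|,\qquad \|W_k-W^{h*}\|\le C_3\delta+\theta^k\|W_0-W_{\min}\|,$$ $$\|a^h[W_k]-a^h[W^{h*}]\|_{L^{2,h}}\le C_3\delta+C_3\,\theta^k\|W_0-W_{\min}\|,$$ where $a^h[W_k],a^h[W^{h*}]\in L^{2,h}$. -/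

import Mathlib

noncomputable section

namespace RTE

open MeasureTheory

/-! ### The orthonormal basis of `L²(-d,d)` -/

/-- `Ψ_0, Ψ_1, …`: the result of the Gram-Schmidt orthonormalization of
`α ↦ α ^ s * exp α`, `s = 0, 1, …`, in `L²(-d,d)`. -/
def Psi (d : ℝ) : ℕ → ℝ → ℝ
  | s =>
    let raw : ℝ → ℝ := fun α => α ^ s * Real.exp α -
      ∑ r : Fin s, (∫ t in (-d)..d, t ^ s * Real.exp t * Psi d r.val t) * Psi d r.val α
    fun α => raw α / Real.sqrt (∫ t in (-d)..d, raw t ^ 2)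
  termination_by s => s
  decreasing_by all_goals exact r.isLt

/-! ### The model

A point of `ℝ^{n+1}` is a pair `(x, y)` with `x : Fin n → ℝ` and `y : ℝ`. -/

/-- The data of the problem: `Ω = (-A,A)^n × (a,b)`, the sources `(α,0,…,0)` with
`α ∈ [-d,d]`, the number `m` of grid intervals in each of the directions `x_1,…,x_n`, the
scattering coefficient `μ_s` and the phase function `K(x,y,α,β)`. -/
structure Model (n : ℕ) where
  A : ℝ
  d : ℝ
  a : ℝ
  b : ℝ
  m : ℕ
  μs : (Fin n → ℝ) × ℝ → ℝ
  K : (Fin n → ℝ) × ℝ × ℝ × ℝ → ℝ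

namespace Model

variable {n : ℕ} (p : Model n)

/-- The open prism `Ω`. -/
def Omega : Set ((Fin n → ℝ) × ℝ) :=
  {z | (∀ i, -p.A < z.1 i ∧ z.1 i < p.A) ∧ p.a < z.2 ∧ z.2 < p.b}

/-- The closed set `closure Ω × [-d,d]²`. -/
def Box : Set ((Fin n → ℝ) × ℝ × ℝ × ℝ) :=
  {z | (∀ i, -p.A ≤ z.1 i ∧ z.1 i ≤ p.A) ∧ (p.a ≤ z.2.1 ∧ z.2.1 ≤ p.b) ∧
    (-p.d ≤ z.2.2.1 ∧ z.2.2.1 ≤ p.d) ∧ (-p.d ≤ z.2.2.2 ∧ z.2.2.2 ≤ p.d)}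

/-- The grid step size. -/
def h : ℝ := 2 * p.A / p.m

/-- The standing assumptions on the coefficients and on the grid, with the lower bound `h0` for the
grid step size, a bound `κ` for the `C¹` norm of `K` and a bound `σ` for `μ_s`. -/
structure Admissible (h0 κ σ : ℝ) : Prop where
  one_lt_m : 1 < p.m
  h0_le : h0 ≤ p.h
  K_nonneg : ∀ z ∈ p.Box, 0 ≤ p.K z
  K_smooth : ContDiffOn ℝ 2 p.K p.Box
  K_le : ∀ z ∈ p.Box, |p.K z| ≤ κ
  K_deriv_le : ∀ z ∈ p.Box, ‖fderivWithin ℝ p.K p.Box z‖ ≤ κ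
  μs_nonneg : ∀ z, 0 ≤ p.μs z
  μs_zero : ∀ z, z ∉ p.Omega → p.μs z = 0
  μs_smooth : ContDiff ℝ 2 p.μs
  μs_le : ∀ z, p.μs z ≤ σ

end Model

/-- The `i`-th coordinate, `i = 1,…,n`, of `(x,y) - (α,0,…,0)`. -/
def shift {n : ℕ} (x : Fin n → ℝ) (α : ℝ) (i : Fin n) : ℝ :=
  if i.val = 0 then x i - α else x i

/-- The Euclidean distance between `(x,y)` and the source `(α,0,…,0)`. -/
def dist0 {n : ℕ} (x : Fin n → ℝ) (y α : ℝ) : ℝ :=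
  Real.sqrt ((∑ i, shift x α i ^ 2) + y ^ 2)

/-- The components `ν_1, …, ν_n` of the unit vector `ν` directed from the source to `(x,y)`. -/
def nu {n : ℕ} (x : Fin n → ℝ) (y α : ℝ) (i : Fin n) : ℝ := shift x α i / dist0 x y α

/-- The component `ν_{n+1}` of `ν`. -/
def nuLast {n : ℕ} (x : Fin n → ℝ) (y α : ℝ) : ℝ := y / dist0 x y α

namespace Model

variable {n : ℕ} (p : Model n) {N : ℕ}

/-- The matrix `D_N = M_N + A_{n+1}`: the coefficient of `∂_y w_s` in the `k`-th equation,
obtained by testing with `Ψ_k`. -/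
def D (x : Fin n → ℝ) (y : ℝ) (k s : Fin N) : ℝ :=
  ∫ α in (-p.d)..p.d,
    (deriv (Psi p.d s) α
      + deriv (fun t => nuLast x y t) α / nuLast x y α * Psi p.d s α) * Psi p.d k α

/-- The matrix `A_i`, `i = 1,…,n`: the coefficient of `∂_{x_i} w_s` in the `k`-th equation. -/
def Amat (i : Fin n) (x : Fin n → ℝ) (y : ℝ) (k s : Fin N) : ℝ :=
  ∫ α in (-p.d)..p.d,
    (nu x y α i / nuLast x y α * deriv (Psi p.d s) α
      + deriv (fun t => nu x y t i) α / nuLast x y α * Psi p.d s α) * Psi p.d k α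

/-- The truncated series `∑_s w_s Ψ_s(α)`. -/
def series (w : Fin N → ℝ) (α : ℝ) : ℝ := ∑ s, w s * Psi p.d s α

/-- `exp (-w(α)) ∫ K(x,y,α,β) exp (w(β)) dβ` for the truncated series `w`. -/
def scatter (w : Fin N → ℝ) (x : Fin n → ℝ) (y α : ℝ) : ℝ :=
  Real.exp (-p.series w α) * ∫ β in (-p.d)..p.d, p.K (x, y, α, β) * Real.exp (p.series w β)

/-- The nonlinear term `F(w,(x,y))`. -/
def F (w : Fin N → ℝ) (x : Fin n → ℝ) (y : ℝ) (k : Fin N) : ℝ :=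
  ∫ α in (-p.d)..p.d,
    -(p.μs (x, y) / nuLast x y α) * deriv (fun t => p.scatter w x y t) α * Psi p.d k α

/-! ### Partial finite differences -/

/-- Indices `(j_1,…,j_n)`, `0 ≤ j_i ≤ m`, of the grid in `[-A,A]^n`. -/
abbrev Grid : Type := Fin n → Fin (p.m + 1)

/-- The grid point with index `g`. -/
def pt (g : p.Grid) : Fin n → ℝ := fun i => -p.A + (g i).val * p.h

/-- Interior grid indices: `1 ≤ j_i ≤ m - 1` for all `i`. -/
def Interior (g : p.Grid) : Prop := ∀ i, 0 < (g i).val ∧ (g i).val < p.m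

open Classical in
/-- The finite set of the interior grid indices. -/
def interiorPts : Finset p.Grid := Finset.univ.filter fun g => p.Interior g

/-- Semi-discrete `N`-vector functions: `W g s y` is the `s`-th component at the point `(x_g, y)`.
Only the values for `y ∈ [a,b]` matter. -/
abbrev GridFun (N : ℕ) : Type := p.Grid → Fin N → ℝ → ℝ

/-- The central difference in the direction `x_k`, used at interior grid points only
(so that `g k ± 1` does not wrap around). -/
def dx (W : p.GridFun N) (k : Fin n) (g : p.Grid) (s : Fin N) (y : ℝ) : ℝ :=
  (W (Function.update g k (g k + 1)) s y - W (Function.update g k (g k - 1)) s y) / (2 * p.h)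

/-- The space `H_N^{1,h}`: at interior grid points the components belong to `H¹(a,b)` (they are
absolutely continuous with a square integrable derivative) and all central differences are
square integrable. -/
def MemH1 (W : p.GridFun N) : Prop :=
  (∀ g, p.Interior g → ∀ s, AbsolutelyContinuousOnInterval (W g s) p.a p.b ∧
    MemLp (deriv (W g s)) 2 (volume.restrict (Set.Ioo p.a p.b))) ∧
  ∀ g, p.Interior g → ∀ k s,
    MemLp (fun y => p.dx W k g s y) 2 (volume.restrict (Set.Ioo p.a p.b))

/-- The scalar product of `H_N^{1,h}`. -/
def innerH1 (V W : p.GridFun N) : ℝ :=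
  ∑ g ∈ p.interiorPts, ∑ k : Fin n, ∫ y in p.a..p.b, ∑ s,
    (V g s y * W g s y + p.dx V k g s y * p.dx W k g s y
      + deriv (V g s) y * deriv (W g s) y)

/-- The norm of `H_N^{1,h}`. -/
def normH1 (W : p.GridFun N) : ℝ := Real.sqrt (p.innerH1 W W)

/-- The boundary condition `W = P` on `∂Ω^h`, i.e. for `y = a`, for `y = b`, and at the boundary
points of the grid. Only the values of `P` on `∂Ω^h` are used. -/
def BdryEq (W P : p.GridFun N) : Prop :=
  (∀ g s, W g s p.a = P g s p.a ∧ W g s p.b = P g s p.b) ∧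
  ∀ g, ¬ p.Interior g → ∀ s, ∀ y ∈ Set.Ioo p.a p.b, W g s y = P g s y

/-- The space `H_{N,0}^{1,h}`. -/
def MemH10 (W : p.GridFun N) : Prop := p.MemH1 W ∧ p.BdryEq W 0

/-- The set `B(R,P)`. -/
def Ball (R : ℝ) (P : p.GridFun N) : Set (p.GridFun N) :=
  {W | p.MemH1 W ∧ p.BdryEq W P ∧ p.normH1 W < R}

/-- The closed set `closure B(R,P)`. -/
def ClosedBall (R : ℝ) (P : p.GridFun N) : Set (p.GridFun N) :=
  {W | p.MemH1 W ∧ p.BdryEq W P ∧ p.normH1 W ≤ R}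

/-- The left hand side `D_N W_y + ∑ A_i W_{x_i} + F(W)` of the semi-discrete system, `k`-th
component at the point `(x_g,y)`. -/
def residual (W : p.GridFun N) (g : p.Grid) (k : Fin N) (y : ℝ) : ℝ :=
  (∑ s, p.D (p.pt g) y k s * deriv (W g s) y)
    + (∑ i, ∑ s, p.Amat i (p.pt g) y k s * p.dx W i g s y)
    + p.F (fun s => W g s y) (p.pt g) y k

/-- `W` solves the semi-discrete system in `Ω^h`. -/
def Solves (W : p.GridFun N) : Prop :=
  ∀ g, p.Interior g → ∀ k, ∀ᵐ y ∂(volume.restrict (Set.Ioo p.a p.b)), p.residual W g k y = 0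

/-- The functional `J_λ`, with the Carleman weight `exp (2 λ y)`. -/
def J (lam : ℝ) (W : p.GridFun N) : ℝ :=
  ∑ g ∈ p.interiorPts, ∫ y in p.a..p.b,
    (∑ k, p.residual W g k y ^ 2) * Real.exp (2 * lam * y)

/-- `G ∈ H_{N,0}^{1,h}` is the Fréchet derivative `J_λ'(W)`, with respect to increments in
`H_{N,0}^{1,h}` and represented through the scalar product. -/
def IsGrad (lam : ℝ) (W G : p.GridFun N) : Prop :=
  p.MemH10 G ∧ ∀ ε > 0, ∃ η > 0, ∀ v : p.GridFun N, p.MemH10 v → p.normH1 v < η →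
    |p.J lam (W + v) - p.J lam W - p.innerH1 G v| ≤ ε * p.normH1 v

open Classical in
/-- `J_λ'(W)` (with the value `0` if it does not exist). -/
def grad (lam : ℝ) (W : p.GridFun N) : p.GridFun N :=
  if hG : ∃ G, p.IsGrad lam W G then hG.choose else 0

/-- The gradient descent sequence with the step `γ`. -/
def descent (lam γ : ℝ) (W0 : p.GridFun N) : ℕ → p.GridFun N
  | 0 => W0
  | k + 1 => descent lam γ W0 k - γ • p.grad lam (descent lam γ W0 k)

/-- Strict convexity of `J_λ` on `closure B(R,P)`, with the modulus `c exp (2 λ a)`. -/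
def StrictlyConvex (lam c R : ℝ) (P : p.GridFun N) : Prop :=
  ∀ W₁ ∈ p.ClosedBall R P, p.IsGrad lam W₁ (p.grad lam W₁) ∧
    ∀ W₂ ∈ p.ClosedBall R P,
      c * Real.exp (2 * lam * p.a) * p.normH1 (W₂ - W₁) ^ 2
        ≤ p.J lam W₂ - p.J lam W₁ - p.innerH1 (p.grad lam W₁) (W₂ - W₁)

/-- `Wmin` is the unique minimizer of `J_λ` on `closure B(R,P)` (uniqueness as a function on the
semi-discrete closed domain). -/
def IsUniqueMin (lam R : ℝ) (P Wmin : p.GridFun N) : Prop :=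
  (Wmin ∈ p.ClosedBall R P ∧ ∀ W ∈ p.ClosedBall R P, p.J lam Wmin ≤ p.J lam W) ∧
  ∀ W' ∈ p.ClosedBall R P, (∀ W ∈ p.ClosedBall R P, p.J lam W' ≤ p.J lam W) →
    ∀ g s, ∀ y ∈ Set.Icc p.a p.b, W' g s y = Wmin g s y

/-! ### The recovered coefficient -/

/-- `a^h(x_g,y)` recovered from `W` by averaging the transport equation over the sources; the
`x`-derivatives of `w^h = ∑ w_s Ψ_s` are central differences. -/
def coeff (W : p.GridFun N) (g : p.Grid) (y : ℝ) : ℝ :=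
  -(1 / (2 * p.d)) * (∫ α in (-p.d)..p.d,
      (∑ i, nu (p.pt g) y α i * p.series (fun s => p.dx W i g s y) α)
        + nuLast (p.pt g) y α * p.series (fun s => deriv (W g s) y) α)
    + 1 / (2 * p.d) * ∫ α in (-p.d)..p.d,
        p.μs (p.pt g, y) * p.scatter (fun s => W g s y) (p.pt g) y α

/-- The discrete space `L^{2,h}` of scalar functions. -/
def MemL2 (f : p.Grid → ℝ → ℝ) : Prop :=
  ∀ g, p.Interior g → MemLp (f g) 2 (volume.restrict (Set.Ioo p.a p.b))

/-- The norm of `L^{2,h}` for scalar functions. -/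
def normL2 (f : p.Grid → ℝ → ℝ) : ℝ :=
  Real.sqrt (∑ g ∈ p.interiorPts, ∫ y in p.a..p.b, f g y ^ 2)

end Model

end RTE

end

/-!
The functional `J_λ` is convex on balls because its principal part is coercive in `W_y`, and because
the Carleman weight `e^{2λy}` makes every other term small.

*Principal part.* Since `Ψ_s' - Ψ_s` is a polynomial of degree less than `s` times the exponential,
the matrix `(∫ Ψ_s' Ψ_k)` is upper triangular with unit diagonal (`integral_deriv_Psi_mul_Psi`),
hence invertible. The matrix `D_N` differs from it by `O(y⁻²)`, so for `a ≥ a₀(A, d, N)` it satisfies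
`|D_N v|² ≥ c₀ |v|²` uniformly in `Ω` (`D_coercive`).

*Nonlinear part.* After differentiation under the integral over `β`, `F` is an integral of
exponentials of linear forms in `w`, times affine factors, over the square of the source parameters
(`Admissible.F_eq`).
Elementary estimates of the integrand (`ExpBounds.expTerm_taylor`) bound `F`, its derivative and its
second order Taylor remainder on bounded sets of `w`. All that is needed of the coefficients is
collected in the structure `Regular`, which `Admissible.regular` provides.

*Convexity.* Let `r` be the residual of `W`, `ℓ` its linearization in the direction `v`, and `Q` the
second order remainder. The Taylor remainder of `J_λ` is the weighted integral of `|ℓ + Q|² + 2 r Q`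
(`Regular.taylor_J`), which is at least `c₀/2 |v_y|²` up to terms in `|v|²` and in the central
differences of `v`. As the grid step is at least `h₀` and `v` vanishes on the boundary, the
differences are controlled by the values (`sum_diffSq_le`). The values are controlled by the
pointwise Carleman estimate `sq_mul_exp_le_carleman`, which bounds `v² e^{2λy}` by `1/(2λ)` times the
weighted energy of `v_y`. So the error terms are `O(1/λ)` times this energy (`Regular.error_le`), and
for large `λ` they are absorbed (`Regular.le_taylor_J`); the Poincaré inequality
`normH1_sq_le_derivSq` turns the energy into the norm of `v` (`Regular.strictlyConvex`). The residual
is only square integrable in `y`, not bounded, so the pointwise form of the estimate matters for the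
term `2 r Q`.

*Gradient descent.* The space of functions with zero boundary values is complete
(`completeSpace_H10`), so the derivative is represented by a gradient (`Regular.exists_isGrad`) and
the minimizer exists (`exists_minimizer`). The Taylor remainder is at most quadratic, so the gradient
is Lipschitz continuous (`norm_grad_sub_le`). With strong convexity, a descent step with a small
`γ` contracts the distance to a critical point (`exists_descent_rate`). To see that the minimizer on
the closed ball is critical, it is compared with `W* + S - S*`, which has the noisy boundary values
and, as `W*` has zero residual, a value of `J_λ` of order `δ²` (`Regular.J_add_le`). By convexity the
minimizer is within `C₃ δ` of `W*`, hence in the ball of radius `R/3`. There its gradient vanishes,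
and iterates that start in `B(R/3)` never leave `B(R)` (`Regular.gradient_descent`). The estimates of
the coefficient follow because `a^h` is Lipschitz continuous on bounded sets
(`Admissible.normL2_coeff_sub_le`).
-/

noncomputable section

namespace RTE

open MeasureTheory

/-! ### One-dimensional inequalities -/

/-- The Cauchy-Schwarz inequality for the integral of a product. -/
theorem sq_integral_mul_le {X : Type*} [MeasurableSpace X] {μ : Measure X} {f g : X → ℝ}
    (hf : MemLp f 2 μ) (hg : MemLp g 2 μ) :
    (∫ x, f x * g x ∂μ) ^ 2 ≤ (∫ x, f x ^ 2 ∂μ) * ∫ x, g x ^ 2 ∂μ := by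
  have hfg : Integrable (fun x => f x * g x) μ := hf.integrable_mul hg
  have key : ∀ t : ℝ, 0 ≤ (∫ x, f x ^ 2 ∂μ) * (t * t) + (2 * ∫ x, f x * g x ∂μ) * t
      + ∫ x, g x ^ 2 ∂μ := by
    intro t
    have h : ∫ x, (t * f x + g x) ^ 2 ∂μ = (∫ x, f x ^ 2 ∂μ) * (t * t)
        + (2 * ∫ x, f x * g x ∂μ) * t + ∫ x, g x ^ 2 ∂μ := by
      have : ∀ x, (t * f x + g x) ^ 2 = (t * t) * f x ^ 2 + (2 * t) * (f x * g x) + g x ^ 2 :=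
        fun x => by ring
      simp_rw [this]
      have hI : Integrable (fun x => (t * t) * f x ^ 2 + (2 * t) * (f x * g x)) μ :=
        (hf.integrable_sq.const_mul _).add (hfg.const_mul _)
      rw [integral_add hI hg.integrable_sq,
        integral_add (hf.integrable_sq.const_mul _) (hfg.const_mul _), integral_const_mul,
        integral_const_mul]
      ring
    rw [← h]
    exact integral_nonneg fun x => sq_nonneg _
  have := discrim_le_zero key
  unfold discrim at this
  nlinarith

theorem sq_integral_le {X : Type*} [MeasurableSpace X] {μ : Measure X} [IsFiniteMeasure μ]
    {f : X → ℝ} (hf : MemLp f 2 μ) :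
    (∫ x, f x ∂μ) ^ 2 ≤ μ.real Set.univ * ∫ x, f x ^ 2 ∂μ := by
  have := sq_integral_mul_le hf (memLp_const (1 : ℝ))
  simpa [mul_comm] using this

section AC

variable {f : ℝ → ℝ} {a b : ℝ}

theorem interval_eq_integral_Ioo (hab : a ≤ b) (f : ℝ → ℝ) :
    ∫ y in a..b, f y = ∫ y in Set.Ioo a b, f y := by
  rw [intervalIntegral.integral_of_le hab, integral_Ioc_eq_integral_Ioo]

theorem sq_sub_le_of_le (hf : AbsolutelyContinuousOnInterval f a b)
    (hf' : MemLp (deriv f) 2 (volume.restrict (Set.Ioo a b))) {y z : ℝ} (hy : y ∈ Set.Icc a b)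
    (hz : z ∈ Set.Icc a b) (hzy : z ≤ y) :
    (f y - f z) ^ 2 ≤ (b - a) * ∫ s in Set.Ioo a b, deriv f s ^ 2 := by
  have hab : a ≤ b := hy.1.trans hy.2
  have hsub : Set.Ioo z y ⊆ Set.Ioo a b := Set.Ioo_subset_Ioo hz.1 hy.2
  have hac : AbsolutelyContinuousOnInterval f z y := hf.mono (by
    rw [Set.uIcc_of_le hzy, Set.uIcc_of_le hab]; exact Set.Icc_subset_Icc hz.1 hy.2)
  rw [← hac.integral_deriv_eq_sub, interval_eq_integral_Ioo hzy]
  have h1 := sq_integral_le (hf'.mono_measure (Measure.restrict_mono hsub le_rfl))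
  have h2 : ∫ s in Set.Ioo z y, deriv f s ^ 2 ≤ ∫ s in Set.Ioo a b, deriv f s ^ 2 :=
    setIntegral_mono_set hf'.integrable_sq (Filter.Eventually.of_forall fun x => sq_nonneg _)
      hsub.eventuallyLE
  have h3 : (volume.restrict (Set.Ioo z y)).real Set.univ = y - z := by
    simp [hzy]
  rw [h3] at h1
  have h4 : 0 ≤ ∫ s in Set.Ioo z y, deriv f s ^ 2 := integral_nonneg fun x => sq_nonneg _
  calc _ ≤ _ := h1
    _ ≤ (b - a) * ∫ s in Set.Ioo a b, deriv f s ^ 2 :=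
      mul_le_mul (by linarith [hy.2, hz.1]) h2 h4 (by linarith)

/-- Oscillation bound for functions with a square integrable derivative. -/
theorem sq_sub_le (hf : AbsolutelyContinuousOnInterval f a b)
    (hf' : MemLp (deriv f) 2 (volume.restrict (Set.Ioo a b))) {y z : ℝ} (hy : y ∈ Set.Icc a b)
    (hz : z ∈ Set.Icc a b) :
    (f y - f z) ^ 2 ≤ (b - a) * ∫ s in Set.Ioo a b, deriv f s ^ 2 := by
  rcases le_total z y with h | h
  · exact sq_sub_le_of_le hf hf' hy hz h
  · rw [← neg_sub, neg_sq]
    exact sq_sub_le_of_le hf hf' hz hy h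

theorem memLp_of_continuousOn {E : Type*} [NormedAddCommGroup E] {f : ℝ → E}
    (hf : ContinuousOn f (Set.Icc a b)) (q : ENNReal) :
    MemLp f q (volume.restrict (Set.Ioo a b)) := by
  obtain ⟨C, hC⟩ := isCompact_Icc.exists_bound_of_continuousOn hf
  refine MemLp.of_bound
    ((hf.mono Set.Ioo_subset_Icc_self).aestronglyMeasurable measurableSet_Ioo) C ?_
  filter_upwards [ae_restrict_mem measurableSet_Ioo] with x hx
    using hC x (Set.Ioo_subset_Icc_self hx)

theorem continuousOn_Icc_of_ac (hab : a ≤ b) (hf : AbsolutelyContinuousOnInterval f a b) :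
    ContinuousOn f (Set.Icc a b) := by
  have := hf.continuousOn
  rwa [Set.uIcc_of_le hab] at this

/-- The embedding of `H¹(a,b)` into the bounded functions. -/
theorem sq_le_sobolev (hab : a < b) (hf : AbsolutelyContinuousOnInterval f a b)
    (hf' : MemLp (deriv f) 2 (volume.restrict (Set.Ioo a b))) {y : ℝ} (hy : y ∈ Set.Icc a b) :
    f y ^ 2 ≤ 2 / (b - a) * (∫ s in Set.Ioo a b, f s ^ 2)
      + 2 * (b - a) * ∫ s in Set.Ioo a b, deriv f s ^ 2 := by
  set D := ∫ s in Set.Ioo a b, deriv f s ^ 2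
  have hba : 0 < b - a := sub_pos.2 hab
  have hf2 : Integrable (fun s => f s ^ 2) (volume.restrict (Set.Ioo a b)) :=
    (memLp_of_continuousOn (continuousOn_Icc_of_ac hab.le hf) 2).integrable_sq
  have h1 : ∫ s in Set.Ioo a b, f y ^ 2 ≤ ∫ s in Set.Ioo a b, (2 * f s ^ 2 + 2 * (b - a) * D) := by
    refine setIntegral_mono_on (integrable_const _)
      ((hf2.const_mul 2).add (integrable_const _)) measurableSet_Ioo fun z hz => ?_
    have := sq_sub_le hf hf' hy (Set.Ioo_subset_Icc_self hz)
    nlinarith [sq_nonneg (f y - 2 * f z)]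
  rw [integral_add (hf2.const_mul 2) (integrable_const _), integral_const_mul] at h1
  simp only [integral_const, measureReal_restrict_apply MeasurableSet.univ, Set.univ_inter,
    Real.volume_real_Ioo_of_le hab.le, smul_eq_mul] at h1
  rw [div_mul_eq_mul_div, ← sub_le_iff_le_add, le_div_iff₀ hba]
  nlinarith

/-- A pointwise Carleman estimate: if `f b = 0`, then `f² e^{2λy}` is dominated by the weighted
energy of `f'`, with a factor that tends to `0` as `λ → ∞`. It comes from
`f(y) = -∫_y^b (f' e^{λs}) e^{-λs} ds` and the Cauchy-Schwarz inequality. -/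
theorem sq_mul_exp_le_carleman (hf : AbsolutelyContinuousOnInterval f a b)
    (hf' : MemLp (deriv f) 2 (volume.restrict (Set.Ioo a b))) (hb : f b = 0) {l : ℝ} (hl : 0 < l)
    {y : ℝ} (hy : y ∈ Set.Icc a b) :
    f y ^ 2 * Real.exp (2 * l * y)
      ≤ 1 / (2 * l) * ∫ s in Set.Ioo a b, deriv f s ^ 2 * Real.exp (2 * l * s) := by
  have hab : a ≤ b := hy.1.trans hy.2
  have hsub : Set.Ioo y b ⊆ Set.Ioo a b := Set.Ioo_subset_Ioo hy.1 le_rfl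
  have hac : AbsolutelyContinuousOnInterval f y b := hf.mono (by
    rw [Set.uIcc_of_le hy.2, Set.uIcc_of_le hab]; exact Set.Icc_subset_Icc hy.1 le_rfl)
  have hrep : f y = -∫ s in Set.Ioo y b,
      (deriv f s * Real.exp (l * s)) * Real.exp (-l * s) := by
    have : ∀ s, (deriv f s * Real.exp (l * s)) * Real.exp (-l * s) = deriv f s := fun s => by
      rw [mul_assoc, ← Real.exp_add]; simp
    simp_rw [this]
    rw [← interval_eq_integral_Ioo hy.2, hac.integral_deriv_eq_sub, hb]; ring
  have hw : MemLp (fun s => deriv f s * Real.exp (l * s)) 2 (volume.restrict (Set.Ioo a b)) := by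
    have hbd : MemLp (fun s => Real.exp (l * s)) ⊤ (volume.restrict (Set.Ioo a b)) :=
      memLp_of_continuousOn (by fun_prop) _
    exact hbd.mul (r := 2) hf'
  have hg : MemLp (fun s => Real.exp (-l * s)) 2 (volume.restrict (Set.Ioo y b)) :=
    memLp_of_continuousOn (by fun_prop) _
  have h1 := sq_integral_mul_le (hw.mono_measure (Measure.restrict_mono hsub le_rfl)) hg
  have e1 : ∀ s, (deriv f s * Real.exp (l * s)) ^ 2 = deriv f s ^ 2 * Real.exp (2 * l * s) :=
    fun s => by rw [mul_pow, ← Real.exp_nat_mul]; congr 2; push_cast; ring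
  have h2 : ∫ s in Set.Ioo y b, (deriv f s * Real.exp (l * s)) ^ 2
      ≤ ∫ s in Set.Ioo a b, (deriv f s * Real.exp (l * s)) ^ 2 :=
    setIntegral_mono_set hw.integrable_sq (Filter.Eventually.of_forall fun x => sq_nonneg _)
      hsub.eventuallyLE
  have h3 : ∫ s in Set.Ioo y b, Real.exp (-l * s) ^ 2 ≤ 1 / (2 * l) * Real.exp (-(2 * l * y)) := by
    have e2 : ∀ s, Real.exp (-l * s) ^ 2 = Real.exp ((-(2 * l)) * s) := fun s => by
      rw [← Real.exp_nat_mul]; congr 1; push_cast; ring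
    simp_rw [e2]
    have hneg : -(2 * l) < 0 := by linarith
    refine (setIntegral_mono_set (integrableOn_exp_mul_Ioi hneg y)
      (Filter.Eventually.of_forall fun x => (Real.exp_pos _).le)
      Set.Ioo_subset_Ioi_self.eventuallyLE).trans (le_of_eq ?_)
    rw [integral_exp_mul_Ioi hneg]
    field_simp
  simp_rw [e1] at h1 h2
  rw [hrep, neg_sq]
  have h4 : 0 ≤ ∫ s in Set.Ioo y b, Real.exp (-l * s) ^ 2 := integral_nonneg fun x => sq_nonneg _
  have h5 : 0 ≤ ∫ s in Set.Ioo a b, deriv f s ^ 2 * Real.exp (2 * l * s) :=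
    integral_nonneg fun x => by positivity
  calc _ ≤ ((∫ s in Set.Ioo a b, deriv f s ^ 2 * Real.exp (2 * l * s)) *
        (1 / (2 * l) * Real.exp (-(2 * l * y)))) * Real.exp (2 * l * y) := by
        gcongr
        exact h1.trans (mul_le_mul h2 h3 h4 h5)
    _ = _ := by
      rw [mul_assoc, mul_assoc, ← Real.exp_add]; simp; ring

end AC

namespace Model

variable {n : ℕ} (p : Model n) {N : ℕ}

/-! ### The semi-discrete Sobolev space -/

/-- Lebesgue measure on the interval `(a,b)`. -/
abbrev mu : Measure ℝ := volume.restrict (Set.Ioo p.a p.b)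

/-- The density `|W|²` at a grid point. -/
def valSq (W : p.GridFun N) (g : p.Grid) (y : ℝ) : ℝ := ∑ s, W g s y ^ 2

/-- The density `|W_y|²` at a grid point. -/
def derivSq (W : p.GridFun N) (g : p.Grid) (y : ℝ) : ℝ := ∑ s, deriv (W g s) y ^ 2

/-- The density `∑_k |W_{x_k}|²` at a grid point. -/
def diffSq (W : p.GridFun N) (g : p.Grid) (y : ℝ) : ℝ := ∑ k, ∑ s, p.dx W k g s y ^ 2

variable {p}

theorem mem_interiorPts {g : p.Grid} : g ∈ p.interiorPts ↔ p.Interior g := by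
  simp [interiorPts]

theorem valSq_nonneg (W : p.GridFun N) (g : p.Grid) (y : ℝ) : 0 ≤ p.valSq W g y :=
  Finset.sum_nonneg fun _ _ => sq_nonneg _

theorem derivSq_nonneg (W : p.GridFun N) (g : p.Grid) (y : ℝ) : 0 ≤ p.derivSq W g y :=
  Finset.sum_nonneg fun _ _ => sq_nonneg _

theorem diffSq_nonneg (W : p.GridFun N) (g : p.Grid) (y : ℝ) : 0 ≤ p.diffSq W g y :=
  Finset.sum_nonneg fun _ _ => Finset.sum_nonneg fun _ _ => sq_nonneg _

theorem dx_add (V W : p.GridFun N) (k : Fin n) (g : p.Grid) (s : Fin N) (y : ℝ) :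
    p.dx (V + W) k g s y = p.dx V k g s y + p.dx W k g s y := by
  simp only [dx, Pi.add_apply]; ring

theorem dx_smul (c : ℝ) (W : p.GridFun N) (k : Fin n) (g : p.Grid) (s : Fin N) (y : ℝ) :
    p.dx (c • W) k g s y = c * p.dx W k g s y := by
  simp only [dx, Pi.smul_apply, smul_eq_mul]; ring

theorem deriv_smul_apply (c : ℝ) (W : p.GridFun N) (g : p.Grid) (s : Fin N) (y : ℝ) :
    deriv ((c • W) g s) y = c * deriv (W g s) y := by
  have : (c • W) g s = fun t => c * W g s t := rfl
  rw [this, deriv_const_mul_field]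

theorem BdryEq.add {V W P Q : p.GridFun N} (hV : p.BdryEq V P) (hW : p.BdryEq W Q) :
    p.BdryEq (V + W) (P + Q) :=
  ⟨fun g s => ⟨congrArg₂ (· + ·) (hV.1 g s).1 (hW.1 g s).1,
    congrArg₂ (· + ·) (hV.1 g s).2 (hW.1 g s).2⟩,
    fun g hg s y hy => congrArg₂ (· + ·) (hV.2 g hg s y hy) (hW.2 g hg s y hy)⟩

theorem BdryEq.smul {W P : p.GridFun N} (c : ℝ) (hW : p.BdryEq W P) :
    p.BdryEq (c • W) (c • P) :=
  ⟨fun g s => ⟨congrArg (c * ·) (hW.1 g s).1, congrArg (c * ·) (hW.1 g s).2⟩,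
    fun g hg s y hy => congrArg (c * ·) (hW.2 g hg s y hy)⟩

theorem BdryEq.sub {V W P Q : p.GridFun N} (hV : p.BdryEq V P) (hW : p.BdryEq W Q) :
    p.BdryEq (V - W) (P - Q) :=
  ⟨fun g s => ⟨congrArg₂ (· - ·) (hV.1 g s).1 (hW.1 g s).1,
    congrArg₂ (· - ·) (hV.1 g s).2 (hW.1 g s).2⟩,
    fun g hg s y hy => congrArg₂ (· - ·) (hV.2 g hg s y hy) (hW.2 g hg s y hy)⟩

section Space

variable [hab : Fact (p.a < p.b)] {V W : p.GridFun N} {g : p.Grid}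

theorem MemH1.continuousOn (hW : p.MemH1 W) (hg : p.Interior g) (s : Fin N) :
    ContinuousOn (W g s) (Set.Icc p.a p.b) :=
  continuousOn_Icc_of_ac hab.out.le (hW.1 g hg s).1

theorem MemH1.memLp_val (hW : p.MemH1 W) (hg : p.Interior g) (s : Fin N) :
    MemLp (W g s) 2 p.mu :=
  memLp_of_continuousOn (hW.continuousOn hg s) 2

omit hab in
theorem MemH1.memLp_deriv (hW : p.MemH1 W) (hg : p.Interior g) (s : Fin N) :
    MemLp (deriv (W g s)) 2 p.mu := (hW.1 g hg s).2

omit hab in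
theorem MemH1.memLp_dx (hW : p.MemH1 W) (hg : p.Interior g) (k : Fin n) (s : Fin N) :
    MemLp (fun y => p.dx W k g s y) 2 p.mu := hW.2 g hg k s

theorem ae_differentiableAt (hW : p.MemH1 W) (hg : p.Interior g) (s : Fin N) :
    ∀ᵐ y ∂p.mu, DifferentiableAt ℝ (W g s) y := by
  rw [ae_restrict_iff' measurableSet_Ioo]
  filter_upwards [(hW.1 g hg s).1.ae_differentiableAt] with y hy hy'
  refine hy ?_
  rw [Set.uIcc_of_le hab.out.le]
  exact Set.Ioo_subset_Icc_self hy'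

theorem ae_deriv_add (hV : p.MemH1 V) (hW : p.MemH1 W) :
    ∀ᵐ y ∂p.mu, ∀ g, p.Interior g → ∀ s,
      deriv ((V + W) g s) y = deriv (V g s) y + deriv (W g s) y := by
  rw [ae_all_iff]; intro g
  by_cases hg : p.Interior g
  · simp only [hg, true_imp_iff]
    rw [ae_all_iff]; intro s
    filter_upwards [ae_differentiableAt hV hg s, ae_differentiableAt hW hg s] with y h1 h2
    exact deriv_add h1 h2
  · simp [hg]

theorem MemH1.add (hV : p.MemH1 V) (hW : p.MemH1 W) : p.MemH1 (V + W) := by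
  refine ⟨fun g hg s => ⟨(hV.1 g hg s).1.add (hW.1 g hg s).1, ?_⟩, fun g hg k s => ?_⟩
  · refine ((hV.memLp_deriv hg s).add (hW.memLp_deriv hg s)).ae_eq ?_
    filter_upwards [ae_deriv_add hV hW] with y hy
    rw [hy g hg s]; rfl
  · simp_rw [dx_add]
    exact (hV.memLp_dx hg k s).add (hW.memLp_dx hg k s)

omit hab in
theorem MemH1.smul (c : ℝ) (hW : p.MemH1 W) : p.MemH1 (c • W) := by
  refine ⟨fun g hg s => ⟨(hW.1 g hg s).1.const_mul c, ?_⟩, fun g hg k s => ?_⟩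
  · have : deriv ((c • W) g s) = fun y => c * deriv (W g s) y :=
      funext fun y => deriv_smul_apply c W g s y
    rw [this]
    exact (hW.memLp_deriv hg s).const_mul c
  · simp_rw [dx_smul]
    exact (hW.memLp_dx hg k s).const_mul c

omit hab in
theorem memH1_zero : p.MemH1 (0 : p.GridFun N) := by
  have h0 : ∀ g : p.Grid, ∀ s : Fin N, (0 : p.GridFun N) g s = fun _ => 0 := fun _ _ => rfl
  refine ⟨fun g hg s => ⟨?_, ?_⟩, fun g hg k s => ?_⟩
  · rw [h0]
    exact (LipschitzWith.const (0 : ℝ)).lipschitzOnWith.absolutelyContinuousOnInterval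
  · simp
  · simp [dx]

theorem MemH1.sub (hV : p.MemH1 V) (hW : p.MemH1 W) : p.MemH1 (V - W) := by
  have := hV.add (hW.smul (-1))
  rwa [neg_one_smul, ← sub_eq_add_neg] at this

variable (p) in
/-- The density of the scalar product of `H_N^{1,h}` at a grid point. -/
def dens (V W : p.GridFun N) (g : p.Grid) (y : ℝ) : ℝ :=
  ∑ k : Fin n, ∑ s, (V g s y * W g s y + p.dx V k g s y * p.dx W k g s y
      + deriv (V g s) y * deriv (W g s) y)

theorem integrable_dens_term (hV : p.MemH1 V) (hW : p.MemH1 W) (hg : p.Interior g) (k : Fin n)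
    (s : Fin N) :
    Integrable (fun y => V g s y * W g s y + p.dx V k g s y * p.dx W k g s y
      + deriv (V g s) y * deriv (W g s) y) p.mu :=
  (((hV.memLp_val hg s).integrable_mul (hW.memLp_val hg s)).add
    ((hV.memLp_dx hg k s).integrable_mul (hW.memLp_dx hg k s))).add
    ((hV.memLp_deriv hg s).integrable_mul (hW.memLp_deriv hg s))

theorem integrable_dens (hV : p.MemH1 V) (hW : p.MemH1 W) (hg : p.Interior g) :
    Integrable (p.dens V W g) p.mu :=
  integrable_finsetSum _ fun k _ => integrable_finsetSum _ fun s _ =>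
    integrable_dens_term hV hW hg k s

theorem innerH1_eq (hV : p.MemH1 V) (hW : p.MemH1 W) :
    p.innerH1 V W = ∑ g ∈ p.interiorPts, ∫ y, p.dens V W g y ∂p.mu := by
  refine Finset.sum_congr rfl fun g hg => ?_
  rw [mem_interiorPts] at hg
  simp_rw [interval_eq_integral_Ioo hab.out.le]
  rw [← integral_finsetSum _ fun k _ => integrable_finsetSum _ fun s _ =>
    integrable_dens_term hV hW hg k s]
  rfl

omit hab in
theorem dens_self (V : p.GridFun N) (g : p.Grid) (y : ℝ) :
    p.dens V V g y = n * p.valSq V g y + p.diffSq V g y + n * p.derivSq V g y := by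
  simp only [dens, valSq, diffSq, derivSq, Finset.sum_add_distrib, Finset.sum_const,
    Finset.card_univ, Fintype.card_fin, nsmul_eq_mul, pow_two]

omit hab in
theorem dens_self_nonneg (V : p.GridFun N) (g : p.Grid) (y : ℝ) : 0 ≤ p.dens V V g y := by
  rw [dens_self]
  have := valSq_nonneg V g y
  have := diffSq_nonneg V g y
  have := derivSq_nonneg V g y
  positivity

omit hab in
theorem innerH1_comm (V W : p.GridFun N) : p.innerH1 V W = p.innerH1 W V := by
  simp only [innerH1, mul_comm]

theorem innerH1_add_left {U : p.GridFun N} (hU : p.MemH1 U) (hV : p.MemH1 V) (hW : p.MemH1 W) :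
    p.innerH1 (U + V) W = p.innerH1 U W + p.innerH1 V W := by
  rw [innerH1_eq (hU.add hV) hW, innerH1_eq hU hW, innerH1_eq hV hW, ← Finset.sum_add_distrib]
  refine Finset.sum_congr rfl fun g hg => ?_
  rw [mem_interiorPts] at hg
  rw [← integral_add (integrable_dens hU hW hg) (integrable_dens hV hW hg)]
  refine integral_congr_ae ?_
  filter_upwards [ae_deriv_add hU hV] with y hy
  simp only [dens, ← Finset.sum_add_distrib]
  refine Finset.sum_congr rfl fun k _ => Finset.sum_congr rfl fun s _ => ?_
  rw [hy g hg s, dx_add]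
  simp only [Pi.add_apply]
  ring

theorem innerH1_smul_left (c : ℝ) (hV : p.MemH1 V) (hW : p.MemH1 W) :
    p.innerH1 (c • V) W = c * p.innerH1 V W := by
  rw [innerH1_eq (hV.smul c) hW, innerH1_eq hV hW, Finset.mul_sum]
  refine Finset.sum_congr rfl fun g hg => ?_
  rw [← integral_const_mul]
  congr 1
  funext y
  simp only [dens, Finset.mul_sum]
  refine Finset.sum_congr rfl fun k _ => Finset.sum_congr rfl fun s _ => ?_
  rw [deriv_smul_apply, dx_smul]
  simp only [Pi.smul_apply, smul_eq_mul]
  ring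

theorem innerH1_self_nonneg (hV : p.MemH1 V) : 0 ≤ p.innerH1 V V := by
  rw [innerH1_eq hV hV]
  exact Finset.sum_nonneg fun g _ => integral_nonneg fun y => dens_self_nonneg V g y

theorem normH1_sq (hV : p.MemH1 V) :
    p.normH1 V ^ 2 = ∑ g ∈ p.interiorPts, ∫ y, p.dens V V g y ∂p.mu := by
  rw [normH1, Real.sq_sqrt (innerH1_self_nonneg hV), innerH1_eq hV hV]

variable (p N) in
/-- `H_N^{1,h}` as a linear space. -/
def h1Submodule : Submodule ℝ (p.GridFun N) where
  carrier := {W | p.MemH1 W}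
  add_mem' := MemH1.add
  zero_mem' := memH1_zero
  smul_mem' c _ h := h.smul c

variable (p N) in
/-- The space `H_N^{1,h}`, a seminormed space: functions that agree at the interior grid points and
have equal differences there are not identified. -/
def H1 : Type := ↥(h1Submodule p N)

instance : AddCommGroup (p.H1 N) := inferInstanceAs (AddCommGroup ↥(h1Submodule p N))

instance : Module ℝ (p.H1 N) := inferInstanceAs (Module ℝ ↥(h1Submodule p N))

variable (p N) in
/-- The scalar product of `H_N^{1,h}`. -/
@[reducible]
def h1Core : PreInnerProductSpace.Core ℝ (p.H1 N) where
  inner V W := p.innerH1 V.1 W.1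
  conj_inner_symm _ _ := innerH1_comm _ _
  re_inner_nonneg V := innerH1_self_nonneg V.2
  add_left U V W := innerH1_add_left U.2 V.2 W.2
  smul_left V W c := innerH1_smul_left c V.2 W.2

instance : SeminormedAddCommGroup (p.H1 N) :=
  InnerProductSpace.Core.toSeminormedAddCommGroup (c := h1Core p N)

instance : InnerProductSpace ℝ (p.H1 N) := InnerProductSpace.ofCore (h1Core p N)

theorem H1.norm_def (V : p.H1 N) : ‖V‖ = p.normH1 V.1 := rfl

variable (p N) in
/-- The subspace `H_{N,0}^{1,h}`. -/
def H10 : Submodule ℝ (p.H1 N) where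
  carrier := {W | p.BdryEq W.1 0}
  add_mem' {V W} hV hW := by
    have h : p.BdryEq (V.1 + W.1) (0 + 0) := BdryEq.add hV hW
    rwa [add_zero] at h
  zero_mem' := ⟨fun _ _ => ⟨rfl, rfl⟩, fun _ _ _ _ _ => rfl⟩
  smul_mem' c W hW := by
    have h : p.BdryEq (c • W.1) (c • 0) := BdryEq.smul c hW
    rwa [smul_zero] at h

end Space

end Model

/-- The Riesz representation theorem in a complete seminormed space with a scalar product. -/
theorem exists_riesz {H : Type*} [SeminormedAddCommGroup H] [InnerProductSpace ℝ H]
    [CompleteSpace H] (l : H →L[ℝ] ℝ) : ∃ G : H, ∀ v, inner ℝ G v = l v := by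
  let l' : SeparationQuotient H →L[ℝ] ℝ :=
    SeparationQuotient.liftCLM l fun x y h => (h.map l.continuous).eq
  obtain ⟨G, hG⟩ := SeparationQuotient.surjective_mk ((InnerProductSpace.toDual ℝ _).symm l')
  refine ⟨G, fun v => ?_⟩
  rw [← SeparationQuotient.inner_mk_mk, hG, InnerProductSpace.toDual_symm_apply]
  rfl

namespace Model

variable {n : ℕ} {p : Model n} {N : ℕ}

/-! ### Functions with zero boundary values -/

theorem injective_shiftIndex (k : Fin n) (c : Fin (p.m + 1)) :
    Function.Injective fun g : p.Grid => Function.update g k (g k + c) := by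
  intro g g' h
  funext i
  have hi := congrFun h i
  by_cases hik : i = k
  · subst hik
    simpa using hi
  · simpa [Function.update_of_ne hik] using hi

/-- Shifting the argument does not increase the sum of squares. On `Fin (p.m + 1)` the shift wraps
around, so it permutes all grid points, and `v` vanishes at those that are not interior. -/
theorem sum_shift_sq_le {v : p.GridFun N} (hv : p.BdryEq v 0) {y : ℝ}
    (hy : y ∈ Set.Ioo p.a p.b) (k : Fin n) (c : Fin (p.m + 1)) (s : Fin N) :
    ∑ g ∈ p.interiorPts, v (Function.update g k (g k + c)) s y ^ 2
      ≤ ∑ g ∈ p.interiorPts, v g s y ^ 2 := by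
  have hbij := Finite.injective_iff_bijective.1 (injective_shiftIndex (p := p) k c)
  calc _ ≤ ∑ g : p.Grid, v (Function.update g k (g k + c)) s y ^ 2 :=
        Finset.sum_le_univ_sum_of_nonneg fun _ => sq_nonneg _
    _ = ∑ g : p.Grid, v g s y ^ 2 :=
        Function.Bijective.sum_comp hbij fun g => v g s y ^ 2
    _ = ∑ g ∈ p.interiorPts, v g s y ^ 2 := by
        symm
        refine Finset.sum_subset (Finset.subset_univ _) fun g _ hg => ?_
        rw [mem_interiorPts] at hg
        rw [hv.2 g hg s y hy]
        simp

/-- The central differences of a function with zero boundary values are controlled by its values: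
each neighbour of an interior grid point is interior or carries the value zero. -/
theorem sum_diffSq_le {v : p.GridFun N} (hv : p.BdryEq v 0) {h0 : ℝ} (h0pos : 0 < h0)
    (hh : h0 ≤ p.h) {y : ℝ} (hy : y ∈ Set.Ioo p.a p.b) :
    ∑ g ∈ p.interiorPts, p.diffSq v g y
      ≤ n / h0 ^ 2 * ∑ g ∈ p.interiorPts, p.valSq v g y := by
  have hpos : 0 < p.h := h0pos.trans_le hh
  have h1 : ∀ (k : Fin n) (s : Fin N), ∑ g ∈ p.interiorPts, p.dx v k g s y ^ 2
      ≤ 1 / h0 ^ 2 * ∑ g ∈ p.interiorPts, v g s y ^ 2 := by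
    intro k s
    have hp := sum_shift_sq_le hv hy k 1 s
    have hm := sum_shift_sq_le hv hy k (-1) s
    have hterm : ∀ g : p.Grid, p.dx v k g s y ^ 2 ≤ 1 / (2 * h0 ^ 2) *
        (v (Function.update g k (g k + 1)) s y ^ 2
          + v (Function.update g k (g k + -1)) s y ^ 2) := by
      intro g
      rw [dx, sub_eq_add_neg (g k), div_pow, div_le_iff₀ (by positivity)]
      set u := v (Function.update g k (g k + 1)) s y
      set w := v (Function.update g k (g k + -1)) s y
      have e : (2 * p.h) ^ 2 ≥ 4 * h0 ^ 2 := by nlinarith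
      calc (u - w) ^ 2 ≤ 2 * (u ^ 2 + w ^ 2) := by nlinarith [sq_nonneg (u + w)]
        _ = 1 / (2 * h0 ^ 2) * (u ^ 2 + w ^ 2) * (4 * h0 ^ 2) := by field_simp; ring
        _ ≤ _ := by gcongr
    calc _ ≤ ∑ g ∈ p.interiorPts, 1 / (2 * h0 ^ 2) *
        (v (Function.update g k (g k + 1)) s y ^ 2
          + v (Function.update g k (g k + -1)) s y ^ 2) := Finset.sum_le_sum fun g _ => hterm g
      _ ≤ 1 / (2 * h0 ^ 2) * (∑ g ∈ p.interiorPts, v g s y ^ 2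
          + ∑ g ∈ p.interiorPts, v g s y ^ 2) := by
        rw [← Finset.mul_sum, Finset.sum_add_distrib]
        gcongr
      _ = _ := by field_simp; ring
  simp only [diffSq, valSq]
  rw [Finset.sum_comm]
  calc _ ≤ ∑ k : Fin n, 1 / h0 ^ 2 * ∑ g ∈ p.interiorPts, ∑ s, v g s y ^ 2 := by
        refine Finset.sum_le_sum fun k _ => ?_
        rw [Finset.sum_comm, Finset.sum_comm (s := p.interiorPts), Finset.mul_sum]
        exact Finset.sum_le_sum fun s _ => h1 k s
    _ = _ := by
        rw [Finset.sum_const, Finset.card_univ, Fintype.card_fin, nsmul_eq_mul]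
        ring

section Space

variable [hab : Fact (p.a < p.b)] {V W v : p.GridFun N} {g : p.Grid}

theorem MemH1.integrable_valSq (hW : p.MemH1 W) (hg : p.Interior g) :
    Integrable (p.valSq W g) p.mu :=
  integrable_finsetSum _ fun s _ => (hW.memLp_val hg s).integrable_sq

omit hab in
theorem MemH1.integrable_derivSq (hW : p.MemH1 W) (hg : p.Interior g) :
    Integrable (p.derivSq W g) p.mu :=
  integrable_finsetSum _ fun s _ => (hW.memLp_deriv hg s).integrable_sq

omit hab in
theorem MemH1.integrable_diffSq (hW : p.MemH1 W) (hg : p.Interior g) :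
    Integrable (p.diffSq W g) p.mu :=
  integrable_finsetSum _ fun k _ => integrable_finsetSum _ fun s _ =>
    (hW.memLp_dx hg k s).integrable_sq

theorem BdryEq.val_sq_le (hv : p.MemH1 v) (hv0 : p.BdryEq v 0) (hg : p.Interior g) (s : Fin N)
    {y : ℝ} (hy : y ∈ Set.Icc p.a p.b) :
    v g s y ^ 2 ≤ (p.b - p.a) * ∫ t, deriv (v g s) t ^ 2 ∂p.mu := by
  have := sq_sub_le (hv.1 g hg s).1 (hv.1 g hg s).2 hy (Set.right_mem_Icc.2 hab.out.le)
  rwa [(hv0.1 g s).2, show (0 : p.GridFun N) g s p.b = 0 from rfl, sub_zero] at this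

omit hab in
theorem integral_derivSq (hv : p.MemH1 v) (hg : p.Interior g) :
    ∫ y, p.derivSq v g y ∂p.mu = ∑ s, ∫ t, deriv (v g s) t ^ 2 ∂p.mu :=
  integral_finsetSum _ fun s _ => (hv.memLp_deriv hg s).integrable_sq

theorem valSq_le_integral_derivSq (hv : p.MemH1 v) (hv0 : p.BdryEq v 0) (hg : p.Interior g)
    {y : ℝ} (hy : y ∈ Set.Icc p.a p.b) :
    p.valSq v g y ≤ (p.b - p.a) * ∫ t, p.derivSq v g t ∂p.mu := by
  rw [integral_derivSq hv hg, Finset.mul_sum]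
  exact Finset.sum_le_sum fun s _ => hv0.val_sq_le hv hg s hy

theorem integral_mu_const (c : ℝ) : ∫ _, c ∂p.mu = (p.b - p.a) * c := by
  rw [integral_const, measureReal_restrict_apply MeasurableSet.univ, Set.univ_inter,
    Real.volume_real_Ioo_of_le hab.out.le, smul_eq_mul]

theorem integral_mu_le {f : ℝ → ℝ} {c : ℝ} (hf : Integrable f p.mu)
    (h : ∀ y ∈ Set.Ioo p.a p.b, f y ≤ c) : ∫ y, f y ∂p.mu ≤ (p.b - p.a) * c := by
  rw [← integral_mu_const]
  exact setIntegral_mono_on hf (integrable_const _) measurableSet_Ioo h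

/-- A Poincaré inequality: on `H_{N,0}^{1,h}` the norm is controlled by the `y`-derivative. -/
theorem normH1_sq_le_derivSq (hv : p.MemH1 v) (hv0 : p.BdryEq v 0) {h0 : ℝ} (h0pos : 0 < h0)
    (hh : h0 ≤ p.h) :
    p.normH1 v ^ 2 ≤ ((n + n / h0 ^ 2) * (p.b - p.a) ^ 2 + n) *
      ∑ g ∈ p.interiorPts, ∫ y, p.derivSq v g y ∂p.mu := by
  have hint : ∀ g ∈ p.interiorPts, p.Interior g := fun g hg => mem_interiorPts.1 hg
  have hba : 0 < p.b - p.a := sub_pos.2 hab.out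
  rw [normH1_sq hv]
  have e1 : ∑ g ∈ p.interiorPts, ∫ y, p.dens v v g y ∂p.mu
      = n * (∑ g ∈ p.interiorPts, ∫ y, p.valSq v g y ∂p.mu)
        + (∫ y, ∑ g ∈ p.interiorPts, p.diffSq v g y ∂p.mu)
        + n * ∑ g ∈ p.interiorPts, ∫ y, p.derivSq v g y ∂p.mu := by
    rw [integral_finsetSum _ fun g hg => hv.integrable_diffSq (hint g hg), Finset.mul_sum,
      Finset.mul_sum, ← Finset.sum_add_distrib, ← Finset.sum_add_distrib]
    refine Finset.sum_congr rfl fun g hg => ?_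
    have i1 := (hv.integrable_valSq (hint g hg)).const_mul (n : ℝ)
    have i2 := hv.integrable_diffSq (hint g hg)
    have i3 := (hv.integrable_derivSq (hint g hg)).const_mul (n : ℝ)
    have i12 : Integrable (fun y => n * p.valSq v g y + p.diffSq v g y) p.mu := i1.add i2
    simp_rw [dens_self]
    rw [integral_add i12 i3, integral_add i1 i2, integral_const_mul, integral_const_mul]
  have e2 : ∫ y, ∑ g ∈ p.interiorPts, p.diffSq v g y ∂p.mu
      ≤ n / h0 ^ 2 * ∑ g ∈ p.interiorPts, ∫ y, p.valSq v g y ∂p.mu := by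
    rw [← integral_finsetSum _ fun g hg => hv.integrable_valSq (hint g hg), ← integral_const_mul]
    refine setIntegral_mono_on
      (integrable_finsetSum _ fun g hg => hv.integrable_diffSq (hint g hg))
      ((integrable_finsetSum _ fun g hg => hv.integrable_valSq (hint g hg)).const_mul _)
      measurableSet_Ioo fun y hy => sum_diffSq_le hv0 h0pos hh hy
  have e3 : ∑ g ∈ p.interiorPts, ∫ y, p.valSq v g y ∂p.mu
      ≤ (p.b - p.a) ^ 2 * ∑ g ∈ p.interiorPts, ∫ y, p.derivSq v g y ∂p.mu := by
    rw [Finset.mul_sum]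
    refine Finset.sum_le_sum fun g hg => ?_
    rw [pow_two, mul_assoc]
    exact integral_mu_le (hv.integrable_valSq (hint g hg)) fun y hy =>
      valSq_le_integral_derivSq hv hv0 (hint g hg) (Set.Ioo_subset_Icc_self hy)
  rw [e1]
  set S1 := ∑ g ∈ p.interiorPts, ∫ y, p.valSq v g y ∂p.mu
  set S3 := ∑ g ∈ p.interiorPts, ∫ y, p.derivSq v g y ∂p.mu
  calc _ ≤ n * S1 + n / h0 ^ 2 * S1 + n * S3 := by gcongr
    _ = (n + n / h0 ^ 2) * S1 + n * S3 := by ring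
    _ ≤ (n + n / h0 ^ 2) * ((p.b - p.a) ^ 2 * S3) + n * S3 := by gcongr
    _ = _ := by ring

theorem integral_dens_le (hW : p.MemH1 W) (hg : p.Interior g) :
    ∫ y, p.dens W W g y ∂p.mu ≤ p.normH1 W ^ 2 := by
  rw [normH1_sq hW]
  exact Finset.single_le_sum (f := fun g => ∫ y, p.dens W W g y ∂p.mu)
    (fun g _ => integral_nonneg fun y => dens_self_nonneg W g y) (mem_interiorPts.2 hg)

/-- A function with zero boundary values and norm zero vanishes. -/
theorem eq_zero_of_normH1_eq_zero (hn : 1 ≤ n) (hv : p.MemH1 v) (hv0 : p.BdryEq v 0)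
    (h : p.normH1 v = 0) (g : p.Grid) (s : Fin N) {y : ℝ} (hy : y ∈ Set.Icc p.a p.b) :
    v g s y = 0 := by
  by_cases hg : p.Interior g
  · have h1 : ∫ t, p.derivSq v g t ∂p.mu ≤ 0 := by
      have h2 := integral_dens_le hv hg
      rw [h] at h2
      refine le_trans (integral_mono (hv.integrable_derivSq hg) (integrable_dens hv hv hg)
        fun t => ?_) (h2.trans (by norm_num))
      rw [dens_self]
      have a1 := valSq_nonneg v g t
      have a2 := diffSq_nonneg v g t
      have a3 := derivSq_nonneg v g t
      have hn' : (1 : ℝ) ≤ n := by exact_mod_cast hn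
      nlinarith [mul_nonneg (Nat.cast_nonneg (α := ℝ) n) a1]
    have h3 := valSq_le_integral_derivSq hv hv0 hg hy
    have h4 : v g s y ^ 2 ≤ p.valSq v g y :=
      Finset.single_le_sum (f := fun s => v g s y ^ 2) (fun _ _ => sq_nonneg _)
        (Finset.mem_univ s)
    have h5 : v g s y ^ 2 ≤ 0 := by
      have := mul_nonpos_of_nonneg_of_nonpos (sub_pos.2 hab.out).le h1
      linarith
    exact pow_eq_zero_iff two_ne_zero |>.1 (le_antisymm h5 (sq_nonneg _))
  · rcases eq_or_lt_of_le hy.1 with h1 | h1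
    · rw [← h1]; exact (hv0.1 g s).1
    rcases eq_or_lt_of_le hy.2 with h2 | h2
    · rw [h2]; exact (hv0.1 g s).2
    exact hv0.2 g hg s y ⟨h1, h2⟩

/-! ### Completeness and Riesz representation -/

omit hab in
theorem norm_sq_Lp (f : Lp ℝ 2 p.mu) : ‖f‖ ^ 2 = ∫ y, f y ^ 2 ∂p.mu := by
  rw [← real_inner_self_eq_norm_sq, L2.inner_def]
  simp [pow_two]

variable (p N) in
/-- The `y`-derivative of one component at one interior grid point, as a map into `L²(a,b)`. -/
def derivLp (hn : 1 ≤ n) (g : {g : p.Grid // p.Interior g}) (s : Fin N) :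
    p.H1 N →L[ℝ] Lp ℝ 2 p.mu :=
  LinearMap.mkContinuous
    { toFun := fun W => (W.2.memLp_deriv g.2 s).toLp _
      map_add' := fun V W => by
        rw [← MemLp.toLp_add]
        refine MemLp.toLp_congr _ _ ?_
        filter_upwards [ae_deriv_add V.2 W.2] with y hy
        exact hy g.1 g.2 s
      map_smul' := fun c W => by
        rw [RingHom.id_apply, ← MemLp.toLp_const_smul]
        refine MemLp.toLp_congr _ _ ?_
        filter_upwards with y
        exact deriv_smul_apply c W.1 g.1 s y } 1 (by
      intro W
      rw [one_mul]
      refine abs_le_of_sq_le_sq' ?_ (norm_nonneg _) |>.2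
      rw [norm_sq_Lp, H1.norm_def]
      refine le_trans ?_ (integral_dens_le W.2 g.2)
      have hco := (W.2.memLp_deriv g.2 s).coeFn_toLp
      calc _ = ∫ y, deriv (W.1 g.1 s) y ^ 2 ∂p.mu := by
            refine integral_congr_ae ?_
            filter_upwards [hco] with y hy
            exact congrArg (· ^ 2) hy
        _ ≤ _ := by
            refine integral_mono (W.2.memLp_deriv g.2 s).integrable_sq
              (integrable_dens W.2 W.2 g.2) fun t => ?_
            rw [dens_self]
            have a1 := valSq_nonneg W.1 g.1 t
            have a2 := diffSq_nonneg W.1 g.1 t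
            have a3 := derivSq_nonneg W.1 g.1 t
            have a4 : deriv (W.1 g.1 s) t ^ 2 ≤ p.derivSq W.1 g.1 t :=
              Finset.single_le_sum (f := fun s => deriv (W.1 g.1 s) t ^ 2)
                (fun _ _ => sq_nonneg _) (Finset.mem_univ s)
            have hn' : (1 : ℝ) ≤ n := by exact_mod_cast hn
            have a5 := mul_nonneg (Nat.cast_nonneg (α := ℝ) n) a1
            show deriv (W.1 g.1 s) t ^ 2 ≤ _
            nlinarith)

theorem derivLp_coe (hn : 1 ≤ n) (g : {g : p.Grid // p.Interior g}) (s : Fin N) (W : p.H1 N) :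
    derivLp p N hn g s W =ᵐ[p.mu] deriv (W.1 g.1 s) :=
  (W.2.memLp_deriv g.2 s).coeFn_toLp

open Classical in
variable (p) in
/-- The function with given `y`-derivatives at the interior grid points, zero for `y = a` and at the
boundary grid points. -/
def primitive (f : {g : p.Grid // p.Interior g} → Fin N → ℝ → ℝ) : p.GridFun N :=
  fun g s y => if hg : p.Interior g then ∫ t in p.a..y, f ⟨g, hg⟩ s t else 0

omit hab in
theorem primitive_apply {f : {g : p.Grid // p.Interior g} → Fin N → ℝ → ℝ}
    (hg : p.Interior g) (s : Fin N) :
    p.primitive f g s = fun y => ∫ t in p.a..y, f ⟨g, hg⟩ s t := by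
  funext y; simp [primitive, hg]

omit hab in
theorem primitive_apply_of_not {f : {g : p.Grid // p.Interior g} → Fin N → ℝ → ℝ}
    (hg : ¬ p.Interior g) (s : Fin N) : p.primitive f g s = fun _ => 0 := by
  funext y; simp [primitive, hg]

theorem intervalIntegrable_of_memLp {f : ℝ → ℝ} (hf : MemLp f 2 p.mu) :
    IntervalIntegrable f volume p.a p.b := by
  rw [intervalIntegrable_iff_integrableOn_Ioo_of_le hab.out.le]
  exact hf.integrable (by norm_num)

theorem ae_deriv_primitive {f : {g : p.Grid // p.Interior g} → Fin N → ℝ → ℝ}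
    (hf : ∀ g s, MemLp (f g s) 2 p.mu) (g : {g : p.Grid // p.Interior g}) (s : Fin N) :
    deriv (p.primitive f g.1 s) =ᵐ[p.mu] f g s := by
  rw [primitive_apply g.2]
  change ∀ᵐ y ∂p.mu, _
  rw [ae_restrict_iff' measurableSet_Ioo]
  filter_upwards [(intervalIntegrable_of_memLp (hf g s)).ae_hasDerivAt_integral] with y hy hy'
  rw [Set.uIcc_of_le hab.out.le] at hy
  exact (hy (Set.Ioo_subset_Icc_self hy') p.a (Set.left_mem_Icc.2 hab.out.le)).deriv

theorem ac_primitive {f : {g : p.Grid // p.Interior g} → Fin N → ℝ → ℝ}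
    (hf : ∀ g s, MemLp (f g s) 2 p.mu) (g : p.Grid) (s : Fin N) :
    AbsolutelyContinuousOnInterval (p.primitive f g s) p.a p.b := by
  by_cases hg : p.Interior g
  · rw [primitive_apply hg]
    exact (intervalIntegrable_of_memLp
      (hf ⟨g, hg⟩ s)).absolutelyContinuousOnInterval_intervalIntegral Set.left_mem_uIcc
  · rw [primitive_apply_of_not hg]
    exact (LipschitzWith.const (0 : ℝ)).lipschitzOnWith.absolutelyContinuousOnInterval

theorem memH1_primitive {f : {g : p.Grid // p.Interior g} → Fin N → ℝ → ℝ}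
    (hf : ∀ g s, MemLp (f g s) 2 p.mu) : p.MemH1 (p.primitive f) := by
  refine ⟨fun g hg s => ⟨ac_primitive hf g s,
    (hf ⟨g, hg⟩ s).ae_eq (ae_deriv_primitive hf ⟨g, hg⟩ s).symm⟩, fun g hg k s => ?_⟩
  have hL : ∀ g', MemLp (p.primitive f g' s) 2 p.mu := fun g' =>
    memLp_of_continuousOn (continuousOn_Icc_of_ac hab.out.le (ac_primitive hf g' s)) 2
  have := ((hL (Function.update g k (g k + 1))).sub
    (hL (Function.update g k (g k - 1)))).const_mul (2 * p.h)⁻¹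
  refine this.ae_eq (Filter.Eventually.of_forall fun y => ?_)
  simp only [dx, Pi.sub_apply, div_eq_inv_mul]

theorem bdryEq_primitive {f : {g : p.Grid // p.Interior g} → Fin N → ℝ → ℝ}
    (hf : ∀ g s, ∫ y, f g s y ∂p.mu = 0) : p.BdryEq (p.primitive f) 0 := by
  refine ⟨fun g s => ?_, fun g hg s y _ => ?_⟩
  · by_cases hg : p.Interior g
    · rw [primitive_apply hg]
      refine ⟨by simp, ?_⟩
      simp only [interval_eq_integral_Ioo hab.out.le]
      exact hf _ _
    · rw [primitive_apply_of_not hg]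
      exact ⟨rfl, rfl⟩
  · rw [primitive_apply_of_not hg]; rfl

theorem integral_deriv_eq_zero (hv : p.MemH1 v) (hv0 : p.BdryEq v 0) (hg : p.Interior g)
    (s : Fin N) : ∫ y, deriv (v g s) y ∂p.mu = 0 := by
  rw [← interval_eq_integral_Ioo hab.out.le, (hv.1 g hg s).1.integral_deriv_eq_sub,
    (hv0.1 g s).1, (hv0.1 g s).2]
  simp

open Filter Topology in
/-- `H_{N,0}^{1,h}` is complete: the limit of a Cauchy sequence is the primitive of the limits in
`L²(a,b)` of the `y`-derivatives. -/
theorem completeSpace_H10 (hn : 1 ≤ n) (hh : 0 < p.h) : CompleteSpace (H10 p N) := by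
  refine Metric.complete_of_cauchySeq_tendsto fun u hu => ?_
  have hu' : CauchySeq fun k => (u k : p.H1 N) := hu.map uniformContinuous_subtype_val
  have hF : ∀ g s, ∃ f : Lp ℝ 2 p.mu,
      Tendsto (fun k => derivLp p N hn g s (u k)) atTop (𝓝 f) := fun g s =>
    cauchySeq_tendsto_of_complete (hu'.map (derivLp p N hn g s).uniformContinuous)
  choose f hf using hF
  have hfL : ∀ g s, MemLp (f g s) 2 p.mu := fun g s => Lp.memLp _
  have hdist : ∀ g s, Tendsto (fun k => ∫ y, (deriv ((u k).1.1 g.1 s) y - f g s y) ^ 2 ∂p.mu)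
      atTop (𝓝 0) := by
    intro g s
    have h1 : Tendsto (fun k => ‖derivLp p N hn g s (u k) - f g s‖ ^ 2) atTop (𝓝 0) := by
      have := (tendsto_iff_norm_sub_tendsto_zero.1 (hf g s)).pow 2
      simpa using this
    refine h1.congr fun k => ?_
    rw [norm_sq_Lp]
    refine integral_congr_ae ?_
    filter_upwards [Lp.coeFn_sub (derivLp p N hn g s (u k)) (f g s), derivLp_coe hn g s (u k)]
      with y h2 h3
    rw [h2, Pi.sub_apply, h3]
  have hdiffL : ∀ g s k, MemLp (fun y => deriv ((u k).1.1 g.1 s) y - f g s y) 2 p.mu :=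
    fun g s k => ((u k).1.2.memLp_deriv g.2 s).sub (hfL g s)
  -- The derivatives have mean zero, hence so do their limits, and the primitives vanish at `y = b`.
  have hmean : ∀ g s, ∫ y, f g s y ∂p.mu = 0 := by
    intro g s
    have h1 : ∀ k, (∫ y, f g s y ∂p.mu) ^ 2
        ≤ (p.mu).real Set.univ * ∫ y, (deriv ((u k).1.1 g.1 s) y - f g s y) ^ 2 ∂p.mu := by
      intro k
      have h2 := sq_integral_le (hdiffL g s k)
      rw [integral_sub (((u k).1.2.memLp_deriv g.2 s).integrable (by norm_num))
        ((hfL g s).integrable (by norm_num)),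
        integral_deriv_eq_zero (u k).1.2 (u k).2 g.2 s, zero_sub, neg_sq] at h2
      exact h2
    have h3 : Tendsto (fun k => (p.mu).real Set.univ *
        ∫ y, (deriv ((u k).1.1 g.1 s) y - f g s y) ^ 2 ∂p.mu) atTop (𝓝 0) := by
      simpa using (hdist g s).const_mul ((p.mu).real Set.univ)
    exact pow_eq_zero_iff two_ne_zero |>.1
      (le_antisymm (ge_of_tendsto' h3 h1) (sq_nonneg _))
  let v : H10 p N := ⟨⟨p.primitive fun g s => f g s, memH1_primitive hfL⟩, bdryEq_primitive hmean⟩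
  refine ⟨v, ?_⟩
  rw [tendsto_iff_norm_sub_tendsto_zero]
  set C : ℝ := (n + n / p.h ^ 2) * (p.b - p.a) ^ 2 + n
  -- By the Poincaré inequality, convergence of the derivatives suffices.
  have hbound : ∀ k, ‖u k - v‖ ^ 2 ≤ C * ∑ g ∈ p.interiorPts.attach, ∑ s,
      ∫ y, (deriv ((u k).1.1 g.1 s) y - f ⟨g.1, mem_interiorPts.1 g.2⟩ s y) ^ 2 ∂p.mu := by
    intro k
    have h1 : p.normH1 (u k - v).1.1 ^ 2 ≤ _ :=
      normH1_sq_le_derivSq (u k - v).1.2 (u k - v).2 hh le_rfl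
    refine h1.trans (le_of_eq ?_)
    congr 1
    rw [← Finset.sum_attach]
    refine Finset.sum_congr rfl fun g _ => ?_
    have hg := mem_interiorPts.1 g.2
    rw [integral_derivSq (u k - v).1.2 hg]
    refine Finset.sum_congr rfl fun s _ => integral_congr_ae ?_
    have hv : ((u k - v).1.1 : p.GridFun N) = (u k).1.1 + (-1 : ℝ) • v.1.1 := by
      rw [neg_one_smul, ← sub_eq_add_neg]; rfl
    filter_upwards [ae_deriv_add (u k).1.2 (v.1.2.smul (-1)), ae_deriv_primitive hfL ⟨g.1, hg⟩ s]
      with y h2 h3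
    rw [hv, h2 g.1 hg s, deriv_smul_apply, show deriv (v.1.1 g.1 s) y = _ from h3]
    ring
  have hlim : Tendsto (fun k => C * ∑ g ∈ p.interiorPts.attach, ∑ s,
      ∫ y, (deriv ((u k).1.1 g.1 s) y - f ⟨g.1, mem_interiorPts.1 g.2⟩ s y) ^ 2 ∂p.mu)
      atTop (𝓝 0) := by
    have h1 : Tendsto (fun k => C * ∑ g ∈ p.interiorPts.attach, ∑ s,
      ∫ y, (deriv ((u k).1.1 g.1 s) y - f ⟨g.1, mem_interiorPts.1 g.2⟩ s y) ^ 2 ∂p.mu)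
      atTop (𝓝 (C * ∑ g ∈ p.interiorPts.attach, ∑ s : Fin N, 0)) :=
      (tendsto_finsetSum _ fun g _ => tendsto_finsetSum _ fun s _ =>
        hdist ⟨g.1, mem_interiorPts.1 g.2⟩ s).const_mul C
    simpa using h1
  have hsq : Tendsto (fun k => ‖u k - v‖ ^ 2) atTop (𝓝 0) :=
    squeeze_zero (fun _ => sq_nonneg _) hbound hlim
  have := hsq.sqrt
  simpa [Real.sqrt_sq (norm_nonneg _)] using this

end Space

end Model

/-! ### Strongly convex functionals on balls of an affine subspace -/

section Hilbert

open Filter Topology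

variable {E : Type*} [SeminormedAddCommGroup E] [InnerProductSpace ℝ E] (H : Submodule ℝ E)

/-- The part of the closed ball of radius `R` that lies in the affine subspace `S + H`. -/
def affineBall (S : E) (R : ℝ) : Set E := {w | w - S ∈ H ∧ ‖w‖ ≤ R}

/-- `J` is strongly convex on `C` with modulus `μ` and the gradient `G`. -/
def StronglyConvexOn (C : Set E) (J : E → ℝ) (G : E → E) (μ : ℝ) : Prop :=
  ∀ w₁ ∈ C, ∀ w₂ ∈ C, μ * ‖w₂ - w₁‖ ^ 2 ≤ J w₂ - J w₁ - inner ℝ (G w₁) (w₂ - w₁)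

/-- The first order Taylor remainder of `J` with the gradient `G` is at most quadratic on `C`. -/
def QuadraticRemainderOn (C : Set E) (J : E → ℝ) (G : E → E) (L : ℝ) : Prop :=
  ∀ w₁ ∈ C, ∀ w₂ ∈ C, |J w₂ - J w₁ - inner ℝ (G w₁) (w₂ - w₁)| ≤ L * ‖w₂ - w₁‖ ^ 2

variable {H} {S : E} {R μ L : ℝ} {J : E → ℝ} {G : E → E}

theorem affineBall_sub_mem {w₁ w₂ : E} (h₁ : w₁ ∈ affineBall H S R)
    (h₂ : w₂ ∈ affineBall H S R) : w₂ - w₁ ∈ H := by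
  have := H.sub_mem h₂.1 h₁.1
  simpa using this

theorem affineBall_segment {w₁ w₂ : E} (h₁ : w₁ ∈ affineBall H S R)
    (h₂ : w₂ ∈ affineBall H S R) {t : ℝ} (t0 : 0 ≤ t) (t1 : t ≤ 1) :
    w₁ + t • (w₂ - w₁) ∈ affineBall H S R := by
  constructor
  · have : w₁ + t • (w₂ - w₁) - S = (w₁ - S) + t • (w₂ - w₁) := by abel
    rw [this]
    exact H.add_mem h₁.1 (H.smul_mem t (affineBall_sub_mem h₁ h₂))
  · have : w₁ + t • (w₂ - w₁) = (1 - t) • w₁ + t • w₂ := by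
      rw [smul_sub, sub_smul, one_smul]; abel
    rw [this]
    calc _ ≤ ‖(1 - t) • w₁‖ + ‖t • w₂‖ := norm_add_le _ _
      _ = (1 - t) * ‖w₁‖ + t * ‖w₂‖ := by
        rw [norm_smul, norm_smul, Real.norm_of_nonneg t0, Real.norm_of_nonneg (sub_nonneg.2 t1)]
      _ ≤ (1 - t) * R + t * R := by
        have := h₁.2
        have := h₂.2
        have := sub_nonneg.2 t1
        gcongr
      _ = R := by ring

/-- A strongly convex functional that is bounded below attains its minimum: minimizing sequences
are Cauchy, by convexity at the midpoints. -/
theorem exists_minimizer [CompleteSpace H] (hμ : 0 < μ) (hS : ‖S‖ ≤ R) (hJ : ∀ w, 0 ≤ J w)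
    (hc : StronglyConvexOn (affineBall H S R) J G μ) :
    ∃ w ∈ affineBall H S R, ∀ w' ∈ affineBall H S R, J w ≤ J w' := by
  set C := affineBall H S R
  have hSC : S ∈ C := ⟨by simp, hS⟩
  set m := sInf (J '' C)
  have hbdd : BddBelow (J '' C) := ⟨0, by rintro _ ⟨w, _, rfl⟩; exact hJ w⟩
  have hm : ∀ w ∈ C, m ≤ J w := fun w hw => csInf_le hbdd ⟨w, hw, rfl⟩
  have hseq : ∀ k : ℕ, ∃ w ∈ C, J w < m + 1 / ((k : ℝ) + 1) := by
    intro k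
    obtain ⟨_, ⟨w, hw, rfl⟩, h⟩ := exists_lt_of_csInf_lt (s := J '' C) ⟨_, S, hSC, rfl⟩
      (show m < m + 1 / ((k : ℝ) + 1) by have : (0 : ℝ) < 1 / ((k : ℝ) + 1) := by positivity
                                         linarith)
    exact ⟨w, hw, h⟩
  choose w hwC hw using hseq
  -- The strong convexity inequalities at the midpoint of `w i` and `w j`, added up.
  have hmid : ∀ i j, μ / 2 * ‖w i - w j‖ ^ 2 ≤ J (w i) + J (w j) - 2 * m := by
    intro i j
    set z := w j + (1 / 2 : ℝ) • (w i - w j)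
    have hz : z ∈ C := affineBall_segment (hwC j) (hwC i) (by norm_num) (by norm_num)
    have h1 := hc z hz (w i) (hwC i)
    have h2 := hc z hz (w j) (hwC j)
    have e1 : w i - z = (1 / 2 : ℝ) • (w i - w j) := by
      have : w i - w j = (1 / 2 : ℝ) • (w i - w j) + (1 / 2 : ℝ) • (w i - w j) := by
        rw [← add_smul]; norm_num
      calc w i - z = (w i - w j) - (1 / 2 : ℝ) • (w i - w j) := by simp only [z]; abel
        _ = _ := by nth_rewrite 1 [this]; abel
    have e2 : w j - z = -((1 / 2 : ℝ) • (w i - w j)) := by simp [z]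
    rw [e1, norm_smul, Real.norm_of_nonneg (by norm_num)] at h1
    rw [e2, norm_neg, norm_smul, Real.norm_of_nonneg (by norm_num), inner_neg_right] at h2
    have := hm z hz
    nlinarith
  have hcau : CauchySeq w := by
    refine cauchySeq_of_le_tendsto_0 (fun k : ℕ => Real.sqrt (4 / μ * (1 / ((k : ℝ) + 1))))
      (fun i j k hi hj => ?_) ?_
    · rw [dist_eq_norm]
      refine Real.le_sqrt_of_sq_le ?_
      have h1 := hmid i j
      have h2 : 1 / ((i : ℝ) + 1) ≤ 1 / ((k : ℝ) + 1) := by gcongr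
      have h3 : 1 / ((j : ℝ) + 1) ≤ 1 / ((k : ℝ) + 1) := by gcongr
      have h4 := hw i
      have h5 := hw j
      rw [div_mul_eq_mul_div, le_div_iff₀ hμ]
      nlinarith
    · have h1 : Tendsto (fun k : ℕ => 4 / μ * (1 / ((k : ℝ) + 1))) atTop (𝓝 0) := by
        simpa using (tendsto_one_div_add_atTop_nhds_zero_nat (𝕜 := ℝ)).const_mul (4 / μ)
      simpa using h1.sqrt
  have hcauH : CauchySeq fun k => (⟨w k - S, (hwC k).1⟩ : H) := by
    rw [Metric.cauchySeq_iff] at hcau ⊢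
    intro ε hε
    obtain ⟨K, hK⟩ := hcau ε hε
    refine ⟨K, fun i hi j hj => ?_⟩
    have := hK i hi j hj
    rw [dist_eq_norm] at this
    rw [dist_eq_norm, Submodule.coe_norm, Submodule.coe_sub]
    simpa using this
  obtain ⟨v, hv⟩ := cauchySeq_tendsto_of_complete hcauH
  set z : E := S + v
  have hlim : Tendsto w atTop (𝓝 z) := by
    have h1 : Tendsto (fun k => w k - S) atTop (𝓝 (v : E)) :=
      (continuous_subtype_val.tendsto v).comp hv
    simpa [z] using h1.const_add S
  have hzC : z ∈ C := by
    refine ⟨by simp [z], ?_⟩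
    exact le_of_tendsto hlim.norm (Eventually.of_forall fun k => (hwC k).2)
  refine ⟨z, hzC, fun w' hw' => ?_⟩
  -- `J` need not be continuous: the strong convexity inequality at `z` gives lower semicontinuity.
  have hle : ∀ k : ℕ, J z ≤ m + 1 / ((k : ℝ) + 1) + ‖G z‖ * ‖w k - z‖ := by
    intro k
    have h1 := hc z hzC (w k) (hwC k)
    have h2 := hw k
    have h3 := neg_le_of_abs_le (abs_real_inner_le_norm (G z) (w k - z))
    have h4 : 0 ≤ μ * ‖w k - z‖ ^ 2 := by positivity
    linarith
  have hlim2 : Tendsto (fun k : ℕ => m + 1 / ((k : ℝ) + 1) + ‖G z‖ * ‖w k - z‖) atTop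
      (𝓝 (m + 0 + ‖G z‖ * 0)) :=
    ((tendsto_one_div_add_atTop_nhds_zero_nat (𝕜 := ℝ)).const_add m).add
      ((tendsto_iff_norm_sub_tendsto_zero.1 hlim).const_mul _)
  have := ge_of_tendsto' hlim2 hle
  simp only [add_zero, mul_zero] at this
  exact this.trans (hm w' hw')

/-- The variational inequality at a minimizer over a convex set. -/
theorem inner_nonneg_of_minimizer (hL : QuadraticRemainderOn (affineBall H S R) J G L) {w w' : E}
    (hw : w ∈ affineBall H S R) (hw' : w' ∈ affineBall H S R)
    (hmin : ∀ z ∈ affineBall H S R, J w ≤ J z) : 0 ≤ inner ℝ (G w) (w' - w) := by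
  by_contra hneg
  push Not at hneg
  set q := inner ℝ (G w) (w' - w)
  set B := |L| * ‖w' - w‖ ^ 2
  have hB : 0 ≤ B := by positivity
  have key : ∀ t : ℝ, 0 < t → t ≤ 1 → 0 ≤ q + t * B := by
    intro t t0 t1
    have hz := affineBall_segment hw hw' t0.le t1
    have h1 := le_of_abs_le (hL w hw _ hz)
    have h2 := hmin _ hz
    rw [add_sub_cancel_left, inner_smul_right, norm_smul, Real.norm_of_nonneg t0.le] at h1
    have h3 : L * (t * ‖w' - w‖) ^ 2 ≤ t ^ 2 * B := by
      have := mul_le_mul_of_nonneg_right (le_abs_self L)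
        (show 0 ≤ t ^ 2 * ‖w' - w‖ ^ 2 by positivity)
      simp only [B]; nlinarith
    have h4 : 0 ≤ t * (q + t * B) := by
      change J (w + t • (w' - w)) - J w - t * q ≤ _ at h1
      nlinarith
    exact nonneg_of_mul_nonneg_right h4 t0
  have ht : 0 < min 1 (-q / (2 * (B + 1))) := lt_min one_pos (by apply div_pos <;> linarith)
  have h1 := key _ ht (min_le_left _ _)
  have h2 : min 1 (-q / (2 * (B + 1))) * B ≤ -q / 2 := by
    calc _ ≤ -q / (2 * (B + 1)) * B := by gcongr; exact min_le_right _ _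
      _ = -q / 2 * (B / (B + 1)) := by field_simp
      _ ≤ -q / 2 * 1 := by
        gcongr
        · linarith
        · rw [div_le_one (by linarith)]; linarith
      _ = _ := by ring
  linarith

/-- Quadratic growth away from a minimizer. -/
theorem mul_norm_sq_le_of_minimizer (hc : StronglyConvexOn (affineBall H S R) J G μ)
    (hL : QuadraticRemainderOn (affineBall H S R) J G L) {w w' : E}
    (hw : w ∈ affineBall H S R) (hw' : w' ∈ affineBall H S R)
    (hmin : ∀ z ∈ affineBall H S R, J w ≤ J z) : μ * ‖w' - w‖ ^ 2 ≤ J w' - J w := by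
  have h1 := hc w hw w' hw'
  have h2 := inner_nonneg_of_minimizer hL hw hw' hmin
  linarith

theorem norm_sub_eq_zero_of_minimizers (hμ : 0 < μ)
    (hc : StronglyConvexOn (affineBall H S R) J G μ)
    (hL : QuadraticRemainderOn (affineBall H S R) J G L) {w w' : E}
    (hw : w ∈ affineBall H S R) (hw' : w' ∈ affineBall H S R)
    (hmin : ∀ z ∈ affineBall H S R, J w ≤ J z) (hmin' : ∀ z ∈ affineBall H S R, J w' ≤ J z) :
    ‖w' - w‖ = 0 := by
  have h1 := mul_norm_sq_le_of_minimizer hc hL hw hw' hmin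
  have h2 := hmin' w hw
  have h3 : ‖w' - w‖ ^ 2 ≤ 0 := by
    by_contra h
    push Not at h
    have := mul_pos hμ h
    linarith
  exact pow_eq_zero_iff two_ne_zero |>.1 (le_antisymm h3 (sq_nonneg _))

/-- At a minimizer in the open ball the gradient vanishes. -/
theorem norm_grad_eq_zero_of_minimizer (hGH : ∀ w, G w ∈ H)
    (hL : QuadraticRemainderOn (affineBall H S R) J G L) {w : E}
    (hw : w - S ∈ H) (hwR : ‖w‖ < R) (hmin : ∀ z ∈ affineBall H S R, J w ≤ J z) :
    ‖G w‖ = 0 := by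
  set ε := (R - ‖w‖) / (‖G w‖ + 1)
  have hε : 0 < ε := div_pos (sub_pos.2 hwR) (by positivity)
  have hεle : ε * ‖G w‖ ≤ R - ‖w‖ := by
    have : ε * (‖G w‖ + 1) = R - ‖w‖ := div_mul_cancel₀ _ (by positivity)
    nlinarith
  have hz : w - ε • G w ∈ affineBall H S R := by
    refine ⟨?_, ?_⟩
    · have : w - ε • G w - S = (w - S) - ε • G w := by abel
      rw [this]
      exact H.sub_mem hw (H.smul_mem _ (hGH w))
    · refine (norm_sub_le _ _).trans ?_
      rw [norm_smul, Real.norm_of_nonneg hε.le]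
      linarith
  have h1 := inner_nonneg_of_minimizer hL ⟨hw, hwR.le⟩ hz hmin
  rw [sub_sub_cancel_left, inner_neg_right, inner_smul_right, real_inner_self_eq_norm_sq] at h1
  have h2 : ‖G w‖ ^ 2 ≤ 0 := by
    by_contra h
    push Not at h
    have := mul_pos hε h
    linarith
  exact pow_eq_zero_iff two_ne_zero |>.1 (le_antisymm h2 (sq_nonneg _))

/-- A quadratic bound of the Taylor remainder on a ball makes the gradient Lipschitz continuous on
a smaller ball: compare the remainders between the points `w₁`, `w₂` and `w₂ + v`, where `v` is the
multiple of `G w₂ - G w₁` of norm about `‖w₂ - w₁‖`. -/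
theorem norm_grad_sub_le (hR : 0 < R) (hGH : ∀ w, G w ∈ H) (hL0 : 0 ≤ L)
    (hL : QuadraticRemainderOn (affineBall H S (4 * R)) J G L) {w₁ w₂ : E}
    (h₁ : w₁ ∈ affineBall H S R) (h₂ : w₂ ∈ affineBall H S R) :
    ‖G w₂ - G w₁‖ ≤ 6 * L * ‖w₂ - w₁‖ := by
  set d := ‖w₂ - w₁‖
  set g := G w₂ - G w₁
  have hd : 0 ≤ d := norm_nonneg _
  have hd2 : d ≤ 2 * R := (norm_sub_le _ _).trans (by linarith [h₁.2, h₂.2])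
  have mono : ∀ w ∈ affineBall H S R, w ∈ affineBall H S (4 * R) := fun w hw =>
    ⟨hw.1, hw.2.trans (by linarith)⟩
  have hgH : g ∈ H := H.sub_mem (hGH _) (hGH _)
  -- A radius `r > d` is allowed since `d` may vanish.
  have key : ∀ r : ℝ, 0 < r → d ≤ r → r ≤ 3 * R → ‖g‖ ≤ 6 * L * r := by
    intro r r0 hdr hrR
    by_cases hg0 : ‖g‖ = 0
    · rw [hg0]; positivity
    have hgpos : 0 < ‖g‖ := lt_of_le_of_ne (norm_nonneg _) (Ne.symm hg0)
    set v := (r / ‖g‖) • g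
    have hvn : ‖v‖ = r := by
      rw [norm_smul, Real.norm_of_nonneg (by positivity), div_mul_cancel₀ _ hg0]
    have hvH : v ∈ H := H.smul_mem _ hgH
    have hw2v : w₂ + v ∈ affineBall H S (4 * R) := by
      refine ⟨?_, ?_⟩
      · have : w₂ + v - S = (w₂ - S) + v := by abel
        rw [this]; exact H.add_mem h₂.1 hvH
      · refine (norm_add_le _ _).trans ?_
        rw [hvn]; linarith [h₂.2]
    have e1 := hL w₂ (mono _ h₂) _ hw2v
    have e2 := hL w₁ (mono _ h₁) _ hw2v
    have e3 := hL w₁ (mono _ h₁) _ (mono _ h₂)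
    have hs : w₂ + v - w₁ = (w₂ - w₁) + v := by abel
    rw [add_sub_cancel_left, hvn] at e1
    rw [hs, inner_add_right] at e2
    have hn : ‖w₂ - w₁ + v‖ ≤ 2 * r := (norm_add_le _ _).trans (by rw [hvn]; linarith)
    have hn2 : L * ‖w₂ - w₁ + v‖ ^ 2 ≤ L * (2 * r) ^ 2 := by gcongr
    have hd3 : L * d ^ 2 ≤ L * r ^ 2 := by gcongr
    have hin : inner ℝ (G w₂) v - inner ℝ (G w₁) v = r * ‖g‖ := by
      rw [← inner_sub_left, inner_smul_right, real_inner_self_eq_norm_sq]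
      field_simp
      rfl
    have a1 := abs_le.1 e1
    have a2 := abs_le.1 e2
    have a3 := abs_le.1 e3
    have hfin : r * ‖g‖ ≤ r * (6 * L * r) := by
      change _ ∧ _ ≤ L * d ^ 2 at a3
      nlinarith [a1.1, a1.2, a2.1, a2.2, a3.1, a3.2]
    exact le_of_mul_le_mul_left hfin r0
  refine le_of_forall_pos_le_add fun ε hε => ?_
  set η := min R (ε / (6 * L + 1))
  have hη : 0 < η := lt_min hR (by positivity)
  have h1 := key (d + η) (by linarith) (by linarith) (by linarith [min_le_left R (ε / (6 * L + 1))])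
  have h2 : 6 * L * η ≤ ε := by
    calc 6 * L * η ≤ 6 * L * (ε / (6 * L + 1)) := by gcongr; exact min_le_right _ _
      _ = ε * (6 * L / (6 * L + 1)) := by ring
      _ ≤ ε * 1 := by
        gcongr
        rw [div_le_one (by positivity)]; linarith
      _ = ε := mul_one ε
  linarith

/-- Gradient descent from `B(R/3)` towards a critical point in `B(R/3)` contracts geometrically and
stays in the ball of radius `R`. -/
theorem exists_descent_rate (hR : 0 < R) (hμ : 0 < μ) (hGH : ∀ w, G w ∈ H) (hL0 : 0 ≤ L)
    (hc : StronglyConvexOn (affineBall H S R) J G μ)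
    (hL : QuadraticRemainderOn (affineBall H S (4 * R)) J G L) {z : E} (hzS : z - S ∈ H)
    (hzR : ‖z‖ < R / 3) (hGz : ‖G z‖ = 0) :
    ∃ γ₀ : ℝ, 0 < γ₀ ∧ ∀ γ : ℝ, 0 < γ → γ ≤ γ₀ → ∃ θ : ℝ, 0 < θ ∧ θ < 1 ∧
      ∀ w : ℕ → E, (∀ k, w (k + 1) = w k - γ • G (w k)) → w 0 - S ∈ H → ‖w 0‖ < R / 3 →
      ∀ k, w k - S ∈ H ∧ ‖w k‖ < R ∧ ‖w k - z‖ ≤ θ ^ k * ‖w 0 - z‖ := by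
  have hz : z ∈ affineBall H S R := ⟨hzS, by linarith⟩
  -- The gradient is Lipschitz continuous with the constant `6 * L`. The second bound of `γ` gives
  -- `γ² ‖G x‖² ≤ γ μ ‖x - z‖²`, and the first one keeps `θ² = 1 - μ γ` positive.
  refine ⟨min (1 / (2 * μ)) (μ / (36 * L ^ 2 + 1)), lt_min (by positivity) (by positivity),
    fun γ hγ hγ0 => ?_⟩
  have hγ1 : μ * γ ≤ 1 / 2 := by
    have := hγ0.trans (min_le_left _ _)
    rw [le_div_iff₀ (by positivity)] at this
    linarith
  have hγ2 : γ * (36 * L ^ 2) ≤ μ := by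
    have := hγ0.trans (min_le_right _ _)
    rw [le_div_iff₀ (by positivity)] at this
    linarith
  have hpos : 0 < 1 - μ * γ := by linarith
  refine ⟨Real.sqrt (1 - μ * γ), Real.sqrt_pos.2 hpos, ?_, fun w hstep h0 h0R => ?_⟩
  · rw [Real.sqrt_lt' one_pos]
    nlinarith [mul_pos hμ hγ]
  set θ := Real.sqrt (1 - μ * γ)
  have hθ0 : 0 ≤ θ := Real.sqrt_nonneg _
  have hθsq : θ ^ 2 = 1 - μ * γ := Real.sq_sqrt hpos.le
  have hθ1 : θ ≤ 1 := by
    have := mul_pos hμ hγ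
    exact Real.sqrt_le_one.2 (by linarith)
  have hcontr : ∀ x ∈ affineBall H S R, ‖x - γ • G x - z‖ ≤ θ * ‖x - z‖ := by
    intro x hx
    have h1 := hc x hx z hz
    have h2 := hc z hz x hx
    have h3 : inner ℝ (G z) (x - z) = 0 := by
      have := abs_real_inner_le_norm (G z) (x - z)
      rw [hGz, zero_mul] at this
      exact abs_nonpos_iff.1 this
    have h4 : ‖G x‖ ≤ 6 * L * ‖x - z‖ := by
      have a := norm_grad_sub_le hR hGH hL0 hL hz hx
      have b : ‖G x‖ ≤ ‖G x - G z‖ + ‖G z‖ := by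
        simpa using norm_add_le (G x - G z) (G z)
      linarith
    have h5 : inner ℝ (G x) (z - x) = -inner ℝ (G x) (x - z) := by
      rw [← inner_neg_right, neg_sub]
    rw [norm_sub_rev, h5] at h1
    rw [h3] at h2
    have h6 : 2 * μ * ‖x - z‖ ^ 2 ≤ inner ℝ (G x) (x - z) := by linarith
    have h7 : ‖x - γ • G x - z‖ ^ 2
        = ‖x - z‖ ^ 2 - 2 * γ * inner ℝ (G x) (x - z) + γ ^ 2 * ‖G x‖ ^ 2 := by
      have : x - γ • G x - z = (x - z) - γ • G x := by abel
      rw [this, norm_sub_sq_real, inner_smul_right, norm_smul, Real.norm_of_nonneg hγ.le,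
        real_inner_comm]
      ring
    have h8 : ‖G x‖ ^ 2 ≤ 36 * L ^ 2 * ‖x - z‖ ^ 2 := by
      calc ‖G x‖ ^ 2 ≤ (6 * L * ‖x - z‖) ^ 2 := by gcongr
        _ = _ := by ring
    refine le_of_sq_le_sq ?_ (by positivity)
    rw [h7, mul_pow, hθsq]
    have h9 : γ ^ 2 * ‖G x‖ ^ 2 ≤ γ * μ * ‖x - z‖ ^ 2 := by
      calc γ ^ 2 * ‖G x‖ ^ 2 ≤ γ ^ 2 * (36 * L ^ 2 * ‖x - z‖ ^ 2) := by gcongr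
        _ = γ * (γ * (36 * L ^ 2)) * ‖x - z‖ ^ 2 := by ring
        _ ≤ γ * μ * ‖x - z‖ ^ 2 := by gcongr
    have h10 := mul_le_mul_of_nonneg_left h6 hγ.le
    nlinarith [sq_nonneg ‖x - z‖, mul_pos hμ hγ,
      mul_nonneg (mul_pos hμ hγ).le (sq_nonneg ‖x - z‖)]
  intro k
  induction k with
  | zero => exact ⟨h0, by linarith, by simp⟩
  | succ k ih =>
    obtain ⟨i1, i2, i3⟩ := ih
    have hx : w k ∈ affineBall H S R := ⟨i1, i2.le⟩
    have h1 : ‖w (k + 1) - z‖ ≤ θ ^ (k + 1) * ‖w 0 - z‖ := by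
      rw [hstep k]
      calc _ ≤ θ * ‖w k - z‖ := hcontr _ hx
        _ ≤ θ * (θ ^ k * ‖w 0 - z‖) := by gcongr
        _ = _ := by ring
    refine ⟨?_, ?_, h1⟩
    · rw [hstep k]
      have : w k - γ • G (w k) - S = (w k - S) - γ • G (w k) := by abel
      rw [this]
      exact H.sub_mem i1 (H.smul_mem _ (hGH _))
    · have h2 : θ ^ (k + 1) * ‖w 0 - z‖ ≤ ‖w 0 - z‖ :=
        mul_le_of_le_one_left (norm_nonneg _) (pow_le_one₀ hθ0 hθ1)
      have h3 : ‖w 0 - z‖ ≤ ‖w 0‖ + ‖z‖ := norm_sub_le _ _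
      have h4 : ‖w (k + 1)‖ ≤ ‖w (k + 1) - z‖ + ‖z‖ := by
        simpa using norm_add_le (w (k + 1) - z) z
      linarith

end Hilbert

/-! ### The residual: pointwise estimates -/

theorem sq_sum_mul_le {ι : Type*} [Fintype ι] {C : ℝ} {a : ι → ℝ} (b : ι → ℝ)
    (ha : ∀ i, |a i| ≤ C) :
    (∑ i, a i * b i) ^ 2 ≤ Fintype.card ι * C ^ 2 * ∑ i, b i ^ 2 := by
  refine (Finset.sum_mul_sq_le_sq_mul_sq _ _ _).trans ?_
  refine mul_le_mul_of_nonneg_right ?_ (Finset.sum_nonneg fun _ _ => sq_nonneg _)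
  calc ∑ i, a i ^ 2 ≤ ∑ _i : ι, C ^ 2 := Finset.sum_le_sum fun i _ => by
        rw [← sq_abs]
        exact pow_le_pow_left₀ (abs_nonneg _) (ha i) 2
    _ = _ := by simp

namespace Model

variable {n : ℕ} {p : Model n} {N : ℕ}

/-- The properties of the coefficients that the convexity of `J_λ` depends on: `D` is uniformly
coercive, `D` and `A_i` are bounded, and `F` has at the interior grid points the derivative `DF`
with respect to `w` with a Taylor remainder that is quadratic, uniformly for bounded `w`. -/
structure Regular (p : Model n) (N : ℕ) (c₀ C h₀ : ℝ) (CF : ℝ → ℝ)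
    (DF : p.Grid → (Fin N → ℝ) → ℝ → Fin N → Fin N → ℝ) : Prop where
  c₀_pos : 0 < c₀
  h₀_pos : 0 < h₀
  h₀_le : h₀ ≤ p.h
  CF_nonneg : ∀ M, 0 ≤ CF M
  D_coercive : ∀ g, p.Interior g → ∀ y ∈ Set.Ioo p.a p.b, ∀ v : Fin N → ℝ,
    c₀ * ∑ s, v s ^ 2 ≤ ∑ k : Fin N, (∑ s, p.D (p.pt g) y k s * v s) ^ 2
  D_le : ∀ g, p.Interior g → ∀ y ∈ Set.Ioo p.a p.b, ∀ k s : Fin N, |p.D (p.pt g) y k s| ≤ C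
  A_le : ∀ g, p.Interior g → ∀ y ∈ Set.Ioo p.a p.b, ∀ i, ∀ k s : Fin N,
    |p.Amat i (p.pt g) y k s| ≤ C
  D_meas : ∀ g, p.Interior g → ∀ k s : Fin N,
    AEStronglyMeasurable (fun y => p.D (p.pt g) y k s) p.mu
  A_meas : ∀ g, p.Interior g → ∀ i, ∀ k s : Fin N,
    AEStronglyMeasurable (fun y => p.Amat i (p.pt g) y k s) p.mu
  F_le : ∀ M g, p.Interior g → ∀ y ∈ Set.Ioo p.a p.b, ∀ w : Fin N → ℝ, ∑ s, w s ^ 2 ≤ M ^ 2 →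
    ∀ k, |p.F w (p.pt g) y k| ≤ CF M
  DF_le : ∀ M g, p.Interior g → ∀ y ∈ Set.Ioo p.a p.b, ∀ w : Fin N → ℝ, ∑ s, w s ^ 2 ≤ M ^ 2 →
    ∀ k s, |DF g w y k s| ≤ CF M
  F_taylor : ∀ M g, p.Interior g → ∀ y ∈ Set.Ioo p.a p.b, ∀ w v : Fin N → ℝ,
    ∑ s, w s ^ 2 ≤ M ^ 2 → ∑ s, (w + v) s ^ 2 ≤ M ^ 2 → ∀ k,
    |p.F (w + v) (p.pt g) y k - p.F w (p.pt g) y k - ∑ s, DF g w y k s * v s|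
      ≤ CF M * ∑ s, v s ^ 2
  F_meas : ∀ g, p.Interior g → ∀ w : Fin N → ℝ → ℝ,
    (∀ s, ContinuousOn (w s) (Set.Icc p.a p.b)) → ∀ k,
    AEStronglyMeasurable (fun y => p.F (fun s => w s y) (p.pt g) y k) p.mu
  DF_meas : ∀ g, p.Interior g → ∀ w : Fin N → ℝ → ℝ,
    (∀ s, ContinuousOn (w s) (Set.Icc p.a p.b)) → ∀ k s,
    AEStronglyMeasurable (fun y => DF g (fun s => w s y) y k s) p.mu

variable (p) in
/-- The part of the residual that is linear in the derivatives of `W`. -/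
def lin (W : p.GridFun N) (g : p.Grid) (k : Fin N) (y : ℝ) : ℝ :=
  (∑ s, p.D (p.pt g) y k s * deriv (W g s) y)
    + ∑ i, ∑ s, p.Amat i (p.pt g) y k s * p.dx W i g s y

variable (p) in
/-- The derivative of the residual at `W` in the direction `v`, when `F` has the derivative `DF`. -/
def linearized (DF : p.Grid → (Fin N → ℝ) → ℝ → Fin N → Fin N → ℝ) (W v : p.GridFun N)
    (g : p.Grid) (k : Fin N) (y : ℝ) : ℝ :=
  p.lin v g k y + ∑ s, DF g (fun s => W g s y) y k s * v g s y

variable (p) in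
/-- The remainder in the first order expansion of `F` at `W` in the direction `v`. -/
def remainderF (DF : p.Grid → (Fin N → ℝ) → ℝ → Fin N → Fin N → ℝ) (W v : p.GridFun N)
    (g : p.Grid) (k : Fin N) (y : ℝ) : ℝ :=
  p.F (fun s => (W + v) g s y) (p.pt g) y k - p.F (fun s => W g s y) (p.pt g) y k
    - ∑ s, DF g (fun s => W g s y) y k s * v g s y

theorem residual_eq (W : p.GridFun N) (g : p.Grid) (k : Fin N) (y : ℝ) :
    p.residual W g k y = p.lin W g k y + p.F (fun s => W g s y) (p.pt g) y k := rfl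

variable {c₀ C h₀ : ℝ} {CF : ℝ → ℝ} {DF : p.Grid → (Fin N → ℝ) → ℝ → Fin N → Fin N → ℝ}

/-- The constant in the bounds of the linear part of the residual. -/
def linConst (n N : ℕ) (C : ℝ) : ℝ := N * (N * C ^ 2) + N * (n * (N * C ^ 2))

theorem linConst_nonneg (n N : ℕ) (C : ℝ) : 0 ≤ linConst n N C := by
  unfold linConst; positivity

theorem Regular.sum_D_sq_le (hr : p.Regular N c₀ C h₀ CF DF) {g : p.Grid} (hg : p.Interior g)
    {y : ℝ} (hy : y ∈ Set.Ioo p.a p.b) (v : p.GridFun N) :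
    ∑ k : Fin N, (∑ s, p.D (p.pt g) y k s * deriv (v g s) y) ^ 2
      ≤ N * (N * C ^ 2) * p.derivSq v g y := by
  calc _ ≤ ∑ _k : Fin N, N * C ^ 2 * p.derivSq v g y := Finset.sum_le_sum fun k _ => by
        have := sq_sum_mul_le (fun s => deriv (v g s) y) (fun s => hr.D_le g hg y hy k s)
        rwa [Fintype.card_fin] at this
    _ = _ := by simp; ring

theorem Regular.sum_A_sq_le (hr : p.Regular N c₀ C h₀ CF DF) {g : p.Grid} (hg : p.Interior g)
    {y : ℝ} (hy : y ∈ Set.Ioo p.a p.b) (v : p.GridFun N) :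
    ∑ k : Fin N, (∑ i, ∑ s, p.Amat i (p.pt g) y k s * p.dx v i g s y) ^ 2
      ≤ N * (n * (N * C ^ 2)) * p.diffSq v g y := by
  calc _ ≤ ∑ _k : Fin N, n * (N * C ^ 2) * p.diffSq v g y := Finset.sum_le_sum fun k _ => by
        have h1 := sq_sum_mul_le (a := fun _ : Fin n => (1 : ℝ)) (C := 1)
          (fun i => ∑ s, p.Amat i (p.pt g) y k s * p.dx v i g s y) (fun _ => by simp)
        simp only [one_mul, one_pow, mul_one, Fintype.card_fin] at h1
        refine h1.trans ?_
        rw [mul_assoc, diffSq, Finset.mul_sum (a := N * C ^ 2)]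
        gcongr with i
        have := sq_sum_mul_le (fun s => p.dx v i g s y) (fun s => hr.A_le g hg y hy i k s)
        rwa [Fintype.card_fin] at this
    _ = _ := by simp; ring

theorem Regular.sum_lin_sq_le (hr : p.Regular N c₀ C h₀ CF DF) {g : p.Grid} (hg : p.Interior g)
    {y : ℝ} (hy : y ∈ Set.Ioo p.a p.b) (v : p.GridFun N) :
    ∑ k, p.lin v g k y ^ 2 ≤ 2 * linConst n N C * (p.derivSq v g y + p.diffSq v g y) := by
  have h1 := hr.sum_D_sq_le hg hy v
  have h2 := hr.sum_A_sq_le hg hy v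
  have h3 : ∑ k, p.lin v g k y ^ 2
      ≤ 2 * ∑ k : Fin N, (∑ s, p.D (p.pt g) y k s * deriv (v g s) y) ^ 2
        + 2 * ∑ k : Fin N, (∑ i, ∑ s, p.Amat i (p.pt g) y k s * p.dx v i g s y) ^ 2 := by
    rw [Finset.mul_sum, Finset.mul_sum, ← Finset.sum_add_distrib]
    refine Finset.sum_le_sum fun k _ => ?_
    unfold lin
    nlinarith [sq_nonneg ((∑ s, p.D (p.pt g) y k s * deriv (v g s) y)
      - ∑ i, ∑ s, p.Amat i (p.pt g) y k s * p.dx v i g s y)]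
  have h4 := derivSq_nonneg v g y
  have h5 := diffSq_nonneg v g y
  have h6 : (0 : ℝ) ≤ N * (N * C ^ 2) := by positivity
  have h7 : (0 : ℝ) ≤ N * (n * (N * C ^ 2)) := by positivity
  unfold linConst
  nlinarith [mul_nonneg h6 h5, mul_nonneg h7 h4]

theorem valSq_sub_le {W v : p.GridFun N} {g : p.Grid} {y M : ℝ} (h1 : p.valSq W g y ≤ M ^ 2)
    (h2 : p.valSq (W + v) g y ≤ M ^ 2) : p.valSq v g y ≤ 4 * M ^ 2 := by
  have : p.valSq v g y ≤ 2 * p.valSq W g y + 2 * p.valSq (W + v) g y := by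
    unfold valSq
    rw [Finset.mul_sum, Finset.mul_sum, ← Finset.sum_add_distrib]
    refine Finset.sum_le_sum fun s _ => ?_
    simp only [Pi.add_apply]
    nlinarith [sq_nonneg (2 * W g s y + v g s y)]
  linarith

theorem Regular.abs_remainderF_le (hr : p.Regular N c₀ C h₀ CF DF) {g : p.Grid}
    (hg : p.Interior g) {y : ℝ} (hy : y ∈ Set.Ioo p.a p.b) {W v : p.GridFun N} {M : ℝ}
    (h1 : p.valSq W g y ≤ M ^ 2) (h2 : p.valSq (W + v) g y ≤ M ^ 2) (k : Fin N) :
    |p.remainderF DF W v g k y| ≤ CF M * p.valSq v g y :=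
  hr.F_taylor M g hg y hy (fun s => W g s y) (fun s => v g s y) h1 h2 k

/-- The constant in the bounds of the terms of order zero in the residual. -/
def lowConst (N : ℕ) (B M : ℝ) : ℝ := N * (N * B ^ 2) + N * (B ^ 2 * (4 * M ^ 2))

theorem lowConst_nonneg (N : ℕ) (B M : ℝ) : 0 ≤ lowConst N B M := by
  unfold lowConst; positivity

theorem Regular.sum_low_sq_le (hr : p.Regular N c₀ C h₀ CF DF) {g : p.Grid}
    (hg : p.Interior g) {y : ℝ} (hy : y ∈ Set.Ioo p.a p.b) {W v : p.GridFun N} {M : ℝ}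
    (h1 : p.valSq W g y ≤ M ^ 2) (h2 : p.valSq (W + v) g y ≤ M ^ 2) :
    ∑ k, (∑ s, DF g (fun s => W g s y) y k s * v g s y) ^ 2
        + ∑ k, p.remainderF DF W v g k y ^ 2
      ≤ lowConst N (CF M) M * p.valSq v g y := by
  have a1 : ∑ k, (∑ s, DF g (fun s => W g s y) y k s * v g s y) ^ 2
      ≤ N * (N * CF M ^ 2) * p.valSq v g y := by
    calc _ ≤ ∑ _k : Fin N, N * CF M ^ 2 * p.valSq v g y := Finset.sum_le_sum fun k _ => by
          have := sq_sum_mul_le (fun s => v g s y)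
            (fun s => hr.DF_le M g hg y hy (fun s => W g s y) h1 k s)
          rwa [Fintype.card_fin] at this
      _ = _ := by simp; ring
  have hv := valSq_nonneg v g y
  have a2 : ∑ k, p.remainderF DF W v g k y ^ 2
      ≤ N * (CF M ^ 2 * (4 * M ^ 2)) * p.valSq v g y := by
    calc _ ≤ ∑ _k : Fin N, CF M ^ 2 * (4 * M ^ 2) * p.valSq v g y :=
          Finset.sum_le_sum fun k _ => by
            rw [← sq_abs]
            calc _ ≤ (CF M * p.valSq v g y) ^ 2 :=
                  pow_le_pow_left₀ (abs_nonneg _) (hr.abs_remainderF_le hg hy h1 h2 k) 2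
              _ = CF M ^ 2 * (p.valSq v g y * p.valSq v g y) := by ring
              _ ≤ CF M ^ 2 * ((4 * M ^ 2) * p.valSq v g y) := by
                  gcongr
                  exact valSq_sub_le h1 h2
              _ = _ := by ring
      _ = _ := by simp; ring
  unfold lowConst
  linarith

/-- Upper bound of the increment of the residual. -/
theorem Regular.sum_increment_sq_le (hr : p.Regular N c₀ C h₀ CF DF) {g : p.Grid}
    (hg : p.Interior g) {y : ℝ} (hy : y ∈ Set.Ioo p.a p.b) {W v : p.GridFun N} {M : ℝ}
    (h1 : p.valSq W g y ≤ M ^ 2) (h2 : p.valSq (W + v) g y ≤ M ^ 2) :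
    ∑ k, (p.linearized DF W v g k y + p.remainderF DF W v g k y) ^ 2
      ≤ (6 * linConst n N C + 3 * lowConst N (CF M) M)
        * (p.derivSq v g y + p.diffSq v g y + p.valSq v g y) := by
  have a1 := hr.sum_lin_sq_le hg hy v
  have a2 := hr.sum_low_sq_le hg hy h1 h2
  have a3 : ∑ k, (p.linearized DF W v g k y + p.remainderF DF W v g k y) ^ 2
      ≤ 3 * ∑ k, p.lin v g k y ^ 2
        + 3 * (∑ k, (∑ s, DF g (fun s => W g s y) y k s * v g s y) ^ 2
        + ∑ k, p.remainderF DF W v g k y ^ 2) := by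
    rw [← Finset.sum_add_distrib, Finset.mul_sum, Finset.mul_sum, ← Finset.sum_add_distrib]
    refine Finset.sum_le_sum fun k _ => ?_
    unfold linearized
    set A := p.lin v g k y
    set B := ∑ s, DF g (fun s => W g s y) y k s * v g s y
    set D := p.remainderF DF W v g k y
    nlinarith [sq_nonneg (A - B), sq_nonneg (A - D), sq_nonneg (B - D)]
  have h3 := valSq_nonneg v g y
  have h4 := derivSq_nonneg v g y
  have h5 := diffSq_nonneg v g y
  have h6 := linConst_nonneg n N C
  have h7 := lowConst_nonneg N (CF M) M
  nlinarith [mul_nonneg h6 h3, mul_nonneg h7 h4, mul_nonneg h7 h5]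

/-- The linearized residual is bounded by the energy density. -/
theorem Regular.sum_linearized_sq_le (hr : p.Regular N c₀ C h₀ CF DF) {g : p.Grid}
    (hg : p.Interior g) {y : ℝ} (hy : y ∈ Set.Ioo p.a p.b) {W : p.GridFun N} (v : p.GridFun N)
    {M : ℝ} (h1 : p.valSq W g y ≤ M ^ 2) :
    ∑ k, p.linearized DF W v g k y ^ 2
      ≤ (4 * linConst n N C + 2 * (N * (N * CF M ^ 2)))
        * (p.derivSq v g y + p.diffSq v g y + p.valSq v g y) := by
  have a1 := hr.sum_lin_sq_le hg hy v
  have a2 : ∑ k, (∑ s, DF g (fun s => W g s y) y k s * v g s y) ^ 2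
      ≤ N * (N * CF M ^ 2) * p.valSq v g y := by
    calc _ ≤ ∑ _k : Fin N, N * CF M ^ 2 * p.valSq v g y := Finset.sum_le_sum fun k _ => by
          have := sq_sum_mul_le (fun s => v g s y)
            (fun s => hr.DF_le M g hg y hy (fun s => W g s y) h1 k s)
          rwa [Fintype.card_fin] at this
      _ = _ := by simp; ring
  have a3 : ∑ k, p.linearized DF W v g k y ^ 2
      ≤ 2 * ∑ k, p.lin v g k y ^ 2
        + 2 * ∑ k, (∑ s, DF g (fun s => W g s y) y k s * v g s y) ^ 2 := by
    rw [Finset.mul_sum, Finset.mul_sum, ← Finset.sum_add_distrib]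
    refine Finset.sum_le_sum fun k _ => ?_
    unfold linearized
    nlinarith [sq_nonneg (p.lin v g k y - ∑ s, DF g (fun s => W g s y) y k s * v g s y)]
  have h3 := valSq_nonneg v g y
  have h4 := derivSq_nonneg v g y
  have h5 := diffSq_nonneg v g y
  have h6 := linConst_nonneg n N C
  have h7 : (0 : ℝ) ≤ N * (N * CF M ^ 2) := by positivity
  nlinarith [mul_nonneg h6 h3, mul_nonneg h7 h4, mul_nonneg h7 h5]

/-- Lower bound of the increment of the residual: the coercivity of `D` controls `v_y`, up to
terms in `v` and its central differences. -/
theorem Regular.le_sum_increment_sq (hr : p.Regular N c₀ C h₀ CF DF) {g : p.Grid}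
    (hg : p.Interior g) {y : ℝ} (hy : y ∈ Set.Ioo p.a p.b) {W v : p.GridFun N} {M : ℝ}
    (h1 : p.valSq W g y ≤ M ^ 2) (h2 : p.valSq (W + v) g y ≤ M ^ 2) :
    c₀ / 2 * p.derivSq v g y - (3 * linConst n N C + 3 * lowConst N (CF M) M)
        * (p.diffSq v g y + p.valSq v g y)
      ≤ ∑ k, (p.linearized DF W v g k y + p.remainderF DF W v g k y) ^ 2 := by
  have a1 := hr.D_coercive g hg y hy fun s => deriv (v g s) y
  have a2 := hr.sum_low_sq_le hg hy h1 h2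
  have a4 := hr.sum_A_sq_le hg hy v
  have a3 : 1 / 2 * ∑ k : Fin N, (∑ s, p.D (p.pt g) y k s * deriv (v g s) y) ^ 2
        - 3 * (∑ k : Fin N, (∑ i, ∑ s, p.Amat i (p.pt g) y k s * p.dx v i g s y) ^ 2)
        - 3 * (∑ k, (∑ s, DF g (fun s => W g s y) y k s * v g s y) ^ 2
        + ∑ k, p.remainderF DF W v g k y ^ 2) ≤
      ∑ k, (p.linearized DF W v g k y + p.remainderF DF W v g k y) ^ 2 := by
    rw [← Finset.sum_add_distrib, Finset.mul_sum, Finset.mul_sum, Finset.mul_sum,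
      ← Finset.sum_sub_distrib, ← Finset.sum_sub_distrib]
    refine Finset.sum_le_sum fun k _ => ?_
    unfold linearized lin
    set A := ∑ s, p.D (p.pt g) y k s * deriv (v g s) y
    set B := ∑ i, ∑ s, p.Amat i (p.pt g) y k s * p.dx v i g s y
    set D := ∑ s, DF g (fun s => W g s y) y k s * v g s y
    set E := p.remainderF DF W v g k y
    nlinarith [sq_nonneg (A + 2 * (B + D + E)), sq_nonneg (B - D), sq_nonneg (B - E),
      sq_nonneg (D - E)]
  have h3 := valSq_nonneg v g y
  have h5 := diffSq_nonneg v g y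
  have h6 := linConst_nonneg n N C
  have h7 := lowConst_nonneg N (CF M) M
  have h8 : N * (n * (N * C ^ 2)) * p.diffSq v g y ≤ linConst n N C * p.diffSq v g y := by
    gcongr
    unfold linConst
    have : (0 : ℝ) ≤ N * (N * C ^ 2) := by positivity
    linarith
  change c₀ * p.derivSq v g y ≤ _ at a1
  nlinarith [mul_nonneg h6 h3, mul_nonneg h7 h5]

section Space

variable [hab : Fact (p.a < p.b)] {W v : p.GridFun N} {g : p.Grid}

theorem ae_residual_add (hW : p.MemH1 W) (hv : p.MemH1 v) :
    ∀ᵐ y ∂p.mu, ∀ g, p.Interior g → ∀ k,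
      p.residual (W + v) g k y
        = p.residual W g k y + (p.linearized DF W v g k y + p.remainderF DF W v g k y) := by
  filter_upwards [ae_deriv_add hW hv] with y hy g hg k
  rw [residual_eq, residual_eq, linearized, remainderF]
  have : p.lin (W + v) g k y = p.lin W g k y + p.lin v g k y := by
    simp only [lin, hy g hg, dx_add, mul_add, Finset.sum_add_distrib]
    ring
  rw [this]
  ring

theorem ae_linearized_add {v' : p.GridFun N} (hv : p.MemH1 v) (hv' : p.MemH1 v') :
    ∀ᵐ y ∂p.mu, ∀ g, p.Interior g → ∀ k,
      p.linearized DF W (v + v') g k y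
        = p.linearized DF W v g k y + p.linearized DF W v' g k y := by
  filter_upwards [ae_deriv_add hv hv'] with y hy g hg k
  simp only [linearized, lin, hy g hg, dx_add]
  simp only [mul_add, Finset.sum_add_distrib, Pi.add_apply]
  ring

omit hab in
theorem linearized_smul (c : ℝ) (g : p.Grid) (k : Fin N) (y : ℝ) :
    p.linearized DF W (c • v) g k y = c * p.linearized DF W v g k y := by
  simp only [linearized, lin, deriv_smul_apply, dx_smul]
  simp only [Pi.smul_apply, smul_eq_mul, mul_add, Finset.mul_sum]
  congr 1
  · congr 1
    · exact Finset.sum_congr rfl fun _ _ => by ring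
    · exact Finset.sum_congr rfl fun _ _ => Finset.sum_congr rfl fun _ _ => by ring
  · exact Finset.sum_congr rfl fun _ _ => by ring

omit hab in
theorem Regular.memLp_lin (hr : p.Regular N c₀ C h₀ CF DF) (hv : p.MemH1 v)
    (hg : p.Interior g) (k : Fin N) : MemLp (p.lin v g k) 2 p.mu := by
  have hD : ∀ s, MemLp (fun y => p.D (p.pt g) y k s) ⊤ p.mu := fun s =>
    memLp_top_of_bound (hr.D_meas g hg k s) C (by
      filter_upwards [ae_restrict_mem measurableSet_Ioo] with y hy using hr.D_le g hg y hy k s)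
  have hA : ∀ i s, MemLp (fun y => p.Amat i (p.pt g) y k s) ⊤ p.mu := fun i s =>
    memLp_top_of_bound (hr.A_meas g hg i k s) C (by
      filter_upwards [ae_restrict_mem measurableSet_Ioo] with y hy using hr.A_le g hg y hy i k s)
  exact (memLp_finsetSum _ fun s _ => (hv.memLp_deriv hg s).mul (hD s)).add
    (memLp_finsetSum _ fun i _ => memLp_finsetSum _ fun s _ => (hv.memLp_dx hg i s).mul (hA i s))

theorem MemH1.exists_valSq_le (hW : p.MemH1 W) (hg : p.Interior g) :
    ∃ M : ℝ, ∀ y ∈ Set.Icc p.a p.b, p.valSq W g y ≤ M ^ 2 := by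
  have : ContinuousOn (p.valSq W g) (Set.Icc p.a p.b) :=
    continuousOn_finsetSum _ fun s _ => (hW.continuousOn hg s).pow 2
  obtain ⟨M, hM⟩ := isCompact_Icc.exists_bound_of_continuousOn this
  refine ⟨|M| + 1, fun y hy => (le_abs_self _).trans ((hM y hy).trans ?_)⟩
  nlinarith [le_abs_self M, abs_nonneg M]

theorem Regular.memLp_residual (hr : p.Regular N c₀ C h₀ CF DF) (hW : p.MemH1 W)
    (hg : p.Interior g) (k : Fin N) : MemLp (p.residual W g k) 2 p.mu := by
  obtain ⟨M, hM⟩ := hW.exists_valSq_le hg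
  refine (hr.memLp_lin hW hg k).add (MemLp.of_bound
    (hr.F_meas g hg (W g) (fun s => hW.continuousOn hg s) k) (CF M) ?_)
  filter_upwards [ae_restrict_mem measurableSet_Ioo] with y hy
  exact hr.F_le M g hg y hy _ (hM y (Set.Ioo_subset_Icc_self hy)) k

theorem Regular.memLp_linearized (hr : p.Regular N c₀ C h₀ CF DF) (hW : p.MemH1 W)
    (hv : p.MemH1 v) (hg : p.Interior g) (k : Fin N) :
    MemLp (p.linearized DF W v g k) 2 p.mu := by
  obtain ⟨M, hM⟩ := hW.exists_valSq_le hg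
  have hDF : ∀ s, MemLp (fun y => DF g (fun s => W g s y) y k s) ⊤ p.mu := fun s =>
    memLp_top_of_bound (hr.DF_meas g hg (W g) (fun s => hW.continuousOn hg s) k s) (CF M) (by
      filter_upwards [ae_restrict_mem measurableSet_Ioo] with y hy
      exact hr.DF_le M g hg y hy _ (hM y (Set.Ioo_subset_Icc_self hy)) k s)
  exact (hr.memLp_lin hv hg k).add
    (memLp_finsetSum _ fun s _ => (hv.memLp_val hg s).mul (hDF s))

end Space

end Model

namespace Model

variable {n : ℕ} {p : Model n} {N : ℕ}

/-! ### The functional: convexity and differentiability -/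

section Space

variable [hab : Fact (p.a < p.b)] {W v : p.GridFun N} {g : p.Grid}
variable {c₀ C h₀ : ℝ} {CF : ℝ → ℝ} {DF : p.Grid → (Fin N → ℝ) → ℝ → Fin N → Fin N → ℝ}

omit hab in
theorem integrable_mul_exp {f : ℝ → ℝ} (hf : Integrable f p.mu) (l : ℝ) :
    Integrable (fun y => f y * Real.exp (2 * l * y)) p.mu := by
  have h1 : MemLp (fun y => Real.exp (2 * l * y)) ⊤ p.mu :=
    memLp_of_continuousOn (by fun_prop) _
  exact memLp_one_iff_integrable.1 (h1.mul (r := 1) (memLp_one_iff_integrable.2 hf))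

omit hab in
theorem densities_le_dens (hn : 1 ≤ n) (W : p.GridFun N) (g : p.Grid) (y : ℝ) :
    p.derivSq W g y + p.diffSq W g y + p.valSq W g y ≤ p.dens W W g y := by
  rw [dens_self]
  have a1 := valSq_nonneg W g y
  have a3 := derivSq_nonneg W g y
  have hn' : (1 : ℝ) ≤ n := by exact_mod_cast hn
  nlinarith

theorem integral_derivSq_le (hn : 1 ≤ n) (hW : p.MemH1 W) (hg : p.Interior g) :
    ∫ y, p.derivSq W g y ∂p.mu ≤ ∫ y, p.dens W W g y ∂p.mu :=
  integral_mono (hW.integrable_derivSq hg) (integrable_dens hW hW hg) fun y => by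
    have := densities_le_dens hn W g y
    have := valSq_nonneg W g y
    have := diffSq_nonneg W g y
    show p.derivSq W g y ≤ p.dens W W g y
    linarith

/-- The constant of the embedding of `H¹(a,b)` into the bounded functions. -/
def sobConst (a b : ℝ) : ℝ := 2 / (b - a) + 2 * (b - a)

theorem valSq_le_normH1 (hn : 1 ≤ n) (hW : p.MemH1 W) (hg : p.Interior g) {y : ℝ}
    (hy : y ∈ Set.Icc p.a p.b) :
    p.valSq W g y ≤ sobConst p.a p.b * p.normH1 W ^ 2 := by
  have hba : 0 < p.b - p.a := sub_pos.2 hab.out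
  have h1 : p.valSq W g y ≤ 2 / (p.b - p.a) * (∫ t, p.valSq W g t ∂p.mu)
      + 2 * (p.b - p.a) * ∫ t, p.derivSq W g t ∂p.mu := by
    rw [integral_derivSq hW hg]
    unfold valSq
    rw [integral_finsetSum _ fun s _ => (hW.memLp_val hg s).integrable_sq, Finset.mul_sum,
      Finset.mul_sum, ← Finset.sum_add_distrib]
    exact Finset.sum_le_sum fun s _ => sq_le_sobolev hab.out (hW.1 g hg s).1 (hW.1 g hg s).2 hy
  have h2 : ∫ t, p.valSq W g t ∂p.mu ≤ p.normH1 W ^ 2 := by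
    refine le_trans (integral_mono (hW.integrable_valSq hg) (integrable_dens hW hW hg) fun t => ?_)
      (integral_dens_le hW hg)
    have := densities_le_dens hn W g t
    have := derivSq_nonneg W g t
    have := diffSq_nonneg W g t
    show p.valSq W g t ≤ p.dens W W g t
    linarith
  have h3 := (integral_derivSq_le hn hW hg).trans (integral_dens_le hW hg)
  calc _ ≤ _ := h1
    _ ≤ 2 / (p.b - p.a) * p.normH1 W ^ 2 + 2 * (p.b - p.a) * p.normH1 W ^ 2 := by gcongr
    _ = _ := by unfold sobConst; ring

/-- A bound for the values of functions of norm at most `R`. -/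
def supBound (a b R : ℝ) : ℝ := Real.sqrt (sobConst a b) * R

theorem valSq_le_supBound (hn : 1 ≤ n) (hW : p.MemH1 W) (hg : p.Interior g) {R : ℝ}
    (hWR : p.normH1 W ≤ R) {y : ℝ} (hy : y ∈ Set.Icc p.a p.b) :
    p.valSq W g y ≤ supBound p.a p.b R ^ 2 := by
  have hba : 0 < p.b - p.a := sub_pos.2 hab.out
  have hs : 0 ≤ sobConst p.a p.b := by unfold sobConst; positivity
  rw [supBound, mul_pow, Real.sq_sqrt hs]
  refine (valSq_le_normH1 hn hW hg hy).trans ?_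
  have : 0 ≤ p.normH1 W := Real.sqrt_nonneg _
  gcongr

/-- A bound for the integral of the squared residual of functions of norm at most `R`. -/
def resConst (n N : ℕ) (a b C : ℝ) (CF : ℝ → ℝ) (R : ℝ) : ℝ :=
  4 * linConst n N C * R ^ 2 + 2 * N * CF (supBound a b R) ^ 2 * (b - a)

theorem Regular.integrable_residual_sq (hr : p.Regular N c₀ C h₀ CF DF) (hW : p.MemH1 W)
    (hg : p.Interior g) : Integrable (fun y => ∑ k, p.residual W g k y ^ 2) p.mu :=
  integrable_finsetSum _ fun k _ => (hr.memLp_residual hW hg k).integrable_sq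

theorem Regular.integral_residual_sq_le (hr : p.Regular N c₀ C h₀ CF DF) (hn : 1 ≤ n)
    (hW : p.MemH1 W) (hg : p.Interior g) {R : ℝ} (hWR : p.normH1 W ≤ R) :
    ∫ y, ∑ k, p.residual W g k y ^ 2 ∂p.mu ≤ resConst n N p.a p.b C CF R := by
  set B := CF (supBound p.a p.b R)
  have hpt : ∀ y ∈ Set.Ioo p.a p.b, ∑ k, p.residual W g k y ^ 2
      ≤ 4 * linConst n N C * p.dens W W g y + 2 * N * B ^ 2 := by
    intro y hy
    have h1 := hr.sum_lin_sq_le hg hy W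
    have h2 : ∑ k, p.F (fun s => W g s y) (p.pt g) y k ^ 2 ≤ N * B ^ 2 := by
      calc _ ≤ ∑ _k : Fin N, B ^ 2 := Finset.sum_le_sum fun k _ => by
            rw [← sq_abs]
            exact pow_le_pow_left₀ (abs_nonneg _) (hr.F_le _ g hg y hy _
              (valSq_le_supBound hn hW hg hWR (Set.Ioo_subset_Icc_self hy)) k) 2
        _ = _ := by simp
    have h3 : ∑ k, p.residual W g k y ^ 2
        ≤ 2 * ∑ k, p.lin W g k y ^ 2 + 2 * ∑ k, p.F (fun s => W g s y) (p.pt g) y k ^ 2 := by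
      rw [Finset.mul_sum, Finset.mul_sum, ← Finset.sum_add_distrib]
      refine Finset.sum_le_sum fun k _ => ?_
      rw [residual_eq]
      nlinarith [sq_nonneg (p.lin W g k y - p.F (fun s => W g s y) (p.pt g) y k)]
    have h4 := densities_le_dens hn W g y
    have h5 := valSq_nonneg W g y
    have h6 := linConst_nonneg n N C
    nlinarith
  have hR0 : 0 ≤ p.normH1 W := Real.sqrt_nonneg _
  have hI : Integrable (fun y => 4 * linConst n N C * p.dens W W g y + 2 * N * B ^ 2) p.mu :=
    ((integrable_dens hW hW hg).const_mul (4 * linConst n N C)).add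
      (integrable_const (2 * N * B ^ 2))
  calc _ ≤ ∫ y, (4 * linConst n N C * p.dens W W g y + 2 * N * B ^ 2) ∂p.mu :=
        setIntegral_mono_on (hr.integrable_residual_sq hW hg) hI measurableSet_Ioo hpt
    _ = 4 * linConst n N C * (∫ y, p.dens W W g y ∂p.mu) + (p.b - p.a) * (2 * N * B ^ 2) := by
        rw [integral_add ((integrable_dens hW hW hg).const_mul _) (integrable_const _),
          integral_const_mul, integral_mu_const]
    _ ≤ 4 * linConst n N C * R ^ 2 + (p.b - p.a) * (2 * N * B ^ 2) := by
        have := linConst_nonneg n N C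
        gcongr
        exact (integral_dens_le hW hg).trans (by gcongr)
    _ = _ := by unfold resConst; ring

theorem Regular.integrable_sum_abs_residual (hr : p.Regular N c₀ C h₀ CF DF) (hW : p.MemH1 W)
    (hg : p.Interior g) : Integrable (fun y => ∑ k, |p.residual W g k y|) p.mu :=
  integrable_finsetSum _ fun k _ => ((hr.memLp_residual hW hg k).integrable (by norm_num)).abs

theorem Regular.integral_sum_abs_residual_le (hr : p.Regular N c₀ C h₀ CF DF) (hn : 1 ≤ n)
    (hW : p.MemH1 W) (hg : p.Interior g) {R : ℝ} (hWR : p.normH1 W ≤ R) :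
    ∫ y, ∑ k, |p.residual W g k y| ∂p.mu ≤ N * (p.b - p.a) + resConst n N p.a p.b C CF R := by
  have hI := hr.integrable_residual_sq hW hg
  calc _ ≤ ∫ y, ((N : ℝ) + ∑ k, p.residual W g k y ^ 2) ∂p.mu := by
        refine integral_mono (hr.integrable_sum_abs_residual hW hg)
          ((integrable_const _).add hI) fun y => ?_
        have : (N : ℝ) = ∑ _k : Fin N, (1 : ℝ) := by simp
        show ∑ k, |p.residual W g k y| ≤ (N : ℝ) + ∑ k, p.residual W g k y ^ 2
        rw [this, ← Finset.sum_add_distrib]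
        refine Finset.sum_le_sum fun k _ => ?_
        rw [← sq_abs]
        nlinarith [sq_nonneg (|p.residual W g k y| - 1), abs_nonneg (p.residual W g k y)]
    _ = N * (p.b - p.a) + ∫ y, ∑ k, p.residual W g k y ^ 2 ∂p.mu := by
        rw [integral_add (integrable_const _) hI, integral_mu_const, mul_comm]
    _ ≤ _ := by
        gcongr
        exact hr.integral_residual_sq_le hn hW hg hWR

theorem J_eq (l : ℝ) (W : p.GridFun N) :
    p.J l W = ∑ g ∈ p.interiorPts,
      ∫ y, (∑ k, p.residual W g k y ^ 2) * Real.exp (2 * l * y) ∂p.mu := by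
  simp only [J, interval_eq_integral_Ioo hab.out.le]

omit hab in
variable (p) in
/-- The derivative of `J_λ` at `W` in the direction `v`, when `F` has the derivative `DF`. -/
def dJ (DF : p.Grid → (Fin N → ℝ) → ℝ → Fin N → Fin N → ℝ) (l : ℝ) (W v : p.GridFun N) : ℝ :=
  ∑ g ∈ p.interiorPts, ∫ y, (2 * ∑ k, p.residual W g k y * p.linearized DF W v g k y)
    * Real.exp (2 * l * y) ∂p.mu

omit hab in
variable (p) in
/-- The density of the first order Taylor remainder of `J_λ`. -/
def remDens (DF : p.Grid → (Fin N → ℝ) → ℝ → Fin N → Fin N → ℝ) (W v : p.GridFun N)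
    (g : p.Grid) (y : ℝ) : ℝ :=
  ∑ k, (p.linearized DF W v g k y + p.remainderF DF W v g k y) ^ 2
    + 2 * ∑ k, p.residual W g k y * p.remainderF DF W v g k y

theorem Regular.integrable_residual_linearized (hr : p.Regular N c₀ C h₀ CF DF) (hW : p.MemH1 W)
    (hv : p.MemH1 v) (hg : p.Interior g) :
    Integrable (fun y => 2 * ∑ k, p.residual W g k y * p.linearized DF W v g k y) p.mu :=
  (integrable_finsetSum _ fun k _ =>
    (hr.memLp_residual hW hg k).integrable_mul (hr.memLp_linearized hW hv hg k)).const_mul 2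

theorem ae_remDens_eq (hW : p.MemH1 W) (hv : p.MemH1 v) :
    ∀ᵐ y ∂p.mu, ∀ g, p.Interior g →
      (∑ k, p.residual (W + v) g k y ^ 2) - (∑ k, p.residual W g k y ^ 2)
        - 2 * ∑ k, p.residual W g k y * p.linearized DF W v g k y = p.remDens DF W v g y := by
  filter_upwards [ae_residual_add (DF := DF) hW hv] with y hy g hg
  simp only [hy g hg, remDens, Finset.mul_sum, ← Finset.sum_sub_distrib, ← Finset.sum_add_distrib]
  exact Finset.sum_congr rfl fun k _ => by ring

theorem Regular.integrable_remDens (hr : p.Regular N c₀ C h₀ CF DF) (hW : p.MemH1 W)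
    (hv : p.MemH1 v) (hg : p.Interior g) : Integrable (p.remDens DF W v g) p.mu := by
  refine (((hr.integrable_residual_sq (hW.add hv) hg).sub (hr.integrable_residual_sq hW hg)).sub
    (hr.integrable_residual_linearized hW hv hg)).congr ?_
  filter_upwards [ae_remDens_eq (DF := DF) hW hv] with y hy using hy g hg

/-- The first order Taylor remainder of `J_λ` is the weighted integral of `|ℓ + Q|² + 2 r Q`, where
`r` is the residual, `ℓ` its linearization and `Q` the second order remainder of `F`. -/
theorem Regular.taylor_J (hr : p.Regular N c₀ C h₀ CF DF) (hW : p.MemH1 W) (hv : p.MemH1 v)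
    (l : ℝ) :
    p.J l (W + v) - p.J l W - p.dJ DF l W v
      = ∑ g ∈ p.interiorPts, ∫ y, p.remDens DF W v g y * Real.exp (2 * l * y) ∂p.mu := by
  rw [J_eq, J_eq, dJ, ← Finset.sum_sub_distrib, ← Finset.sum_sub_distrib]
  refine Finset.sum_congr rfl fun g hg => ?_
  rw [mem_interiorPts] at hg
  have i1 := integrable_mul_exp (hr.integrable_residual_sq (hW.add hv) hg) l
  have i2 := integrable_mul_exp (hr.integrable_residual_sq hW hg) l
  have i3 := integrable_mul_exp (hr.integrable_residual_linearized hW hv hg) l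
  have i12 : Integrable (fun y => (∑ k, p.residual (W + v) g k y ^ 2) * Real.exp (2 * l * y)
      - (∑ k, p.residual W g k y ^ 2) * Real.exp (2 * l * y)) p.mu := i1.sub i2
  rw [← integral_sub i1 i2, ← integral_sub i12 i3]
  refine integral_congr_ae ?_
  filter_upwards [ae_remDens_eq (DF := DF) hW hv] with y hy
  rw [← hy g hg]
  ring

/-- The constant in the bounds of the increment of the residual on the ball of radius `R`. -/
def incConst (n N : ℕ) (a b C : ℝ) (CF : ℝ → ℝ) (R : ℝ) : ℝ :=
  6 * linConst n N C + 3 * lowConst N (CF (supBound a b R)) (supBound a b R)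

theorem incConst_nonneg (n N : ℕ) (a b C : ℝ) (CF : ℝ → ℝ) (R : ℝ) :
    0 ≤ incConst n N a b C CF R := by
  have := linConst_nonneg n N C
  have := lowConst_nonneg N (CF (supBound a b R)) (supBound a b R)
  unfold incConst; positivity

/-- The constant in front of the terms that a large `λ` makes small. -/
def carlConst (n N : ℕ) (a b h₀ C : ℝ) (CF : ℝ → ℝ) (R : ℝ) : ℝ :=
  incConst n N a b C CF R * (n / h₀ ^ 2 + 1) * (b - a)
    + 2 * CF (supBound a b R) * (N * (b - a) + resConst n N a b C CF R)

omit hab in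
theorem Regular.abs_residual_mul_remainder_le (hr : p.Regular N c₀ C h₀ CF DF)
    (hg : p.Interior g) {y : ℝ} (hy : y ∈ Set.Ioo p.a p.b) {M : ℝ}
    (h1 : p.valSq W g y ≤ M ^ 2) (h2 : p.valSq (W + v) g y ≤ M ^ 2) :
    |2 * ∑ k, p.residual W g k y * p.remainderF DF W v g k y|
      ≤ 2 * CF M * ((∑ k, |p.residual W g k y|) * p.valSq v g y) := by
  rw [abs_mul, abs_two, mul_assoc]
  gcongr
  calc _ ≤ ∑ k, |p.residual W g k y * p.remainderF DF W v g k y| := Finset.abs_sum_le_sum_abs _ _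
    _ ≤ ∑ k, |p.residual W g k y| * (CF M * p.valSq v g y) := Finset.sum_le_sum fun k _ => by
        rw [abs_mul]
        gcongr
        exact hr.abs_remainderF_le hg hy h1 h2 k
    _ = _ := by rw [← Finset.sum_mul]; ring

/-- The weighted energy `∑ ∫ |v_y|² e^{2λy}`. -/
def wEnergy (l : ℝ) (v : p.GridFun N) : ℝ :=
  ∑ g ∈ p.interiorPts, ∫ y, p.derivSq v g y * Real.exp (2 * l * y) ∂p.mu

omit hab in
/-- The Carleman estimate for functions with zero boundary values. -/
theorem valSq_mul_exp_le (hv : p.MemH1 v) (hv0 : p.BdryEq v 0) (hg : p.Interior g) {l : ℝ}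
    (hl : 0 < l) {y : ℝ} (hy : y ∈ Set.Icc p.a p.b) :
    p.valSq v g y * Real.exp (2 * l * y)
      ≤ 1 / (2 * l) * ∫ t, p.derivSq v g t * Real.exp (2 * l * t) ∂p.mu := by
  have e : ∀ t, p.derivSq v g t * Real.exp (2 * l * t)
      = ∑ s, deriv (v g s) t ^ 2 * Real.exp (2 * l * t) := fun t => Finset.sum_mul _ _ _
  simp_rw [e]
  rw [integral_finsetSum _ fun s _ => integrable_mul_exp (hv.memLp_deriv hg s).integrable_sq l,
    valSq, Finset.sum_mul, Finset.mul_sum]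
  refine Finset.sum_le_sum fun s _ => ?_
  exact sq_mul_exp_le_carleman (hv.1 g hg s).1 (hv.1 g hg s).2
    ((hv0.1 g s).2.trans rfl) hl hy

theorem integrable_mul_valSq_exp {f : ℝ → ℝ} (hf : Integrable f p.mu) (hv : p.MemH1 v)
    (hg : p.Interior g) (l : ℝ) :
    Integrable (fun y => f y * p.valSq v g y * Real.exp (2 * l * y)) p.mu := by
  have h1 : MemLp (p.valSq v g) ⊤ p.mu :=
    memLp_of_continuousOn (continuousOn_finsetSum _ fun s _ => (hv.continuousOn hg s).pow 2) _
  have h2 : Integrable (fun y => f y * p.valSq v g y) p.mu :=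
    memLp_one_iff_integrable.1 (h1.mul (r := 1) (memLp_one_iff_integrable.2 hf))
  exact integrable_mul_exp h2 l

/-- The error terms of the convexity estimate are `O(1/λ)` times the weighted energy. In the term
with the residual, which is merely integrable, the supremum of `|v|² e^{2λy}` is taken out of the
integral. -/
theorem Regular.error_le (hr : p.Regular N c₀ C h₀ CF DF) (hn : 1 ≤ n) (hW : p.MemH1 W)
    (hv : p.MemH1 v) (hv0 : p.BdryEq v 0) {R : ℝ} (hWR : p.normH1 W ≤ R) {l : ℝ} (hl : 0 < l) :
    ∑ g ∈ p.interiorPts, ((∫ y, (incConst n N p.a p.b C CF R * (p.diffSq v g y + p.valSq v g y)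
        + 2 * CF (supBound p.a p.b R) * ((∑ k, |p.residual W g k y|) * p.valSq v g y))
        * Real.exp (2 * l * y) ∂p.mu))
      ≤ carlConst n N p.a p.b h₀ C CF R / (2 * l) * wEnergy l v := by
  have hba : 0 < p.b - p.a := sub_pos.2 hab.out
  set K := incConst n N p.a p.b C CF R
  have hK : 0 ≤ K := incConst_nonneg _ _ _ _ _ _ _
  set B := CF (supBound p.a p.b R)
  have hB : 0 ≤ B := hr.CF_nonneg _
  set ρ := N * (p.b - p.a) + resConst n N p.a p.b C CF R
  have hint : ∀ g ∈ p.interiorPts, p.Interior g := fun g hg => mem_interiorPts.1 hg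
  have iV : ∀ g ∈ p.interiorPts, Integrable (fun y => p.valSq v g y * Real.exp (2 * l * y)) p.mu :=
    fun g hg => integrable_mul_exp (hv.integrable_valSq (hint g hg)) l
  have iX : ∀ g ∈ p.interiorPts,
      Integrable (fun y => p.diffSq v g y * Real.exp (2 * l * y)) p.mu :=
    fun g hg => integrable_mul_exp (hv.integrable_diffSq (hint g hg)) l
  have iP : ∀ g ∈ p.interiorPts, Integrable (fun y => (∑ k, |p.residual W g k y|) * p.valSq v g y
      * Real.exp (2 * l * y)) p.mu := fun g hg =>
    integrable_mul_valSq_exp (hr.integrable_sum_abs_residual hW (hint g hg)) hv (hint g hg) l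
  have hsplit : ∀ g ∈ p.interiorPts, ∫ y, (K * (p.diffSq v g y + p.valSq v g y)
        + 2 * B * ((∑ k, |p.residual W g k y|) * p.valSq v g y)) * Real.exp (2 * l * y) ∂p.mu
      = K * (∫ y, p.diffSq v g y * Real.exp (2 * l * y) ∂p.mu)
        + K * (∫ y, p.valSq v g y * Real.exp (2 * l * y) ∂p.mu)
        + 2 * B * ∫ y, (∑ k, |p.residual W g k y|) * p.valSq v g y
          * Real.exp (2 * l * y) ∂p.mu := by
    intro g hg
    have e : ∀ y, (K * (p.diffSq v g y + p.valSq v g y)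
        + 2 * B * ((∑ k, |p.residual W g k y|) * p.valSq v g y)) * Real.exp (2 * l * y)
        = K * (p.diffSq v g y * Real.exp (2 * l * y)) + K * (p.valSq v g y * Real.exp (2 * l * y))
          + 2 * B * ((∑ k, |p.residual W g k y|) * p.valSq v g y * Real.exp (2 * l * y)) :=
      fun y => by ring
    simp_rw [e]
    have i1 := (iX g hg).const_mul K
    have i2 := (iV g hg).const_mul K
    have i3 := (iP g hg).const_mul (2 * B)
    have i12 : Integrable (fun y => K * (p.diffSq v g y * Real.exp (2 * l * y))
      + K * (p.valSq v g y * Real.exp (2 * l * y))) p.mu := i1.add i2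
    rw [integral_add i12 i3, integral_add i1 i2, integral_const_mul, integral_const_mul,
      integral_const_mul]
  have hV : ∀ g ∈ p.interiorPts, ∫ y, p.valSq v g y * Real.exp (2 * l * y) ∂p.mu
      ≤ (p.b - p.a) / (2 * l) * ∫ y, p.derivSq v g y * Real.exp (2 * l * y) ∂p.mu := by
    intro g hg
    have := integral_mu_le (iV g hg) fun y hy =>
      valSq_mul_exp_le hv hv0 (hint g hg) hl (Set.Ioo_subset_Icc_self hy)
    refine this.trans (le_of_eq (by ring))
  have hP : ∀ g ∈ p.interiorPts, ∫ y, (∑ k, |p.residual W g k y|) * p.valSq v g y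
        * Real.exp (2 * l * y) ∂p.mu
      ≤ ρ / (2 * l) * ∫ y, p.derivSq v g y * Real.exp (2 * l * y) ∂p.mu := by
    intro g hg
    set Eg := ∫ y, p.derivSq v g y * Real.exp (2 * l * y) ∂p.mu
    have hEg : 0 ≤ Eg := integral_nonneg fun y =>
      mul_nonneg (derivSq_nonneg v g y) (Real.exp_pos _).le
    calc _ ≤ ∫ y, (1 / (2 * l) * Eg) * (∑ k, |p.residual W g k y|) ∂p.mu := by
          refine setIntegral_mono_on (iP g hg)
            ((hr.integrable_sum_abs_residual hW (hint g hg)).const_mul _) measurableSet_Ioo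
            fun y hy => ?_
          have h1 := valSq_mul_exp_le hv hv0 (hint g hg) hl (Set.Ioo_subset_Icc_self hy)
          have h2 : 0 ≤ ∑ k, |p.residual W g k y| := Finset.sum_nonneg fun _ _ => abs_nonneg _
          calc _ = (p.valSq v g y * Real.exp (2 * l * y)) * ∑ k, |p.residual W g k y| := by ring
            _ ≤ _ := mul_le_mul_of_nonneg_right h1 h2
      _ = (1 / (2 * l) * Eg) * ∫ y, ∑ k, |p.residual W g k y| ∂p.mu := integral_const_mul _ _
      _ ≤ (1 / (2 * l) * Eg) * ρ := by
          have := hr.integral_sum_abs_residual_le hn hW (hint g hg) hWR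
          have h3 : 0 ≤ 1 / (2 * l) * Eg := by positivity
          exact mul_le_mul_of_nonneg_left this h3
      _ = _ := by ring
  have hX : ∑ g ∈ p.interiorPts, ∫ y, p.diffSq v g y * Real.exp (2 * l * y) ∂p.mu
      ≤ n / h₀ ^ 2 * ∑ g ∈ p.interiorPts, ∫ y, p.valSq v g y * Real.exp (2 * l * y) ∂p.mu := by
    rw [← integral_finsetSum _ iX, ← integral_finsetSum _ iV, ← integral_const_mul]
    refine setIntegral_mono_on (integrable_finsetSum _ iX)
      ((integrable_finsetSum _ iV).const_mul _) measurableSet_Ioo fun y hy => ?_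
    rw [← Finset.sum_mul, ← Finset.sum_mul, ← mul_assoc]
    exact mul_le_mul_of_nonneg_right (sum_diffSq_le hv0 hr.h₀_pos hr.h₀_le hy) (Real.exp_pos _).le
  have hVs : ∑ g ∈ p.interiorPts, ∫ y, p.valSq v g y * Real.exp (2 * l * y) ∂p.mu
      ≤ (p.b - p.a) / (2 * l) * wEnergy l v := by
    rw [wEnergy, Finset.mul_sum]
    exact Finset.sum_le_sum hV
  have hPs : ∑ g ∈ p.interiorPts, ∫ y, (∑ k, |p.residual W g k y|) * p.valSq v g y
        * Real.exp (2 * l * y) ∂p.mu ≤ ρ / (2 * l) * wEnergy l v := by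
    rw [wEnergy, Finset.mul_sum]
    exact Finset.sum_le_sum hP
  rw [Finset.sum_congr rfl hsplit, Finset.sum_add_distrib, Finset.sum_add_distrib,
    ← Finset.mul_sum, ← Finset.mul_sum, ← Finset.mul_sum]
  set SV := ∑ g ∈ p.interiorPts, ∫ y, p.valSq v g y * Real.exp (2 * l * y) ∂p.mu
  calc _ ≤ K * (n / h₀ ^ 2 * SV) + K * SV + 2 * B * (ρ / (2 * l) * wEnergy l v) := by gcongr
    _ = K * (n / h₀ ^ 2 + 1) * SV + 2 * B * (ρ / (2 * l) * wEnergy l v) := by ring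
    _ ≤ K * (n / h₀ ^ 2 + 1) * ((p.b - p.a) / (2 * l) * wEnergy l v)
        + 2 * B * (ρ / (2 * l) * wEnergy l v) := by gcongr
    _ = _ := by
      unfold carlConst
      ring

omit hab in
theorem wEnergy_nonneg (l : ℝ) (v : p.GridFun N) : 0 ≤ wEnergy l v :=
  Finset.sum_nonneg fun g _ => integral_nonneg fun y =>
    mul_nonneg (derivSq_nonneg v g y) (Real.exp_pos _).le

theorem Regular.integrable_error (hr : p.Regular N c₀ C h₀ CF DF) (hW : p.MemH1 W)
    (hv : p.MemH1 v) (hg : p.Interior g) (K B l : ℝ) :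
    Integrable (fun y => (K * (p.diffSq v g y + p.valSq v g y)
        + 2 * B * ((∑ k, |p.residual W g k y|) * p.valSq v g y)) * Real.exp (2 * l * y)) p.mu := by
  have i1 := integrable_mul_exp (((hv.integrable_diffSq hg).add
    (hv.integrable_valSq hg)).const_mul K) l
  have i2 := (integrable_mul_valSq_exp (hr.integrable_sum_abs_residual hW hg) hv hg l).const_mul
    (2 * B)
  refine (i1.add i2).congr (Filter.Eventually.of_forall fun y => ?_)
  simp only [Pi.add_apply]
  ring

/-- The Taylor remainder of `J_λ` is bounded below by the weighted energy. -/
theorem Regular.le_taylor_J (hr : p.Regular N c₀ C h₀ CF DF) (hn : 1 ≤ n) (hW : p.MemH1 W)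
    (hv : p.MemH1 v) (hv0 : p.BdryEq v 0) {R : ℝ} (hWR : p.normH1 W ≤ R)
    (hWvR : p.normH1 (W + v) ≤ R) {l : ℝ} (hl : 0 < l) :
    (c₀ / 2 - carlConst n N p.a p.b h₀ C CF R / (2 * l)) * wEnergy l v
      ≤ p.J l (W + v) - p.J l W - p.dJ DF l W v := by
  rw [hr.taylor_J hW hv, sub_mul]
  refine le_trans (sub_le_sub_left (hr.error_le hn hW hv hv0 hWR hl) _) ?_
  rw [wEnergy, Finset.mul_sum, ← Finset.sum_sub_distrib]
  refine Finset.sum_le_sum fun g hg => ?_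
  rw [mem_interiorPts] at hg
  have i1 := integrable_mul_exp (hv.integrable_derivSq hg) l
  have i2 := hr.integrable_error hW hv hg (incConst n N p.a p.b C CF R)
    (CF (supBound p.a p.b R)) l
  rw [← integral_const_mul, ← integral_sub (i1.const_mul _) i2]
  refine setIntegral_mono_on ((i1.const_mul _).sub i2)
    (integrable_mul_exp (hr.integrable_remDens hW hv hg) l) measurableSet_Ioo fun y hy => ?_
  rw [← mul_assoc, ← sub_mul]
  refine mul_le_mul_of_nonneg_right ?_ (Real.exp_pos _).le
  have hy' := Set.Ioo_subset_Icc_self hy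
  have h1 := valSq_le_supBound hn hW hg hWR hy'
  have h2 := valSq_le_supBound hn (hW.add hv) hg hWvR hy'
  have h3 := hr.le_sum_increment_sq hg hy h1 h2
  have h4 := neg_le_of_abs_le (hr.abs_residual_mul_remainder_le hg hy h1 h2)
  have h5 : (3 * linConst n N C + 3 * lowConst N (CF (supBound p.a p.b R)) (supBound p.a p.b R))
        * (p.diffSq v g y + p.valSq v g y)
      ≤ incConst n N p.a p.b C CF R * (p.diffSq v g y + p.valSq v g y) := by
    have := valSq_nonneg v g y
    have := diffSq_nonneg v g y
    have := linConst_nonneg n N C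
    unfold incConst
    gcongr
    linarith
  rw [remDens]
  linarith

/-- The Taylor remainder of `J_λ` is bounded above by the weighted energy. -/
theorem Regular.abs_taylor_J_le (hr : p.Regular N c₀ C h₀ CF DF) (hn : 1 ≤ n) (hW : p.MemH1 W)
    (hv : p.MemH1 v) (hv0 : p.BdryEq v 0) {R : ℝ} (hWR : p.normH1 W ≤ R)
    (hWvR : p.normH1 (W + v) ≤ R) {l : ℝ} (hl : 0 < l) :
    |p.J l (W + v) - p.J l W - p.dJ DF l W v|
      ≤ (incConst n N p.a p.b C CF R + carlConst n N p.a p.b h₀ C CF R / (2 * l))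
        * wEnergy l v := by
  rw [hr.taylor_J hW hv, add_mul]
  refine le_trans ?_ (add_le_add_right (hr.error_le hn hW hv hv0 hWR hl) _)
  rw [wEnergy, Finset.mul_sum, ← Finset.sum_add_distrib]
  refine (Finset.abs_sum_le_sum_abs _ _).trans (Finset.sum_le_sum fun g hg => ?_)
  rw [mem_interiorPts] at hg
  have i1 := integrable_mul_exp (hv.integrable_derivSq hg) l
  have i2 := hr.integrable_error hW hv hg (incConst n N p.a p.b C CF R)
    (CF (supBound p.a p.b R)) l
  have i3 := integrable_mul_exp (hr.integrable_remDens hW hv hg) l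
  rw [← integral_const_mul, ← integral_add (i1.const_mul _) i2]
  refine abs_integral_le_integral_abs.trans ?_
  refine setIntegral_mono_on i3.abs ((i1.const_mul _).add i2) measurableSet_Ioo fun y hy => ?_
  rw [abs_mul, abs_of_pos (Real.exp_pos _), ← mul_assoc, ← add_mul]
  refine mul_le_mul_of_nonneg_right ?_ (Real.exp_pos _).le
  have hy' := Set.Ioo_subset_Icc_self hy
  have h1 := valSq_le_supBound hn hW hg hWR hy'
  have h2 := valSq_le_supBound hn (hW.add hv) hg hWvR hy'
  have h3 := hr.sum_increment_sq_le hg hy h1 h2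
  have h4 := hr.abs_residual_mul_remainder_le hg hy h1 h2
  have h5 : 0 ≤ ∑ k, (p.linearized DF W v g k y + p.remainderF DF W v g k y) ^ 2 :=
    Finset.sum_nonneg fun _ _ => sq_nonneg _
  rw [remDens]
  refine (abs_add_le _ _).trans ?_
  rw [abs_of_nonneg h5]
  change _ ≤ incConst n N p.a p.b C CF R * _ at h3
  linarith

theorem wEnergy_le (hn : 1 ≤ n) (hv : p.MemH1 v) {l : ℝ} (hl : 0 ≤ l) :
    wEnergy l v ≤ Real.exp (2 * l * p.b) * p.normH1 v ^ 2 := by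
  rw [normH1_sq hv, wEnergy, Finset.mul_sum]
  refine Finset.sum_le_sum fun g hg => ?_
  rw [mem_interiorPts] at hg
  refine le_trans ?_ (mul_le_mul_of_nonneg_left (integral_derivSq_le hn hv hg) (Real.exp_pos _).le)
  rw [← integral_const_mul]
  refine setIntegral_mono_on (integrable_mul_exp (hv.integrable_derivSq hg) l)
    ((hv.integrable_derivSq hg).const_mul _) measurableSet_Ioo fun y hy => ?_
  rw [mul_comm]
  refine mul_le_mul_of_nonneg_right (Real.exp_le_exp.2 ?_) (derivSq_nonneg v g y)
  exact mul_le_mul_of_nonneg_left hy.2.le (by positivity)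

/-- The constant of the Poincaré inequality. -/
def poincareConst (n : ℕ) (a b h₀ : ℝ) : ℝ := (n + n / h₀ ^ 2) * (b - a) ^ 2 + n

theorem le_wEnergy (hv : p.MemH1 v) (hv0 : p.BdryEq v 0) {h0 : ℝ} (h0pos : 0 < h0)
    (hh : h0 ≤ p.h) {l : ℝ} (hl : 0 ≤ l) :
    Real.exp (2 * l * p.a) * p.normH1 v ^ 2 ≤ poincareConst n p.a p.b h0 * wEnergy l v := by
  have h1 := normH1_sq_le_derivSq hv hv0 h0pos hh
  have h2 : Real.exp (2 * l * p.a) * ∑ g ∈ p.interiorPts, ∫ y, p.derivSq v g y ∂p.mu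
      ≤ wEnergy l v := by
    rw [wEnergy, Finset.mul_sum]
    refine Finset.sum_le_sum fun g hg => ?_
    rw [mem_interiorPts] at hg
    rw [← integral_const_mul]
    refine setIntegral_mono_on ((hv.integrable_derivSq hg).const_mul _)
      (integrable_mul_exp (hv.integrable_derivSq hg) l) measurableSet_Ioo fun y hy => ?_
    rw [mul_comm]
    refine mul_le_mul_of_nonneg_left (Real.exp_le_exp.2 ?_) (derivSq_nonneg v g y)
    exact mul_le_mul_of_nonneg_left hy.1.le (by positivity)
  have h3 : 0 ≤ poincareConst n p.a p.b h0 := by unfold poincareConst; positivity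
  calc _ ≤ Real.exp (2 * l * p.a) * (poincareConst n p.a p.b h0 *
        ∑ g ∈ p.interiorPts, ∫ y, p.derivSq v g y ∂p.mu) := by
        gcongr
        exact h1
    _ = poincareConst n p.a p.b h0 * (Real.exp (2 * l * p.a) *
        ∑ g ∈ p.interiorPts, ∫ y, p.derivSq v g y ∂p.mu) := by ring
    _ ≤ _ := by gcongr

/-- If `W` has zero residual, then `J_λ` grows at most quadratically away from `W`, in the
directions of the whole space. -/
theorem Regular.J_add_le (hr : p.Regular N c₀ C h₀ CF DF) (hn : 1 ≤ n) (hW : p.MemH1 W)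
    (hv : p.MemH1 v) {R : ℝ} (hWR : p.normH1 W ≤ R) (hWvR : p.normH1 (W + v) ≤ R)
    (hsol : p.Solves W) {l : ℝ} (hl : 0 ≤ l) :
    p.J l (W + v) ≤ Real.exp (2 * l * p.b) * incConst n N p.a p.b C CF R * p.normH1 v ^ 2 := by
  rw [J_eq, normH1_sq hv, Finset.mul_sum]
  refine Finset.sum_le_sum fun g hg => ?_
  rw [mem_interiorPts] at hg
  rw [← integral_const_mul]
  have hsol' : ∀ᵐ y ∂p.mu, ∀ k, p.residual W g k y = 0 := ae_all_iff.2 fun k => hsol g hg k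
  refine integral_mono_ae (integrable_mul_exp (hr.integrable_residual_sq (hW.add hv) hg) l)
    ((integrable_dens hv hv hg).const_mul _) ?_
  filter_upwards [ae_residual_add (DF := DF) hW hv, hsol', ae_restrict_mem measurableSet_Ioo]
    with y h1 h2 hy
  simp only [h1 g hg, h2, zero_add]
  have hy' := Set.Ioo_subset_Icc_self hy
  have h3 := hr.sum_increment_sq_le hg hy (valSq_le_supBound hn hW hg hWR hy')
    (valSq_le_supBound hn (hW.add hv) hg hWvR hy')
  have h4 := densities_le_dens hn v g y
  have hK := incConst_nonneg n N p.a p.b C CF R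
  have h5 : ∑ k, (p.linearized DF W v g k y + p.remainderF DF W v g k y) ^ 2
      ≤ incConst n N p.a p.b C CF R * p.dens v v g y :=
    h3.trans (mul_le_mul_of_nonneg_left h4 hK)
  have h6 : Real.exp (2 * l * y) ≤ Real.exp (2 * l * p.b) :=
    Real.exp_le_exp.2 (mul_le_mul_of_nonneg_left hy.2.le (by positivity))
  have h7 := dens_self_nonneg v g y
  calc _ ≤ (incConst n N p.a p.b C CF R * p.dens v v g y) * Real.exp (2 * l * p.b) :=
        mul_le_mul h5 h6 (Real.exp_pos _).le (by positivity)
    _ = _ := by ring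

theorem Regular.dJ_add (hr : p.Regular N c₀ C h₀ CF DF) {v' : p.GridFun N} (hW : p.MemH1 W)
    (hv : p.MemH1 v) (hv' : p.MemH1 v') (l : ℝ) :
    p.dJ DF l W (v + v') = p.dJ DF l W v + p.dJ DF l W v' := by
  rw [dJ, dJ, dJ, ← Finset.sum_add_distrib]
  refine Finset.sum_congr rfl fun g hg => ?_
  rw [mem_interiorPts] at hg
  rw [← integral_add (integrable_mul_exp (hr.integrable_residual_linearized hW hv hg) l)
    (integrable_mul_exp (hr.integrable_residual_linearized hW hv' hg) l)]
  refine integral_congr_ae ?_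
  filter_upwards [ae_linearized_add (W := W) (DF := DF) hv hv'] with y hy
  simp only [hy g hg, mul_add, add_mul, Finset.sum_add_distrib]

omit hab in
theorem dJ_smul (c l : ℝ) : p.dJ DF l W (c • v) = c * p.dJ DF l W v := by
  rw [dJ, dJ, Finset.mul_sum]
  refine Finset.sum_congr rfl fun g _ => ?_
  rw [← integral_const_mul]
  congr 1
  funext y
  simp only [linearized_smul, Finset.mul_sum, Finset.sum_mul]
  exact Finset.sum_congr rfl fun k _ => by ring

/-- The derivative of `J_λ` is a bounded functional. -/
theorem Regular.exists_dJ_le (hr : p.Regular N c₀ C h₀ CF DF) (hn : 1 ≤ n) (hW : p.MemH1 W)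
    (l : ℝ) : ∃ B : ℝ, ∀ v, p.MemH1 v → |p.dJ DF l W v| ≤ B * p.normH1 v := by
  set M := supBound p.a p.b (p.normH1 W)
  set K := 4 * linConst n N C + 2 * (N * (N * CF M ^ 2))
  have hK : 0 ≤ K := by have := linConst_nonneg n N C; positivity
  let rw' : p.Grid → Fin N → ℝ → ℝ := fun g k y =>
    2 * p.residual W g k y * Real.exp (2 * l * y)
  have hrw : ∀ g, p.Interior g → ∀ k, MemLp (rw' g k) 2 p.mu := by
    intro g hg k
    have h1 : MemLp (fun y => Real.exp (2 * l * y)) ⊤ p.mu :=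
      memLp_of_continuousOn (by fun_prop) _
    exact h1.mul (r := 2) ((hr.memLp_residual hW hg k).const_mul 2)
  refine ⟨∑ g ∈ p.interiorPts, ∑ k, Real.sqrt (∫ y, rw' g k y ^ 2 ∂p.mu) * Real.sqrt K,
    fun v hv => ?_⟩
  rw [dJ, Finset.sum_mul]
  refine (Finset.abs_sum_le_sum_abs _ _).trans (Finset.sum_le_sum fun g hg => ?_)
  rw [mem_interiorPts] at hg
  have e : ∀ y, (2 * ∑ k, p.residual W g k y * p.linearized DF W v g k y) * Real.exp (2 * l * y)
      = ∑ k, rw' g k y * p.linearized DF W v g k y := by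
    intro y
    simp only [rw', Finset.mul_sum, Finset.sum_mul]
    exact Finset.sum_congr rfl fun k _ => by ring
  simp_rw [e]
  have hI : ∀ k, Integrable (fun y => rw' g k y * p.linearized DF W v g k y) p.mu := fun k =>
    (hrw g hg k).integrable_mul (hr.memLp_linearized hW hv hg k)
  rw [integral_finsetSum _ fun k _ => hI k, Finset.sum_mul]
  refine (Finset.abs_sum_le_sum_abs _ _).trans (Finset.sum_le_sum fun k _ => ?_)
  have h1 := sq_integral_mul_le (hrw g hg k) (hr.memLp_linearized hW hv hg k)
  have h2 : ∫ y, p.linearized DF W v g k y ^ 2 ∂p.mu ≤ K * p.normH1 v ^ 2 := by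
    refine le_trans ?_ (mul_le_mul_of_nonneg_left (integral_dens_le hv hg) hK)
    rw [← integral_const_mul]
    refine setIntegral_mono_on (hr.memLp_linearized hW hv hg k).integrable_sq
      ((integrable_dens hv hv hg).const_mul _) measurableSet_Ioo fun y hy => ?_
    have h3 := hr.sum_linearized_sq_le hg hy v
      (valSq_le_supBound hn hW hg le_rfl (Set.Ioo_subset_Icc_self hy))
    have h4 : p.linearized DF W v g k y ^ 2 ≤ ∑ k, p.linearized DF W v g k y ^ 2 :=
      Finset.single_le_sum (f := fun k => p.linearized DF W v g k y ^ 2)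
        (fun _ _ => sq_nonneg _) (Finset.mem_univ k)
    exact h4.trans (h3.trans (mul_le_mul_of_nonneg_left (densities_le_dens hn v g y) hK))
  have hv0 : 0 ≤ p.normH1 v := Real.sqrt_nonneg _
  refine abs_le_of_sq_le_sq (h1.trans ?_) (by positivity)
  have h5 : 0 ≤ ∫ y, rw' g k y ^ 2 ∂p.mu := integral_nonneg fun _ => sq_nonneg _
  rw [mul_pow, mul_pow, Real.sq_sqrt h5, Real.sq_sqrt hK, mul_assoc]
  exact mul_le_mul_of_nonneg_left h2 h5

end Space

end Model

namespace Model

variable {n : ℕ} {p : Model n} {N : ℕ}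

/-! ### The gradient of the functional -/

section Space

variable [hab : Fact (p.a < p.b)] {W v : p.GridFun N} {g : p.Grid}
variable {c₀ C h₀ : ℝ} {CF : ℝ → ℝ} {DF : p.Grid → (Fin N → ℝ) → ℝ → Fin N → Fin N → ℝ}

theorem resConst_nonneg (C : ℝ) (CF : ℝ → ℝ) (R : ℝ) : 0 ≤ resConst n N p.a p.b C CF R := by
  have hba : 0 < p.b - p.a := sub_pos.2 hab.out
  have := linConst_nonneg n N C
  unfold resConst
  positivity

theorem Regular.carlConst_nonneg (hr : p.Regular N c₀ C h₀ CF DF) (R : ℝ) :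
    0 ≤ carlConst n N p.a p.b h₀ C CF R := by
  have hba : 0 < p.b - p.a := sub_pos.2 hab.out
  have h1 := resConst_nonneg (p := p) (N := N) C CF R
  have h2 := incConst_nonneg n N p.a p.b C CF R
  have h3 := hr.CF_nonneg (supBound p.a p.b R)
  unfold carlConst
  positivity

theorem normH1_smul (c : ℝ) (hv : p.MemH1 v) : p.normH1 (c • v) = |c| * p.normH1 v := by
  let V : p.H1 N := ⟨v, hv⟩
  exact norm_smul c V

theorem innerH1_smul_right (c : ℝ) (hW : p.MemH1 W) (hv : p.MemH1 v) :
    p.innerH1 W (c • v) = c * p.innerH1 W v := by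
  rw [innerH1_comm, innerH1_smul_left c hv hW, innerH1_comm]

omit hab in
theorem MemH10.smul (c : ℝ) (hv : p.MemH10 v) : p.MemH10 (c • v) :=
  ⟨hv.1.smul c, by have := hv.2.smul c; rwa [smul_zero] at this⟩

omit hab in
theorem memH10_grad (l : ℝ) (W : p.GridFun N) : p.MemH10 (p.grad l W) := by
  unfold grad
  split_ifs with h
  · exact h.choose_spec.1
  · exact ⟨memH1_zero, ⟨fun _ _ => ⟨rfl, rfl⟩, fun _ _ _ _ _ => rfl⟩⟩

/-- A gradient is determined by `J_λ` as a functional on `H_{N,0}^{1,h}`. -/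
theorem IsGrad.inner_eq {l : ℝ} {G G' : p.GridFun N} (hG : p.IsGrad l W G)
    (hG' : p.IsGrad l W G') (hv : p.MemH10 v) : p.innerH1 G v = p.innerH1 G' v := by
  have hnv : 0 ≤ p.normH1 v := Real.sqrt_nonneg _
  have key : ∀ ε > 0, |p.innerH1 G v - p.innerH1 G' v| ≤ 2 * ε * p.normH1 v := by
    intro ε hε
    obtain ⟨η, hη, h1⟩ := hG.2 ε hε
    obtain ⟨η', hη', h2⟩ := hG'.2 ε hε
    set t := min η η' / (p.normH1 v + 1)
    have hm : 0 < min η η' := lt_min hη hη'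
    have ht : 0 < t := div_pos hm (by positivity)
    have htv : p.normH1 (t • v) < min η η' := by
      rw [normH1_smul t hv.1, abs_of_pos ht, div_mul_eq_mul_div, div_lt_iff₀ (by positivity)]
      nlinarith
    have a1 := h1 (t • v) (hv.smul t) (htv.trans_le (min_le_left _ _))
    have a2 := h2 (t • v) (hv.smul t) (htv.trans_le (min_le_right _ _))
    rw [innerH1_smul_right t hG.1.1 hv.1, normH1_smul t hv.1, abs_of_pos ht] at a1
    rw [innerH1_smul_right t hG'.1.1 hv.1, normH1_smul t hv.1, abs_of_pos ht] at a2
    have a3 : t * |p.innerH1 G v - p.innerH1 G' v| ≤ t * (2 * ε * p.normH1 v) := by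
      rw [← abs_of_pos ht, ← abs_mul, abs_of_pos ht]
      rw [abs_le] at a1 a2 ⊢
      constructor <;> linarith [a1.1, a1.2, a2.1, a2.2]
    exact le_of_mul_le_mul_left a3 ht
  have h0 : |p.innerH1 G v - p.innerH1 G' v| ≤ 0 := by
    refine le_of_forall_pos_le_add fun ε hε => ?_
    refine (key (ε / (2 * (p.normH1 v + 1))) (by positivity)).trans ?_
    rw [zero_add]
    calc _ = ε * (p.normH1 v / (p.normH1 v + 1)) := by field_simp
      _ ≤ ε * 1 := by
        gcongr
        rw [div_le_one (by positivity)]; linarith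
      _ = ε := mul_one ε
  exact sub_eq_zero.1 (abs_nonpos_iff.1 h0)

/-- The constant in the quadratic bound of the Taylor remainder of `J_λ`. -/
def remConst (n N : ℕ) (a b h₀ C : ℝ) (CF : ℝ → ℝ) (R l : ℝ) : ℝ :=
  (incConst n N a b C CF R + carlConst n N a b h₀ C CF R / (2 * l)) * Real.exp (2 * l * b)

theorem Regular.remConst_nonneg (hr : p.Regular N c₀ C h₀ CF DF) (R : ℝ) {l : ℝ} (hl : 0 < l) :
    0 ≤ remConst n N p.a p.b h₀ C CF R l := by
  have h1 := hr.carlConst_nonneg R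
  have h2 := incConst_nonneg n N p.a p.b C CF R
  unfold remConst
  positivity

theorem Regular.abs_taylor_J_le_norm (hr : p.Regular N c₀ C h₀ CF DF) (hn : 1 ≤ n)
    (hW : p.MemH1 W) (hv : p.MemH10 v) {R : ℝ} (hWR : p.normH1 W ≤ R)
    (hWvR : p.normH1 (W + v) ≤ R) {l : ℝ} (hl : 0 < l) :
    |p.J l (W + v) - p.J l W - p.dJ DF l W v|
      ≤ remConst n N p.a p.b h₀ C CF R l * p.normH1 v ^ 2 := by
  refine (hr.abs_taylor_J_le hn hW hv.1 hv.2 hWR hWvR hl).trans ?_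
  have h1 := hr.carlConst_nonneg R
  have h2 := incConst_nonneg n N p.a p.b C CF R
  rw [remConst, mul_assoc]
  gcongr
  exact wEnergy_le hn hv.1 hl.le

theorem normH1_add_le (hW : p.MemH1 W) (hv : p.MemH1 v) :
    p.normH1 (W + v) ≤ p.normH1 W + p.normH1 v := by
  let W' : p.H1 N := ⟨W, hW⟩
  let V : p.H1 N := ⟨v, hv⟩
  exact norm_add_le W' V

theorem Regular.isGrad_of_inner_eq (hr : p.Regular N c₀ C h₀ CF DF) (hn : 1 ≤ n)
    (hW : p.MemH1 W) {l : ℝ} (hl : 0 < l) {G : p.GridFun N} (hG : p.MemH10 G)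
    (h : ∀ v, p.MemH10 v → p.innerH1 G v = p.dJ DF l W v) : p.IsGrad l W G := by
  refine ⟨hG, fun ε hε => ?_⟩
  set L := remConst n N p.a p.b h₀ C CF (p.normH1 W + 1) l
  have hL : 0 ≤ L := hr.remConst_nonneg _ hl
  refine ⟨min 1 (ε / (L + 1)), lt_min one_pos (by positivity), fun v hv hvη => ?_⟩
  have hnv : 0 ≤ p.normH1 v := Real.sqrt_nonneg _
  have h1 : p.normH1 v ≤ 1 := hvη.le.trans (min_le_left _ _)
  have h2 : p.normH1 v ≤ ε / (L + 1) := hvη.le.trans (min_le_right _ _)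
  rw [le_div_iff₀ (by positivity)] at h2
  rw [h v hv]
  refine (hr.abs_taylor_J_le_norm hn hW hv (R := p.normH1 W + 1) (by linarith)
    ((normH1_add_le hW hv.1).trans (by linarith)) hl).trans ?_
  rw [pow_two, ← mul_assoc]
  gcongr
  change L * _ ≤ _
  linarith

/-- The Fréchet derivative of `J_λ`, represented through the scalar product of `H_N^{1,h}`. -/
theorem Regular.exists_isGrad (hr : p.Regular N c₀ C h₀ CF DF) (hn : 1 ≤ n)
    (hW : p.MemH1 W) {l : ℝ} (hl : 0 < l) :
    ∃ G, p.IsGrad l W G ∧ ∀ v, p.MemH10 v → p.innerH1 G v = p.dJ DF l W v := by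
  have := completeSpace_H10 (p := p) (N := N) hn (hr.h₀_pos.trans_le hr.h₀_le)
  obtain ⟨B, hB⟩ := hr.exists_dJ_le hn hW l
  let f : H10 p N →L[ℝ] ℝ := LinearMap.mkContinuous
    { toFun := fun v => p.dJ DF l W v.1.1
      map_add' := fun v v' => hr.dJ_add hW v.1.2 v'.1.2 l
      map_smul' := fun c v => dJ_smul c l } B fun v => hB v.1.1 v.1.2
  obtain ⟨G, hG⟩ := exists_riesz f
  have h : ∀ v, p.MemH10 v → p.innerH1 G.1.1 v = p.dJ DF l W v := fun v hv =>
    hG ⟨⟨v, hv.1⟩, hv.2⟩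
  exact ⟨G.1.1, hr.isGrad_of_inner_eq hn hW hl ⟨G.1.2, G.2⟩ h, h⟩

theorem Regular.isGrad_grad (hr : p.Regular N c₀ C h₀ CF DF) (hn : 1 ≤ n)
    (hW : p.MemH1 W) {l : ℝ} (hl : 0 < l) : p.IsGrad l W (p.grad l W) := by
  obtain ⟨G, hG, _⟩ := hr.exists_isGrad hn hW hl
  have hex : ∃ G, p.IsGrad l W G := ⟨G, hG⟩
  rw [grad, dif_pos hex]
  exact hex.choose_spec

theorem Regular.inner_grad (hr : p.Regular N c₀ C h₀ CF DF) (hn : 1 ≤ n)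
    (hW : p.MemH1 W) {l : ℝ} (hl : 0 < l) (hv : p.MemH10 v) :
    p.innerH1 (p.grad l W) v = p.dJ DF l W v := by
  obtain ⟨G, hG, h⟩ := hr.exists_isGrad hn hW hl
  rw [← h v hv]
  exact (hr.isGrad_grad hn hW hl).inner_eq hG hv

/-- A threshold of `λ` for the convexity of `J_λ` on balls of radius `R`. -/
def lamConst (n N : ℕ) (a b h₀ c₀ C : ℝ) (CF : ℝ → ℝ) (R : ℝ) : ℝ :=
  max 1 (2 * carlConst n N a b h₀ C CF R / c₀)

/-- The modulus of convexity of `J_λ`, up to the factor `e^{2λa}`. -/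
def convConst (n : ℕ) (a b h₀ c₀ : ℝ) : ℝ := c₀ / (4 * poincareConst n a b h₀)

theorem convConst_pos (hn : 1 ≤ n) {a b h₀ c₀ : ℝ} (hc : 0 < c₀) :
    0 < convConst n a b h₀ c₀ := by
  have hn' : (0 : ℝ) < n := by exact_mod_cast hn
  unfold convConst poincareConst
  positivity

/-- For `λ` above the threshold the error terms take at most half of the weighted energy that the
coercivity of `D_N` provides, and the Poincaré inequality turns the rest into the norm. -/
theorem Regular.convex_J (hr : p.Regular N c₀ C h₀ CF DF) (hn : 1 ≤ n)
    (hW : p.MemH1 W) (hv : p.MemH10 v) {R : ℝ} (hWR : p.normH1 W ≤ R)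
    (hWvR : p.normH1 (W + v) ≤ R) {l : ℝ} (hl : lamConst n N p.a p.b h₀ c₀ C CF R ≤ l) :
    convConst n p.a p.b h₀ c₀ * Real.exp (2 * l * p.a) * p.normH1 v ^ 2
      ≤ p.J l (W + v) - p.J l W - p.dJ DF l W v := by
  have hl1 : 1 ≤ l := (le_max_left _ _).trans hl
  have hl2 : 2 * carlConst n N p.a p.b h₀ C CF R / c₀ ≤ l := (le_max_right _ _).trans hl
  have hc := hr.c₀_pos
  rw [div_le_iff₀ hc] at hl2
  refine le_trans ?_ (hr.le_taylor_J hn hW hv.1 hv.2 hWR hWvR (by linarith))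
  have h1 : carlConst n N p.a p.b h₀ C CF R / (2 * l) ≤ c₀ / 4 := by
    rw [div_le_div_iff₀ (by linarith) (by norm_num)]
    linarith
  have h2 := le_wEnergy hv.1 hv.2 hr.h₀_pos hr.h₀_le (show 0 ≤ l by linarith)
  have hn' : (0 : ℝ) < n := by exact_mod_cast hn
  have hP : 0 < poincareConst n p.a p.b h₀ := by unfold poincareConst; positivity
  have hE := wEnergy_nonneg (p := p) l v
  calc _ = convConst n p.a p.b h₀ c₀ * (Real.exp (2 * l * p.a) * p.normH1 v ^ 2) := by ring
    _ ≤ convConst n p.a p.b h₀ c₀ * (poincareConst n p.a p.b h₀ * wEnergy l v) := by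
        have := convConst_pos hn (a := p.a) (b := p.b) (h₀ := h₀) hc
        gcongr
    _ = c₀ / 4 * wEnergy l v := by unfold convConst; field_simp
    _ ≤ _ := by
        gcongr
        linarith

omit hab in
theorem ClosedBall.sub_memH10 [Fact (p.a < p.b)] {R : ℝ} {P W₁ W₂ : p.GridFun N}
    (h₁ : W₁ ∈ p.ClosedBall R P) (h₂ : W₂ ∈ p.ClosedBall R P) : p.MemH10 (W₂ - W₁) := by
  refine ⟨h₂.1.sub h₁.1, ?_⟩
  have := h₂.2.1.sub h₁.2.1
  rwa [sub_self] at this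

theorem Regular.strictlyConvex (hr : p.Regular N c₀ C h₀ CF DF) (hn : 1 ≤ n) {R l : ℝ}
    (hl : lamConst n N p.a p.b h₀ c₀ C CF R ≤ l) (P : p.GridFun N) :
    p.StrictlyConvex l (convConst n p.a p.b h₀ c₀) R P := by
  have hl0 : 0 < l := one_pos.trans_le ((le_max_left _ _).trans hl)
  intro W₁ h₁
  refine ⟨hr.isGrad_grad hn h₁.1 hl0, fun W₂ h₂ => ?_⟩
  have hv := ClosedBall.sub_memH10 h₁ h₂
  rw [hr.inner_grad hn h₁.1 hl0 hv]
  have h := hr.convex_J hn h₁.1 hv h₁.2.2 (by rw [add_sub_cancel]; exact h₂.2.2) hl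
  rwa [add_sub_cancel] at h

theorem J_nonneg (l : ℝ) (W : p.GridFun N) : 0 ≤ p.J l W := by
  rw [J_eq]
  exact Finset.sum_nonneg fun g _ => integral_nonneg fun y =>
    mul_nonneg (Finset.sum_nonneg fun _ _ => sq_nonneg _) (Real.exp_pos _).le

/-! ### Convergence of gradient descent -/

/-- `J_λ` as a functional on the seminormed space `H_N^{1,h}`. -/
def JH1 (l : ℝ) (W : p.H1 N) : ℝ := p.J l W.1

/-- The gradient of `J_λ` as a map of the seminormed space `H_N^{1,h}`. -/
def gradH1 (l : ℝ) (W : p.H1 N) : p.H1 N := ⟨p.grad l W.1, (memH10_grad l W.1).1⟩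

theorem Regular.stronglyConvexOn (hr : p.Regular N c₀ C h₀ CF DF) (hn : 1 ≤ n) {R R' l : ℝ}
    (hRR : R ≤ R') (hl : lamConst n N p.a p.b h₀ c₀ C CF R' ≤ l) (S : p.H1 N) :
    StronglyConvexOn (affineBall (H10 p N) S R) (JH1 l) (gradH1 l)
      (convConst n p.a p.b h₀ c₀ * Real.exp (2 * l * p.a)) := by
  have hl0 : 0 < l := one_pos.trans_le ((le_max_left _ _).trans hl)
  intro W₁ h₁ W₂ h₂
  have hv : p.MemH10 (W₂ - W₁).1 := ⟨(W₂ - W₁).2, affineBall_sub_mem h₁ h₂⟩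
  have e : W₁.1 + (W₂ - W₁).1 = W₂.1 := congrArg Subtype.val (add_sub_cancel W₁ W₂)
  have h := hr.convex_J hn W₁.2 hv (h₁.2.trans hRR) (by rw [e]; exact h₂.2.trans hRR) hl
  rw [e, ← hr.inner_grad hn W₁.2 hl0 hv] at h
  exact h

theorem Regular.quadraticRemainderOn (hr : p.Regular N c₀ C h₀ CF DF) (hn : 1 ≤ n) (R : ℝ) {l : ℝ}
    (hl : 0 < l) (S : p.H1 N) :
    QuadraticRemainderOn (affineBall (H10 p N) S R) (JH1 l) (gradH1 l)
      (remConst n N p.a p.b h₀ C CF R l) := by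
  intro W₁ h₁ W₂ h₂
  have hv : p.MemH10 (W₂ - W₁).1 := ⟨(W₂ - W₁).2, affineBall_sub_mem h₁ h₂⟩
  have e : W₁.1 + (W₂ - W₁).1 = W₂.1 := congrArg Subtype.val (add_sub_cancel W₁ W₂)
  have h := hr.abs_taylor_J_le_norm hn W₁.2 hv h₁.2 (by rw [e]; exact h₂.2) hl
  rw [e, ← hr.inner_grad hn W₁.2 hl hv] at h
  exact h

theorem mem_affineBall_iff {R : ℝ} {S : p.H1 N} {P : p.GridFun N} (hS : p.BdryEq S.1 P)
    (W : p.H1 N) : W ∈ affineBall (H10 p N) S R ↔ W.1 ∈ p.ClosedBall R P := by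
  constructor
  · rintro ⟨h1, h2⟩
    refine ⟨W.2, ?_, h2⟩
    have h3 : p.BdryEq ((W - S).1 + S.1) (0 + P) := BdryEq.add h1 hS
    have e : (W - S).1 + S.1 = W.1 := congrArg Subtype.val (sub_add_cancel W S)
    rwa [e, zero_add] at h3
  · rintro ⟨_, h1, h2⟩
    refine ⟨?_, h2⟩
    have h3 : p.BdryEq (W.1 - S.1) (P - P) := h1.sub hS
    rw [sub_self] at h3
    exact h3

theorem memH1_descent {l γ : ℝ} {W0 : p.GridFun N} (h0 : p.MemH1 W0) (k : ℕ) :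
    p.MemH1 (p.descent l γ W0 k) := by
  induction k with
  | zero => exact h0
  | succ k ih => exact ih.sub ((memH10_grad l _).1.smul γ)

/-- The constant in the stability estimate of the minimizer. -/
def stabConst (n N : ℕ) (a b h₀ c₀ C : ℝ) (CF : ℝ → ℝ) (R l : ℝ) : ℝ :=
  Real.sqrt (Real.exp (2 * l * b) * incConst n N a b C CF R
    / (convConst n a b h₀ c₀ * Real.exp (2 * l * a))) + 1

/-- Existence, uniqueness and stability of the minimizer, and convergence of gradient descent.
The minimizer is compared with `W* + S - S*`, which has the boundary values of the noisy problem
and almost zero residual. -/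
theorem Regular.gradient_descent (hr : p.Regular N c₀ C h₀ CF DF) (hn : 1 ≤ n) {R l : ℝ}
    (hR : 0 < R) (hl : lamConst n N p.a p.b h₀ c₀ C CF (2 * R) ≤ l)
    {P Pstar S Sstar Wstar : p.GridFun N} {δ ρ : ℝ} (hρ : 0 < ρ) (hρR : ρ < R)
    (hS : p.MemH1 S) (hSP : p.BdryEq S P) (hSR : p.normH1 S < R)
    (hS' : p.MemH1 Sstar) (hSP' : p.BdryEq Sstar Pstar)
    (hSS : p.normH1 (S - Sstar) < δ) (hW : Wstar ∈ p.Ball ((R - ρ) / 3) Pstar)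
    (hsol : p.Solves Wstar)
    (hδ : stabConst n N p.a p.b h₀ c₀ C CF (2 * R) l * δ < ρ / 3) :
    ∃ Wmin : p.GridFun N, p.IsUniqueMin l R P Wmin ∧ p.MemH1 Wmin ∧ p.normH1 Wmin < R ∧
      p.normH1 (Wmin - Wstar) ≤ stabConst n N p.a p.b h₀ c₀ C CF (2 * R) l * δ ∧
      ∃ γ₀ : ℝ, 0 < γ₀ ∧ ∀ γ : ℝ, 0 < γ → γ ≤ γ₀ → ∃ θ : ℝ, 0 < θ ∧ θ < 1 ∧
        ∀ W0 ∈ p.Ball (R / 3) P, ∀ k : ℕ, p.descent l γ W0 k ∈ p.Ball R P ∧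
          p.IsGrad l (p.descent l γ W0 k) (p.grad l (p.descent l γ W0 k)) ∧
          p.normH1 (p.descent l γ W0 k - Wmin) ≤ θ ^ k * p.normH1 (W0 - Wmin) := by
  have := completeSpace_H10 (p := p) (N := N) hn (hr.h₀_pos.trans_le hr.h₀_le)
  have hl0 : 0 < l := one_pos.trans_le ((le_max_left _ _).trans hl)
  set μ := convConst n p.a p.b h₀ c₀ * Real.exp (2 * l * p.a)
  have hμ : 0 < μ := mul_pos (convConst_pos hn hr.c₀_pos) (Real.exp_pos _)
  set K := Real.exp (2 * l * p.b) * incConst n N p.a p.b C CF (2 * R)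
  have hK : 0 ≤ K := mul_nonneg (Real.exp_pos _).le (incConst_nonneg _ _ _ _ _ _ _)
  set C₃ := stabConst n N p.a p.b h₀ c₀ C CF (2 * R) l
  have hC₃ : C₃ = Real.sqrt (K / μ) + 1 := rfl
  have hδ0 : 0 ≤ δ := (Real.sqrt_nonneg _).trans hSS.le
  have hC₃1 : 1 ≤ C₃ := by rw [hC₃]; linarith [Real.sqrt_nonneg (K / μ)]
  have hδ1 : δ < ρ / 3 := lt_of_le_of_lt (le_mul_of_one_le_left hδ0 hC₃1) hδ
  let s : p.H1 N := ⟨S, hS⟩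
  let s' : p.H1 N := ⟨Sstar, hS'⟩
  let w' : p.H1 N := ⟨Wstar, hW.1⟩
  have hss : ‖s - s'‖ < δ := hSS
  have hw' : ‖w'‖ < (R - ρ) / 3 := hW.2.2
  have hc := hr.stronglyConvexOn hn (show R ≤ 2 * R by linarith) hl s
  have hq := hr.quadraticRemainderOn hn R hl0 s
  obtain ⟨z, hz, hzmin⟩ := exists_minimizer hμ (show ‖s‖ ≤ R from hSR.le)
    (fun w => J_nonneg l w.1) hc
  -- The competitor with the noisy boundary values.
  set x : p.H1 N := w' + (s - s')
  have hxn : ‖x‖ < R / 3 := by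
    refine (norm_add_le _ _).trans_lt ?_
    linarith
  have hx : x ∈ affineBall (H10 p N) s R := by
    refine ⟨?_, by linarith⟩
    have e : x - s = w' - s' := by simp only [x]; abel
    rw [e]
    have h3 : p.BdryEq (Wstar - Sstar) (Pstar - Pstar) := hW.2.1.sub hSP'
    rw [sub_self] at h3
    exact h3
  have hJx : JH1 l x ≤ K * δ ^ 2 := by
    have h1 := hr.J_add_le hn w'.2 (s - s').2 (R := 2 * R) (hw'.le.trans (by linarith))
      (show ‖x‖ ≤ 2 * R by linarith) hsol hl0.le
    refine h1.trans ?_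
    have h2 : p.normH1 (s - s').1 ≤ δ := hSS.le
    have h3 : 0 ≤ p.normH1 (s - s').1 := Real.sqrt_nonneg _
    gcongr
  have hxz : ‖x - z‖ ≤ Real.sqrt (K / μ) * δ := by
    have h1 := mul_norm_sq_le_of_minimizer hc hq hz hx hzmin
    have h2 := J_nonneg l z.1
    change 0 ≤ JH1 l z at h2
    refine abs_le_of_sq_le_sq' ?_ (by positivity) |>.2
    rw [mul_pow, Real.sq_sqrt (by positivity), div_mul_eq_mul_div, le_div_iff₀ hμ]
    linarith
  have hzw : ‖z - w'‖ ≤ C₃ * δ := by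
    have e : z - w' = -(x - z) + (s - s') := by simp only [x]; abel
    rw [e]
    refine (norm_add_le _ _).trans ?_
    rw [norm_neg, hC₃]
    linarith
  have hzR : ‖z‖ < R / 3 := by
    have e : z = (z - w') + w' := by abel
    rw [e]
    refine (norm_add_le _ _).trans_lt ?_
    linarith
  have hGH : ∀ w : p.H1 N, gradH1 l w ∈ H10 p N := fun w => (memH10_grad l w.1).2
  have hGz : ‖gradH1 l z‖ = 0 :=
    norm_grad_eq_zero_of_minimizer hGH hq hz.1 (by linarith) hzmin
  obtain ⟨γ₀, hγ₀, hdesc⟩ := exists_descent_rate hR hμ hGH (hr.remConst_nonneg (4 * R) hl0) hc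
    (hr.quadraticRemainderOn hn (4 * R) hl0 s) hz.1 hzR hGz
  have hzP : z.1 ∈ p.ClosedBall R P := (mem_affineBall_iff hSP z).1 hz
  refine ⟨z.1, ⟨⟨hzP, fun W hWP => ?_⟩, fun W hWP hmin g t y hy => ?_⟩, z.2, ?_, hzw, γ₀, hγ₀,
    fun γ hγ hγγ => ?_⟩
  · exact hzmin ⟨W, hWP.1⟩ ((mem_affineBall_iff hSP _).2 hWP)
  · have h0 := norm_sub_eq_zero_of_minimizers hμ hc hq hz
      ((mem_affineBall_iff hSP ⟨W, hWP.1⟩).2 hWP) hzmin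
      fun w hw => hmin w.1 ((mem_affineBall_iff hSP w).1 hw)
    have hv := ClosedBall.sub_memH10 hzP hWP
    have := eq_zero_of_normH1_eq_zero hn hv.1 hv.2 h0 g t hy
    exact sub_eq_zero.1 this
  · have : p.normH1 z.1 < R / 3 := hzR
    linarith
  · obtain ⟨θ, hθ0, hθ1, hθ⟩ := hdesc γ hγ hγγ
    refine ⟨θ, hθ0, hθ1, fun W0 hW0 k => ?_⟩
    let w : ℕ → p.H1 N := fun k => ⟨p.descent l γ W0 k, memH1_descent hW0.1 k⟩
    have hw0 : w 0 - s ∈ H10 p N := by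
      have h3 : p.BdryEq (W0 - S) (P - P) := hW0.2.1.sub hSP
      rw [sub_self] at h3
      exact h3
    obtain ⟨h1, h2, h3⟩ := hθ w (fun k => rfl) hw0 hW0.2.2 k
    refine ⟨⟨(w k).2, ((mem_affineBall_iff hSP (w k)).1 ⟨h1, h2.le⟩).2.1, h2⟩,
      hr.isGrad_grad hn (w k).2 hl0, h3⟩

end Space

end Model

/-! ### The orthonormal basis -/

section Basis

variable {d : ℝ}

/-- The function before normalization in the Gram-Schmidt process. -/
def rawPsi (d : ℝ) (s : ℕ) (α : ℝ) : ℝ :=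
  α ^ s * Real.exp α -
    ∑ r : Fin s, (∫ t in (-d)..d, t ^ s * Real.exp t * Psi d r.val t) * Psi d r.val α

theorem Psi_eq (d : ℝ) (s : ℕ) (α : ℝ) :
    Psi d s α = rawPsi d s α / Real.sqrt (∫ t in (-d)..d, rawPsi d s t ^ 2) := by
  rw [Psi]
  rfl

theorem integral_sq_eq_zero {f : ℝ → ℝ} (hd : 0 < d) (hf : Continuous f)
    (h : ∫ t in (-d)..d, f t ^ 2 = 0) : ∀ t ∈ Set.Ioo (-d) d, f t = 0 := by
  intro t ht
  by_contra hne
  have hpos : 0 < ∫ t in (-d)..d, f t ^ 2 :=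
    intervalIntegral.integral_pos (by linarith) (hf.pow 2).continuousOn
      (fun _ _ => sq_nonneg _) ⟨t, Set.Ioo_subset_Icc_self ht, by positivity⟩
  exact hpos.ne' h

open Polynomial in
/-- The induction behind the Gram-Schmidt process: `Ψ_s` is a polynomial of degree at most `s` times
the exponential, is normalized, and is orthogonal to the previous functions. -/
theorem Psi_spec (hd : 0 < d) (s : ℕ) :
    (∃ q : ℝ[X], q.degree ≤ s ∧ ∀ α, Psi d s α = q.eval α * Real.exp α) ∧
    (0 < ∫ t in (-d)..d, rawPsi d s t ^ 2) ∧
    (∫ t in (-d)..d, Psi d s t ^ 2 = 1) ∧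
    ∀ r < s, ∫ t in (-d)..d, Psi d s t * Psi d r t = 0 := by
  induction s using Nat.strong_induction_on with
  | _ s ih =>
  have hq : ∀ r : Fin s, ∃ q : ℝ[X], q.degree ≤ r.val ∧
      ∀ α, Psi d r α = q.eval α * Real.exp α := fun r => (ih r r.2).1
  choose q hqdeg hqeq using hq
  have hcont : ∀ r : Fin s, Continuous (Psi d r) := fun r => by
    rw [funext (hqeq r)]; fun_prop
  set c : Fin s → ℝ := fun r => ∫ t in (-d)..d, t ^ s * Real.exp t * Psi d r.val t
  set Q : ℝ[X] := X ^ s - ∑ r, C (c r) * q r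
  have hrawQ : ∀ α, rawPsi d s α = Q.eval α * Real.exp α := by
    intro α
    simp only [rawPsi, Q, eval_sub, eval_pow, eval_X, eval_finsetSum, eval_mul, eval_C, sub_mul,
      Finset.sum_mul]
    congr 1
    exact Finset.sum_congr rfl fun r _ => by rw [hqeq r]; simp only [c]; ring
  have hsumdeg : (∑ r, C (c r) * q r).degree < s := by
    rw [← mem_degreeLT]
    refine Submodule.sum_mem _ fun r _ => ?_
    rw [mem_degreeLT]
    refine lt_of_le_of_lt ?_ (WithBot.coe_lt_coe.2 r.2)
    refine (degree_mul_le _ _).trans ?_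
    calc (C (c r)).degree + (q r).degree ≤ 0 + (q r).degree := by
          gcongr; exact degree_C_le
      _ ≤ _ := by rw [zero_add]; exact hqdeg r
  have hQdeg : Q.degree = s := by
    rw [degree_sub_eq_left_of_degree_lt (by rwa [degree_X_pow]), degree_X_pow]
  have hQ0 : Q ≠ 0 := by
    intro h
    rw [h, degree_zero] at hQdeg
    exact WithBot.bot_ne_coe hQdeg
  have hrawcont : Continuous (rawPsi d s) := by
    rw [funext hrawQ]; fun_prop
  have hpos : 0 < ∫ t in (-d)..d, rawPsi d s t ^ 2 := by
    refine lt_of_le_of_ne (intervalIntegral.integral_nonneg (by linarith)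
      fun _ _ => sq_nonneg _) fun h => hQ0 ?_
    refine eq_zero_of_infinite_isRoot Q ((Set.Ioo_infinite (by linarith : -d < d)).mono ?_)
    intro t ht
    have := integral_sq_eq_zero hd hrawcont h.symm t ht
    rw [hrawQ] at this
    exact (mul_eq_zero.1 this).resolve_right (Real.exp_pos t).ne'
  set m := Real.sqrt (∫ t in (-d)..d, rawPsi d s t ^ 2)
  have hm : 0 < m := Real.sqrt_pos.2 hpos
  have hPsi : ∀ α, Psi d s α = rawPsi d s α / m := Psi_eq d s
  refine ⟨⟨C m⁻¹ * Q, ?_, fun α => ?_⟩, hpos, ?_, fun r hr => ?_⟩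
  · refine (degree_mul_le _ _).trans ?_
    calc (C m⁻¹).degree + Q.degree ≤ 0 + Q.degree := by gcongr; exact degree_C_le
      _ ≤ _ := by rw [zero_add, hQdeg]
  · rw [hPsi, hrawQ, eval_mul, eval_C]
    field_simp
  · simp_rw [hPsi, div_pow]
    rw [intervalIntegral.integral_div, Real.sq_sqrt hpos.le, div_self hpos.ne']
  · have hraw0 : ∫ t in (-d)..d, rawPsi d s t * Psi d r t = 0 := by
      have hr' := hcont ⟨r, hr⟩
      have e : ∀ t, rawPsi d s t * Psi d r t = t ^ s * Real.exp t * Psi d r t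
          - ∑ j : Fin s, c j * (Psi d j t * Psi d r t) := by
        intro t
        simp only [rawPsi, sub_mul, Finset.sum_mul, c]
        congr 1
        exact Finset.sum_congr rfl fun j _ => by ring
      simp_rw [e]
      have hij : ∀ j ∈ (Finset.univ : Finset (Fin s)), IntervalIntegrable
          (fun t => c j * (Psi d j t * Psi d r t)) volume (-d) d := fun j _ =>
        (continuous_const.mul ((hcont j).mul hr')).intervalIntegrable _ _
      rw [intervalIntegral.integral_sub
        (Continuous.intervalIntegrable (by fun_prop) _ _)
        (Continuous.intervalIntegrable (by fun_prop) _ _),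
        intervalIntegral.integral_finsetSum hij]
      simp only [intervalIntegral.integral_const_mul]
      rw [Finset.sum_eq_single (⟨r, hr⟩ : Fin s)]
      · have h1 : ∫ t in (-d)..d, Psi d r t * Psi d r t = 1 := by
          have := (ih r hr).2.2.1
          simpa [pow_two] using this
        simp only [c]
        rw [h1]
        ring
      · intro j _ hj
        rcases lt_trichotomy j.val r with h | h | h
        · have := (ih r hr).2.2.2 j h
          simp_rw [mul_comm (Psi d j _)]
          rw [this, mul_zero]
        · exact absurd (Fin.ext h) hj
        · rw [(ih j j.2).2.2.2 r h, mul_zero]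
      · intro h
        exact absurd (Finset.mem_univ _) h
    simp_rw [hPsi, div_mul_eq_mul_div]
    rw [intervalIntegral.integral_div, hraw0, zero_div]

variable (hd : 0 < d)
include hd

theorem contDiff_Psi (s : ℕ) : ContDiff ℝ ⊤ (Psi d s) := by
  obtain ⟨q, _, hq⟩ := (Psi_spec hd s).1
  rw [funext hq]
  have h : ContDiff ℝ ⊤ fun x => q.eval x := by simpa using q.contDiff_aeval (𝕜 := ℝ) ⊤
  exact h.mul Real.contDiff_exp

theorem continuous_Psi (s : ℕ) : Continuous (Psi d s) := (contDiff_Psi hd s).continuous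

theorem differentiable_Psi (s : ℕ) : Differentiable ℝ (Psi d s) :=
  (contDiff_Psi hd s).differentiable (by simp)

theorem continuous_deriv_Psi (s : ℕ) : Continuous (deriv (Psi d s)) :=
  (contDiff_Psi hd s).continuous_deriv (by simp)

theorem integral_Psi_mul_Psi {r s : ℕ} (h : r ≠ s) :
    ∫ t in (-d)..d, Psi d r t * Psi d s t = 0 := by
  rcases lt_or_gt_of_ne h with h | h
  · simp_rw [mul_comm (Psi d r _)]
    exact (Psi_spec hd s).2.2.2 r h
  · exact (Psi_spec hd r).2.2.2 s h

theorem integral_pow_mul_Psi {j k : ℕ} (hjk : j < k) :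
    ∫ t in (-d)..d, t ^ j * Real.exp t * Psi d k t = 0 := by
  have hpos := (Psi_spec hd j).2.1
  set m := Real.sqrt (∫ t in (-d)..d, rawPsi d j t ^ 2)
  have hm : 0 < m := Real.sqrt_pos.2 hpos
  have e : ∀ t, t ^ j * Real.exp t * Psi d k t = m * (Psi d j t * Psi d k t)
      + ∑ r : Fin j, (∫ t in (-d)..d, t ^ j * Real.exp t * Psi d r.val t) *
        (Psi d r.val t * Psi d k t) := by
    intro t
    have h1 : m * Psi d j t = rawPsi d j t := by
      rw [Psi_eq d j t]
      exact mul_div_cancel₀ _ hm.ne'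
    have h2 : t ^ j * Real.exp t = m * Psi d j t +
        ∑ r : Fin j, (∫ t in (-d)..d, t ^ j * Real.exp t * Psi d r.val t) * Psi d r.val t := by
      rw [h1, rawPsi]; ring
    rw [h2, add_mul, Finset.sum_mul, mul_assoc]
    congr 1
    exact Finset.sum_congr rfl fun r _ => mul_assoc _ _ _
  have hc := continuous_Psi hd
  simp_rw [e]
  have hij : ∀ r ∈ (Finset.univ : Finset (Fin j)), IntervalIntegrable
      (fun t => (∫ t in (-d)..d, t ^ j * Real.exp t * Psi d r.val t) *
        (Psi d r.val t * Psi d k t)) volume (-d) d := fun r _ =>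
    (continuous_const.mul ((hc r).mul (hc k))).intervalIntegrable _ _
  have hcj := hc j
  have hck := hc k
  rw [intervalIntegral.integral_add (Continuous.intervalIntegrable (by fun_prop) _ _)
    (Continuous.intervalIntegrable (by fun_prop) _ _), intervalIntegral.integral_finsetSum hij]
  simp only [intervalIntegral.integral_const_mul]
  rw [integral_Psi_mul_Psi hd hjk.ne, mul_zero, zero_add]
  refine Finset.sum_eq_zero fun r _ => ?_
  rw [integral_Psi_mul_Psi hd (r.2.trans hjk).ne, mul_zero]

open Polynomial in
theorem integral_polynomial_mul_Psi {q : ℝ[X]} {k : ℕ} (hq : q.degree < k) :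
    ∫ t in (-d)..d, q.eval t * Real.exp t * Psi d k t = 0 := by
  rcases Nat.eq_zero_or_pos k with rfl | hk
  · have : q = 0 := by
      rw [← degree_eq_bot]
      exact Nat.WithBot.lt_zero_iff.1 (by simpa using hq)
    simp [this]
  have hn : q.natDegree < k := by
    rcases eq_or_ne q 0 with rfl | h0
    · simpa using hk
    · exact (natDegree_lt_iff_degree_lt h0).2 hq
  have hc := continuous_Psi hd k
  have e : ∀ t, q.eval t * Real.exp t * Psi d k t
      = ∑ j ∈ Finset.range k, q.coeff j * (t ^ j * Real.exp t * Psi d k t) := by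
    intro t
    rw [eval_eq_sum_range' hn, Finset.sum_mul, Finset.sum_mul]
    exact Finset.sum_congr rfl fun j _ => by ring
  simp_rw [e]
  rw [intervalIntegral.integral_finsetSum fun j _ =>
    Continuous.intervalIntegrable (by fun_prop) _ _]
  refine Finset.sum_eq_zero fun j hj => ?_
  rw [intervalIntegral.integral_const_mul, integral_pow_mul_Psi hd (Finset.mem_range.1 hj),
    mul_zero]

open Polynomial in
/-- The matrix `(∫ Ψ_s' Ψ_k)` is upper triangular with unit diagonal, because
`Ψ_s' - Ψ_s` is a polynomial of degree less than `s` times the exponential. -/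
theorem integral_deriv_Psi_mul_Psi {k s : ℕ} (hsk : s ≤ k) :
    ∫ t in (-d)..d, deriv (Psi d s) t * Psi d k t = if s = k then 1 else 0 := by
  obtain ⟨q, hqdeg, hq⟩ := (Psi_spec hd s).1
  have hq0 : q ≠ 0 := by
    rintro rfl
    have h1 := (Psi_spec hd s).2.2.1
    simp [hq] at h1
  have hder : ∀ t, deriv (Psi d s) t = Psi d s t + q.derivative.eval t * Real.exp t := by
    intro t
    rw [funext hq]
    rw [((q.hasDerivAt t).fun_mul (Real.hasDerivAt_exp t)).deriv]
    ring
  have hc := continuous_Psi hd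
  have hcs := hc s
  have hck := hc k
  simp_rw [hder, add_mul]
  rw [intervalIntegral.integral_add (Continuous.intervalIntegrable (by fun_prop) _ _)
    (Continuous.intervalIntegrable (by fun_prop) _ _)]
  have h2 : q.derivative.degree < k :=
    (degree_derivative_lt hq0).trans_le (hqdeg.trans (by exact_mod_cast hsk))
  rw [integral_polynomial_mul_Psi hd h2, add_zero]
  split_ifs with h
  · subst h
    simpa [pow_two] using (Psi_spec hd s).2.2.1
  · exact integral_Psi_mul_Psi hd h

/-- Uniform bounds for the first `N` basis functions and their derivatives. -/
theorem exists_Psi_bound (N : ℕ) : ∃ B : ℝ, 1 ≤ B ∧ ∀ s : Fin N, ∀ α ∈ Set.Icc (-d) d,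
    |Psi d s α| ≤ B ∧ |deriv (Psi d s) α| ≤ B := by
  have h : ∀ s : Fin N, ∃ B : ℝ, ∀ α ∈ Set.Icc (-d) d,
      |Psi d s α| ≤ B ∧ |deriv (Psi d s) α| ≤ B := by
    intro s
    obtain ⟨B₁, h₁⟩ := isCompact_Icc.exists_bound_of_continuousOn
      (continuous_Psi hd s).continuousOn (s := Set.Icc (-d) d)
    obtain ⟨B₂, h₂⟩ := isCompact_Icc.exists_bound_of_continuousOn
      (continuous_deriv_Psi hd s).continuousOn (s := Set.Icc (-d) d)
    exact ⟨max B₁ B₂, fun α hα => ⟨(h₁ α hα).trans (le_max_left _ _),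
      (h₂ α hα).trans (le_max_right _ _)⟩⟩
  choose B hB using h
  refine ⟨1 + ∑ s, |B s|, ?_, fun s α hα => ?_⟩
  · have : 0 ≤ ∑ s, |B s| := Finset.sum_nonneg fun _ _ => abs_nonneg _
    linarith
  · have h1 : |B s| ≤ ∑ s, |B s| :=
      Finset.single_le_sum (f := fun s => |B s|) (fun _ _ => abs_nonneg _) (Finset.mem_univ s)
    have h2 := le_abs_self (B s)
    exact ⟨(hB s α hα).1.trans (by linarith), (hB s α hα).2.trans (by linarith)⟩

/-- The invertibility of the matrix `(∫ Ψ_s' Ψ_k)`, in quantitative form. -/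
theorem exists_derivMatrix_coercive (N : ℕ) : ∃ m₀ : ℝ, 0 < m₀ ∧ ∀ v : Fin N → ℝ,
    m₀ * ∑ s, v s ^ 2
      ≤ ∑ k : Fin N, (∑ s : Fin N, (∫ t in (-d)..d, deriv (Psi d s) t * Psi d k t) * v s) ^ 2 := by
  set M : Matrix (Fin N) (Fin N) ℝ :=
    Matrix.of fun k s => ∫ t in (-d)..d, deriv (Psi d s) t * Psi d k t
  have htri : M.BlockTriangular id := by
    intro i j hij
    have hij' : j.val < i.val := hij
    have := integral_deriv_Psi_mul_Psi hd hij'.le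
    rw [if_neg hij'.ne] at this
    exact this
  have hdet : M.det = 1 := by
    rw [Matrix.det_of_isUpperTriangular htri]
    refine Finset.prod_eq_one fun i _ => ?_
    have := integral_deriv_Psi_mul_Psi hd (le_refl i.val)
    rw [if_pos rfl] at this
    exact this
  have hinv : M⁻¹ * M = 1 := Matrix.nonsing_inv_mul M (by rw [hdet]; exact isUnit_one)
  set B := ∑ i, ∑ j, |M⁻¹ i j|
  have hB0 : 0 ≤ B := Finset.sum_nonneg fun _ _ => Finset.sum_nonneg fun _ _ => abs_nonneg _
  have hB : ∀ i j, |M⁻¹ i j| ≤ B := fun i j =>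
    (Finset.single_le_sum (f := fun j => |M⁻¹ i j|) (fun _ _ => abs_nonneg _)
      (Finset.mem_univ j)).trans
      (Finset.single_le_sum (f := fun i => ∑ j, |M⁻¹ i j|)
        (fun _ _ => Finset.sum_nonneg fun _ _ => abs_nonneg _) (Finset.mem_univ i))
  refine ⟨1 / (N * (N * B ^ 2) + 1), by positivity, fun v => ?_⟩
  have hMv : ∀ k : Fin N, (∑ s : Fin N, (∫ t in (-d)..d, deriv (Psi d s) t * Psi d k t) * v s)
      = M.mulVec v k := fun k => rfl
  simp_rw [hMv]
  set u := M.mulVec v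
  have hv : v = M⁻¹.mulVec u := by rw [Matrix.mulVec_mulVec, hinv, Matrix.one_mulVec]
  have h1 : ∑ s, v s ^ 2 ≤ N * (N * B ^ 2) * ∑ k, u k ^ 2 := by
    calc ∑ s, v s ^ 2 ≤ ∑ _s : Fin N, N * B ^ 2 * ∑ k, u k ^ 2 :=
          Finset.sum_le_sum fun s _ => by
            have := sq_sum_mul_le u (fun k => hB s k)
            rw [Fintype.card_fin] at this
            rw [hv]
            exact this
      _ = _ := by simp; ring
  have h2 : 0 ≤ ∑ k, u k ^ 2 := Finset.sum_nonneg fun _ _ => sq_nonneg _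
  rw [div_mul_eq_mul_div, one_mul, div_le_iff₀ (by positivity)]
  linarith

end Basis

/-! ### The direction `ν` and the matrices of the linear part -/

section Geometry

variable {n : ℕ} {x : Fin n → ℝ} {y α H : ℝ}

/-- The square of the distance to the source. -/
def distSq (x : Fin n → ℝ) (y α : ℝ) : ℝ := (∑ i, shift x α i ^ 2) + y ^ 2

/-- The coordinate `x_1 - α`, that is half of minus the derivative of `distSq` with respect to the
position `α` of the source. It is written as a sum so that it makes sense for `n = 0`, too. -/
def slope (x : Fin n → ℝ) (α : ℝ) : ℝ := ∑ i : Fin n, shift x α i * (if i.val = 0 then 1 else 0)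

theorem dist0_eq : dist0 x y α = Real.sqrt (distSq x y α) := rfl

theorem sq_le_distSq : y ^ 2 ≤ distSq x y α :=
  le_add_of_nonneg_left (Finset.sum_nonneg fun _ _ => sq_nonneg _)

theorem shift_sq_le_distSq (i : Fin n) : shift x α i ^ 2 ≤ distSq x y α :=
  (Finset.single_le_sum (f := fun i => shift x α i ^ 2) (fun _ _ => sq_nonneg _)
    (Finset.mem_univ i)).trans (le_add_of_nonneg_right (sq_nonneg y))

theorem distSq_pos (hy : 0 < y) : 0 < distSq x y α := (pow_pos hy 2).trans_le sq_le_distSq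

theorem dist0_pos (hy : 0 < y) : 0 < dist0 x y α := Real.sqrt_pos.2 (distSq_pos hy)

theorem dist0_sq (hy : 0 < y) : dist0 x y α ^ 2 = distSq x y α := Real.sq_sqrt (distSq_pos hy).le

theorem abs_nu_le_one (hy : 0 < y) (i : Fin n) : |nu x y α i| ≤ 1 := by
  rw [nu, abs_div, abs_of_pos (dist0_pos hy), div_le_one (dist0_pos hy), dist0_eq,
    ← Real.sqrt_sq_eq_abs]
  exact Real.sqrt_le_sqrt (shift_sq_le_distSq i)

theorem abs_nuLast_le_one (hy : 0 < y) : |nuLast x y α| ≤ 1 := by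
  rw [nuLast, abs_div, abs_of_pos (dist0_pos hy), div_le_one (dist0_pos hy), dist0_eq,
    ← Real.sqrt_sq_eq_abs]
  exact Real.sqrt_le_sqrt sq_le_distSq

theorem hasDerivAt_shift (i : Fin n) :
    HasDerivAt (fun t => shift x t i) (-(if i.val = 0 then 1 else 0)) α := by
  unfold shift
  split_ifs
  · simpa using (hasDerivAt_id α).const_sub (x i)
  · simpa using hasDerivAt_const α (x i)

theorem hasDerivAt_distSq : HasDerivAt (fun t => distSq x y t) (-(2 * slope x α)) α := by
  have h := HasDerivAt.fun_sum (u := Finset.univ) fun i _ =>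
    (hasDerivAt_shift (x := x) (α := α) i).fun_pow 2
  refine (h.add_const (y ^ 2)).congr_deriv ?_
  rw [slope, Finset.mul_sum, ← Finset.sum_neg_distrib]
  exact Finset.sum_congr rfl fun i _ => by push_cast; ring

theorem hasDerivAt_dist0 (hy : 0 < y) :
    HasDerivAt (fun t => dist0 x y t) (-(slope x α / dist0 x y α)) α := by
  refine (hasDerivAt_distSq.sqrt (distSq_pos hy).ne').congr_deriv ?_
  rw [← dist0_eq]
  have := dist0_pos (x := x) (α := α) hy
  field_simp

theorem continuous_shift (i : Fin n) : Continuous fun t => shift x t i :=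
  continuous_iff_continuousAt.2 fun _ => (hasDerivAt_shift i).continuousAt

theorem continuous_dist0 (hy : 0 < y) : Continuous fun t => dist0 x y t :=
  continuous_iff_continuousAt.2 fun _ => (hasDerivAt_dist0 hy).continuousAt

theorem deriv_nuLast_div (hy : 0 < y) :
    deriv (fun t => nuLast x y t) α / nuLast x y α = slope x α / distSq x y α := by
  have hr := dist0_pos (x := x) (α := α) hy
  have h := (hasDerivAt_const α y).fun_div (hasDerivAt_dist0 (x := x) hy) hr.ne'
  have h' : deriv (fun t => nuLast x y t) α = _ := h.deriv
  rw [h', nuLast, ← dist0_sq hy]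
  field_simp
  ring

theorem nu_div_nuLast (hy : 0 < y) (i : Fin n) :
    nu x y α i / nuLast x y α = shift x α i / y := by
  have hr := dist0_pos (x := x) (α := α) hy
  rw [nu, nuLast]
  field_simp

theorem deriv_nu_div (hy : 0 < y) (i : Fin n) :
    deriv (fun t => nu x y t i) α / nuLast x y α
      = (-(if i.val = 0 then 1 else 0) + shift x α i * slope x α / distSq x y α) / y := by
  have hr := dist0_pos (x := x) (α := α) hy
  have h := (hasDerivAt_shift (x := x) (α := α) i).fun_div (hasDerivAt_dist0 (x := x) hy) hr.ne'
  have h' : deriv (fun t => nu x y t i) α = _ := h.deriv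
  rw [h', nuLast, ← dist0_sq hy]
  field_simp
  ring

theorem abs_slope_le (hH : 0 ≤ H) (hs : ∀ i, |shift x α i| ≤ H) : |slope x α| ≤ H := by
  unfold slope
  cases n with
  | zero => simpa using hH
  | succ k =>
    rw [Fin.sum_univ_succ]
    simpa using hs 0

theorem abs_slope_div_le (hy : 0 < y) (hH : 0 ≤ H) (hs : ∀ i, |shift x α i| ≤ H) :
    |slope x α / distSq x y α| ≤ H / y ^ 2 := by
  rw [abs_div, abs_of_pos (distSq_pos hy)]
  exact div_le_div₀ hH (abs_slope_le hH hs) (pow_pos hy 2) sq_le_distSq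

theorem abs_shift_le {A d : ℝ} (hd : 0 ≤ d) (hx : ∀ i, -A ≤ x i ∧ x i ≤ A) (hα : α ∈ Set.Icc (-d) d)
    (i : Fin n) : |shift x α i| ≤ A + d := by
  have h1 := hx i
  rw [Set.mem_Icc] at hα
  unfold shift
  split_ifs <;> rw [abs_le] <;> constructor <;> linarith [h1.1, h1.2, hα.1, hα.2]

theorem measurable_shift (x : Fin n → ℝ) (i : Fin n) : Measurable fun t => shift x t i :=
  (continuous_shift i).measurable

theorem measurable_slope (x : Fin n → ℝ) : Measurable fun t => slope x t := by
  unfold slope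
  exact Finset.measurable_sum _ fun i _ => (measurable_shift x i).mul_const _

theorem measurable_distSq (x : Fin n → ℝ) : Measurable fun z : ℝ × ℝ => distSq x z.1 z.2 := by
  unfold distSq
  refine (Finset.measurable_sum _ fun i _ =>
    ((measurable_shift x i).comp measurable_snd).pow_const 2).add (measurable_fst.pow_const 2)

theorem measurable_dist0 (x : Fin n → ℝ) : Measurable fun z : ℝ × ℝ => dist0 x z.1 z.2 :=
  (measurable_distSq x).sqrt

end Geometry

/-- A parametric integral of a jointly measurable function is measurable. -/
theorem stronglyMeasurable_intervalIntegral {f : ℝ → ℝ → ℝ} (d : ℝ)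
    (hf : Measurable fun z : ℝ × ℝ => f z.1 z.2) :
    StronglyMeasurable fun y => ∫ α in (-d)..d, f y α := by
  unfold intervalIntegral
  exact (StronglyMeasurable.integral_prod_right' (ν := volume.restrict (Set.Ioc (-d) d))
    hf.stronglyMeasurable).sub (StronglyMeasurable.integral_prod_right'
      (ν := volume.restrict (Set.Ioc d (-d))) hf.stronglyMeasurable)

theorem abs_intervalIntegral_le {f : ℝ → ℝ} {d C : ℝ} (hd : 0 < d)
    (hf : ∀ α ∈ Set.Icc (-d) d, |f α| ≤ C) : |∫ α in (-d)..d, f α| ≤ 2 * d * C := by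
  have h := intervalIntegral.norm_integral_le_of_norm_le_const (f := f) (a := -d) (b := d) (C := C)
    fun t ht => hf t (by
      rw [Set.uIoc_of_le (by linarith)] at ht
      exact Set.Ioc_subset_Icc_self ht)
  rw [Real.norm_eq_abs, abs_of_nonneg (by linarith : 0 ≤ d - -d)] at h
  linarith

namespace Model

variable {n : ℕ} {p : Model n} {N : ℕ}

theorem pt_mem {p : Model n} (hA : 0 < p.A) (hm : 1 < p.m) (g : p.Grid) (i : Fin n) :
    -p.A ≤ p.pt g i ∧ p.pt g i ≤ p.A := by
  have hm0 : (0 : ℝ) < p.m := by exact_mod_cast (zero_lt_one.trans hm)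
  have hg : ((g i).val : ℝ) ≤ p.m := by exact_mod_cast Nat.le_of_lt_succ (g i).2
  have h2 : (p.m : ℝ) * p.h = 2 * p.A := by
    unfold h; field_simp
  have h0 : 0 ≤ p.h := by unfold h; positivity
  have h3 := mul_le_mul_of_nonneg_right hg h0
  have h4 : 0 ≤ ((g i).val : ℝ) * p.h := by positivity
  unfold pt
  constructor <;> linarith

section Matrices

variable (hd : 0 < p.d) {x : Fin n → ℝ} {y : ℝ}

theorem D_eq (hy : 0 < y) (k s : Fin N) : p.D x y k s = ∫ α in (-p.d)..p.d,
    (deriv (Psi p.d s) α + slope x α / distSq x y α * Psi p.d s α) * Psi p.d k α := by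
  unfold D
  simp_rw [deriv_nuLast_div hy]

theorem Amat_eq (hy : 0 < y) (i : Fin n) (k s : Fin N) :
    p.Amat i x y k s = ∫ α in (-p.d)..p.d, (shift x α i / y * deriv (Psi p.d s) α
      + (-(if i.val = 0 then 1 else 0) + shift x α i * slope x α / distSq x y α) / y
        * Psi p.d s α) * Psi p.d k α := by
  unfold Amat
  simp_rw [nu_div_nuLast hy, deriv_nu_div hy]

include hd

/-- `D_N` differs from the matrix `(∫ Ψ_s' Ψ_k)` by `O(y⁻²)`. -/
theorem abs_D_sub_le {B H : ℝ} (hB0 : 0 ≤ B) (hH : 0 ≤ H)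
    (hB : ∀ s : Fin N, ∀ α ∈ Set.Icc (-p.d) p.d, |Psi p.d s α| ≤ B)
    (hs : ∀ α ∈ Set.Icc (-p.d) p.d, ∀ i, |shift x α i| ≤ H) (hy : 0 < y) (k s : Fin N) :
    |(∫ α in (-p.d)..p.d, deriv (Psi p.d s) α * Psi p.d k α) - p.D x y k s|
      ≤ 2 * p.d * (H * B ^ 2) / y ^ 2 := by
  have c1 := continuous_Psi hd
  have c1s := c1 s
  have c1k := c1 k
  have c2 := continuous_deriv_Psi hd s
  have c3 : Continuous fun α => slope x α / distSq x y α := by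
    refine Continuous.div (continuous_finsetSum _ fun i _ => (continuous_shift i).mul_const _)
      (continuous_iff_continuousAt.2 fun _ => hasDerivAt_distSq.continuousAt)
      fun α => (distSq_pos hy).ne'
  rw [D_eq hy, ← intervalIntegral.integral_sub (Continuous.intervalIntegrable (by fun_prop) _ _)
    (Continuous.intervalIntegrable (by fun_prop) _ _)]
  have e : 2 * p.d * (H * B ^ 2) / y ^ 2 = 2 * p.d * (H / y ^ 2 * B * B) := by ring
  rw [e]
  refine abs_intervalIntegral_le hd fun α hα => ?_
  have e2 : deriv (Psi p.d s) α * Psi p.d k α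
      - (deriv (Psi p.d s) α + slope x α / distSq x y α * Psi p.d s α) * Psi p.d k α
      = -(slope x α / distSq x y α * Psi p.d s α * Psi p.d k α) := by ring
  rw [e2, abs_neg, abs_mul, abs_mul]
  have h1 := abs_slope_div_le hy hH (hs α hα)
  gcongr
  · exact hB s α hα
  · exact hB k α hα

theorem abs_D_le {B H : ℝ} (hB0 : 0 ≤ B) (hH : 0 ≤ H)
    (hB : ∀ s : Fin N, ∀ α ∈ Set.Icc (-p.d) p.d, |Psi p.d s α| ≤ B ∧ |deriv (Psi p.d s) α| ≤ B)
    (hs : ∀ α ∈ Set.Icc (-p.d) p.d, ∀ i, |shift x α i| ≤ H) (hy : 1 ≤ y) (k s : Fin N) :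
    |p.D x y k s| ≤ 2 * p.d * ((B + H * B) * B) := by
  have hy0 : 0 < y := by linarith
  rw [D_eq hy0]
  refine abs_intervalIntegral_le hd fun α hα => ?_
  have h1 := abs_slope_div_le hy0 hH (hs α hα)
  have h2 : H / y ^ 2 ≤ H := div_le_self hH (one_le_pow₀ hy)
  rw [abs_mul]
  have h3 := (abs_add_le (deriv (Psi p.d s) α) (slope x α / distSq x y α * Psi p.d s α)).trans
    (add_le_add (hB s α hα).2 ((abs_mul _ _).trans_le
      (mul_le_mul (h1.trans h2) (hB s α hα).1 (abs_nonneg _) hH)))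
  exact mul_le_mul h3 (hB k α hα).1 (abs_nonneg _) (by positivity)

theorem abs_Amat_le {B H : ℝ} (hB0 : 0 ≤ B) (hH : 0 ≤ H)
    (hB : ∀ s : Fin N, ∀ α ∈ Set.Icc (-p.d) p.d, |Psi p.d s α| ≤ B ∧ |deriv (Psi p.d s) α| ≤ B)
    (hs : ∀ α ∈ Set.Icc (-p.d) p.d, ∀ i, |shift x α i| ≤ H) (hy : 1 ≤ y) (i : Fin n)
    (k s : Fin N) :
    |p.Amat i x y k s| ≤ 2 * p.d * ((H * B + (1 + H * H) * B) * B) := by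
  have hy0 : 0 < y := by linarith
  rw [Amat_eq hy0]
  refine abs_intervalIntegral_le hd fun α hα => ?_
  have h1 := (abs_slope_div_le hy0 hH (hs α hα)).trans (div_le_self hH (one_le_pow₀ hy))
  have h2 : |shift x α i / y| ≤ H := by
    rw [abs_div, abs_of_pos hy0]
    exact (div_le_self (abs_nonneg _) hy).trans (hs α hα i)
  have h3 : |(-(if i.val = 0 then 1 else 0) + shift x α i * slope x α / distSq x y α) / y|
      ≤ 1 + H * H := by
    rw [abs_div, abs_of_pos hy0]
    refine (div_le_self (abs_nonneg _) hy).trans ((abs_add_le _ _).trans (add_le_add ?_ ?_))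
    · split_ifs <;> simp
    · rw [mul_div_assoc, abs_mul]
      exact mul_le_mul (hs α hα i) h1 (abs_nonneg _) hH
  rw [abs_mul]
  refine mul_le_mul ((abs_add_le _ _).trans (add_le_add ?_ ?_)) (hB k α hα).1 (abs_nonneg _)
    (by positivity)
  · rw [abs_mul]
    exact mul_le_mul h2 (hB s α hα).2 (abs_nonneg _) hH
  · rw [abs_mul]
    exact mul_le_mul h3 (hB s α hα).1 (abs_nonneg _) (by positivity)

theorem aestronglyMeasurable_D (ha : 0 ≤ p.a) (k s : Fin N) :
    AEStronglyMeasurable (fun y => p.D x y k s) p.mu := by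
  have m1 : ∀ k : Fin N, Measurable fun z : ℝ × ℝ => Psi p.d k z.2 := fun k =>
    (continuous_Psi hd k).measurable.comp measurable_snd
  have m2 : Measurable fun z : ℝ × ℝ => deriv (Psi p.d s) z.2 :=
    (continuous_deriv_Psi hd s).measurable.comp measurable_snd
  have m3 : Measurable fun z : ℝ × ℝ => slope x z.2 := (measurable_slope x).comp measurable_snd
  refine (stronglyMeasurable_intervalIntegral p.d (f := fun y α =>
    (deriv (Psi p.d s) α + slope x α / distSq x y α * Psi p.d s α) * Psi p.d k α)
    ((m2.add ((m3.div (measurable_distSq x)).mul (m1 s))).mul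
      (m1 k))).aestronglyMeasurable.congr ?_
  filter_upwards [ae_restrict_mem measurableSet_Ioo] with y hy
  exact (D_eq (ha.trans_lt hy.1) k s).symm

theorem aestronglyMeasurable_Amat (ha : 0 ≤ p.a) (i : Fin n) (k s : Fin N) :
    AEStronglyMeasurable (fun y => p.Amat i x y k s) p.mu := by
  have m1 : ∀ k : Fin N, Measurable fun z : ℝ × ℝ => Psi p.d k z.2 := fun k =>
    (continuous_Psi hd k).measurable.comp measurable_snd
  have m2 : Measurable fun z : ℝ × ℝ => deriv (Psi p.d s) z.2 :=
    (continuous_deriv_Psi hd s).measurable.comp measurable_snd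
  have m3 : Measurable fun z : ℝ × ℝ => slope x z.2 := (measurable_slope x).comp measurable_snd
  have m4 : Measurable fun z : ℝ × ℝ => shift x z.2 i :=
    (measurable_shift x i).comp measurable_snd
  refine (stronglyMeasurable_intervalIntegral p.d (f := fun y α =>
    (shift x α i / y * deriv (Psi p.d s) α
      + (-(if i.val = 0 then 1 else 0) + shift x α i * slope x α / distSq x y α) / y
        * Psi p.d s α) * Psi p.d k α)
    ((((m4.div measurable_fst).mul m2).add ((((m4.mul m3).div
      (measurable_distSq x)).const_add _ |>.div measurable_fst).mul (m1 s))).mul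
      (m1 k))).aestronglyMeasurable.congr ?_
  filter_upwards [ae_restrict_mem measurableSet_Ioo] with y hy
  exact (Amat_eq (ha.trans_lt hy.1) i k s).symm

/-- For `y` large enough, the coercivity of `(∫ Ψ_s' Ψ_k)` carries over to `D_N`. -/
theorem D_coercive {B H m₀ : ℝ} (hB0 : 0 ≤ B) (hH : 0 ≤ H)
    (hB : ∀ s : Fin N, ∀ α ∈ Set.Icc (-p.d) p.d, |Psi p.d s α| ≤ B)
    (hs : ∀ α ∈ Set.Icc (-p.d) p.d, ∀ i, |shift x α i| ≤ H) (hm₀ : 0 < m₀)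
    (hM : ∀ v : Fin N → ℝ, m₀ * ∑ s, v s ^ 2
      ≤ ∑ k : Fin N, (∑ s : Fin N, (∫ t in (-p.d)..p.d,
        deriv (Psi p.d s) t * Psi p.d k t) * v s) ^ 2)
    (hy : 1 ≤ y) (hy' : 4 * (N * N * (2 * p.d * (H * B ^ 2)) ^ 2) / m₀ ≤ y) (v : Fin N → ℝ) :
    m₀ / 4 * ∑ s, v s ^ 2 ≤ ∑ k : Fin N, (∑ s, p.D x y k s * v s) ^ 2 := by
  have hy0 : 0 < y := by linarith
  set E := 2 * p.d * (H * B ^ 2)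
  set S := ∑ s, v s ^ 2
  have hS : 0 ≤ S := Finset.sum_nonneg fun _ _ => sq_nonneg _
  set M : Fin N → Fin N → ℝ := fun k s => ∫ t in (-p.d)..p.d, deriv (Psi p.d s) t * Psi p.d k t
  have h1 : ∑ k, (∑ s, (M k s - p.D x y k s) * v s) ^ 2 ≤ N * (N * (E / y ^ 2) ^ 2 * S) := by
    calc _ ≤ ∑ _k : Fin N, N * (E / y ^ 2) ^ 2 * S := Finset.sum_le_sum fun k _ => by
          have := sq_sum_mul_le v fun s => abs_D_sub_le hd hB0 hH hB hs hy0 k s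
          rwa [Fintype.card_fin] at this
      _ = _ := by simp
  have h2 : ∑ k, (∑ s, M k s * v s) ^ 2
      ≤ 2 * ∑ k, (∑ s, p.D x y k s * v s) ^ 2
        + 2 * ∑ k, (∑ s, (M k s - p.D x y k s) * v s) ^ 2 := by
    rw [Finset.mul_sum, Finset.mul_sum, ← Finset.sum_add_distrib]
    refine Finset.sum_le_sum fun k _ => ?_
    have e : ∑ s, M k s * v s
        = (∑ s, p.D x y k s * v s) + ∑ s, (M k s - p.D x y k s) * v s := by
      rw [← Finset.sum_add_distrib]
      exact Finset.sum_congr rfl fun s _ => by ring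
    rw [e]
    nlinarith [sq_nonneg ((∑ s, p.D x y k s * v s) - ∑ s, (M k s - p.D x y k s) * v s)]
  have h3 : 4 * (N * (N * (E / y ^ 2) ^ 2)) ≤ m₀ := by
    rw [div_le_iff₀ hm₀] at hy'
    have e : 4 * ((N : ℝ) * (N * (E / y ^ 2) ^ 2)) = 4 * (N * N * E ^ 2) / y ^ 4 := by ring
    rw [e, div_le_iff₀ (by positivity)]
    have hy4 : y ≤ y ^ 4 := le_self_pow₀ hy (by norm_num)
    calc _ ≤ y * m₀ := hy'
      _ ≤ y ^ 4 * m₀ := by gcongr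
      _ = _ := mul_comm _ _
  have h4 := hM v
  have h5 := mul_le_mul_of_nonneg_right h3 hS
  have h6 : m₀ * S ≤ ∑ k, (∑ s, M k s * v s) ^ 2 := h4
  linarith

end Matrices

end Model

/-! ### Integrals of exponential type -/

section ExpTerm

theorem abs_exp_sub_one_le (u : ℝ) : |Real.exp u - 1| ≤ |u| * Real.exp |u| := by
  have h1 := Real.add_one_le_exp u
  have h2 := Real.add_one_le_exp (-u)
  have h3 : Real.exp u * Real.exp (-u) = 1 := by rw [← Real.exp_add]; simp
  have h4 := Real.exp_pos u
  rcases le_total 0 u with h | h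
  · rw [abs_of_nonneg h, abs_of_nonneg (by linarith)]
    nlinarith
  · rw [abs_of_nonpos h, abs_of_nonpos (by nlinarith [Real.exp_pos (-u)])]
    nlinarith [Real.one_le_exp (neg_nonneg.2 h)]

theorem abs_exp_sub_one_sub_le (u : ℝ) : |Real.exp u - 1 - u| ≤ u ^ 2 * Real.exp |u| := by
  have h1 := Real.add_one_le_exp u
  have h2 := Real.add_one_le_exp (-u)
  have h3 : Real.exp u * Real.exp (-u) = 1 := by rw [← Real.exp_add]; simp
  have h4 := Real.exp_pos u
  have h5 := abs_exp_sub_one_le u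
  have h6 : Real.exp u - 1 - u ≤ u * (Real.exp u - 1) := by nlinarith
  rw [abs_of_nonneg (by linarith)]
  calc _ ≤ |u * (Real.exp u - 1)| := h6.trans (le_abs_self _)
    _ ≤ |u| * (|u| * Real.exp |u|) := by rw [abs_mul]; gcongr
    _ = _ := by rw [← sq_abs u]; ring

variable {N : ℕ} {Z : Type*}

/-- The integrand `e^{⟨w,p⟩} (⟨w,q⟩ c₁ + c₂)`. -/
def expTerm (P Q : Fin N → Z → ℝ) (c₁ c₂ : Z → ℝ) (w : Fin N → ℝ) (z : Z) : ℝ :=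
  Real.exp (∑ s, P s z * w s) * ((∑ s, Q s z * w s) * c₁ z + c₂ z)

/-- The derivative of `expTerm` with respect to `w s`. -/
def expTermDeriv (P Q : Fin N → Z → ℝ) (c₁ c₂ : Z → ℝ) (w : Fin N → ℝ) (s : Fin N) (z : Z) : ℝ :=
  Real.exp (∑ s, P s z * w s) * (P s z * ((∑ s, Q s z * w s) * c₁ z + c₂ z) + Q s z * c₁ z)

/-- A common bound for `expTerm`, its derivative and its Taylor remainder: `B` bounds `P` and `Q`,
`C` bounds `c₁` and `c₂`, and `M` bounds `w`. -/
def expConst (N : ℕ) (B C M : ℝ) : ℝ :=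
  Real.exp (3 * (N * B * |M|)) * (C * (N * B * |M| + 2)) * (1 + B + N * B ^ 2)

theorem expConst_nonneg {N : ℕ} {B C : ℝ} (hB : 0 ≤ B) (hC : 0 ≤ C) (M : ℝ) :
    0 ≤ expConst N B C M := by
  unfold expConst; positivity

theorem abs_sum_mul_le {a w : Fin N → ℝ} {B M : ℝ} (hB : 0 ≤ B) (ha : ∀ s, |a s| ≤ B)
    (hw : ∑ s, w s ^ 2 ≤ M ^ 2) : |∑ s, a s * w s| ≤ N * B * |M| := by
  have h : ∀ s, |w s| ≤ |M| := fun s => sq_le_sq.1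
    ((Finset.single_le_sum (f := fun s => w s ^ 2) (fun _ _ => sq_nonneg _)
      (Finset.mem_univ s)).trans hw)
  calc |∑ s, a s * w s| ≤ ∑ s, |a s * w s| := Finset.abs_sum_le_sum_abs _ _
    _ ≤ ∑ _s : Fin N, B * |M| := Finset.sum_le_sum fun s _ => by
        rw [abs_mul]; exact mul_le_mul (ha s) (h s) (abs_nonneg _) hB
    _ = _ := by simp; ring

variable {P Q : Fin N → Z → ℝ} {c₁ c₂ : Z → ℝ} {B C M : ℝ} {z : Z}

/-- Pointwise bounds of the data of `expTerm`. -/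
structure ExpBounds (P Q : Fin N → Z → ℝ) (c₁ c₂ : Z → ℝ) (B C : ℝ) (z : Z) : Prop where
  P_le : ∀ s, |P s z| ≤ B
  Q_le : ∀ s, |Q s z| ≤ B
  c₁_le : |c₁ z| ≤ C
  c₂_le : |c₂ z| ≤ C

theorem ExpBounds.abs_inner_le (h : ExpBounds P Q c₁ c₂ B C z) (hB : 0 ≤ B)
    {w : Fin N → ℝ} (hw : ∑ s, w s ^ 2 ≤ M ^ 2) :
    |(∑ s, Q s z * w s) * c₁ z + c₂ z| ≤ C * (N * B * |M| + 1) := by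
  have h1 := abs_sum_mul_le hB h.Q_le hw
  calc _ ≤ |∑ s, Q s z * w s| * |c₁ z| + |c₂ z| := by
        rw [← abs_mul]; exact abs_add_le _ _
    _ ≤ N * B * |M| * C + C := by
        gcongr
        · exact h.c₁_le
        · exact h.c₂_le
    _ = _ := by ring

theorem ExpBounds.exp_le (h : ExpBounds P Q c₁ c₂ B C z) (hB : 0 ≤ B)
    {w : Fin N → ℝ} (hw : ∑ s, w s ^ 2 ≤ M ^ 2) :
    Real.exp (∑ s, P s z * w s) ≤ Real.exp (N * B * |M|) :=
  Real.exp_le_exp.2 ((le_abs_self _).trans (abs_sum_mul_le hB h.P_le hw))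

theorem exp_le_exp_three {t : ℝ} (ht : 0 ≤ t) : Real.exp t ≤ Real.exp (3 * t) :=
  Real.exp_le_exp.2 (by linarith)

theorem ExpBounds.abs_expTerm_le (h : ExpBounds P Q c₁ c₂ B C z) (hB : 0 ≤ B) (hC : 0 ≤ C)
    {w : Fin N → ℝ} (hw : ∑ s, w s ^ 2 ≤ M ^ 2) :
    |expTerm P Q c₁ c₂ w z| ≤ expConst N B C M := by
  have hT : 0 ≤ N * B * |M| := by positivity
  rw [expTerm, abs_mul, Real.abs_exp]
  calc _ ≤ Real.exp (3 * (N * B * |M|)) * (C * (N * B * |M| + 1)) :=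
        mul_le_mul ((h.exp_le hB hw).trans (exp_le_exp_three hT)) (h.abs_inner_le hB hw)
          (abs_nonneg _) (Real.exp_pos _).le
    _ ≤ Real.exp (3 * (N * B * |M|)) * (C * (N * B * |M| + 2)) * 1 := by
        rw [mul_one]; gcongr; norm_num
    _ ≤ expConst N B C M := by
        unfold expConst
        gcongr
        nlinarith [mul_nonneg (Nat.cast_nonneg (α := ℝ) N) (sq_nonneg B)]

theorem ExpBounds.abs_expTermDeriv_le (h : ExpBounds P Q c₁ c₂ B C z) (hB : 0 ≤ B) (hC : 0 ≤ C)
    {w : Fin N → ℝ} (hw : ∑ s, w s ^ 2 ≤ M ^ 2) (s : Fin N) :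
    |expTermDeriv P Q c₁ c₂ w s z| ≤ expConst N B C M := by
  have hT : 0 ≤ N * B * |M| := by positivity
  rw [expTermDeriv, abs_mul, Real.abs_exp]
  have h1 : |P s z * ((∑ s, Q s z * w s) * c₁ z + c₂ z) + Q s z * c₁ z|
      ≤ B * (C * (N * B * |M| + 1)) + B * C := by
    refine (abs_add_le _ _).trans ?_
    rw [abs_mul, abs_mul]
    exact add_le_add (mul_le_mul (h.P_le s) (h.abs_inner_le hB hw) (abs_nonneg _) hB)
      (mul_le_mul (h.Q_le s) h.c₁_le (abs_nonneg _) hB)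
  calc _ ≤ Real.exp (3 * (N * B * |M|)) * (B * (C * (N * B * |M| + 1)) + B * C) :=
        mul_le_mul ((h.exp_le hB hw).trans (exp_le_exp_three hT)) h1
          (abs_nonneg _) (Real.exp_pos _).le
    _ = Real.exp (3 * (N * B * |M|)) * (C * (N * B * |M| + 2)) * B := by ring
    _ ≤ expConst N B C M := by
        unfold expConst
        gcongr
        nlinarith [mul_nonneg (Nat.cast_nonneg (α := ℝ) N) (sq_nonneg B)]

/-- The second order Taylor estimate of `expTerm`. -/
theorem ExpBounds.expTerm_taylor (h : ExpBounds P Q c₁ c₂ B C z) (hB : 0 ≤ B) (hC : 0 ≤ C)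
    {w v : Fin N → ℝ} (hw : ∑ s, w s ^ 2 ≤ M ^ 2) (hwv : ∑ s, (w + v) s ^ 2 ≤ M ^ 2) :
    |expTerm P Q c₁ c₂ (w + v) z - expTerm P Q c₁ c₂ w z
      - ∑ s, expTermDeriv P Q c₁ c₂ w s z * v s| ≤ expConst N B C M * ∑ s, v s ^ 2 := by
  set T := N * B * |M|
  have hT : 0 ≤ T := by positivity
  set S := ∑ s, v s ^ 2
  have hS : 0 ≤ S := Finset.sum_nonneg fun _ _ => sq_nonneg _
  set a := ∑ s, P s z * w s
  set b := ∑ s, Q s z * w s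
  set u := ∑ s, P s z * v s
  set r := ∑ s, Q s z * v s
  have ea : ∑ s, P s z * (w + v) s = a + u := by
    simp only [Pi.add_apply, mul_add, Finset.sum_add_distrib, a, u]
  have eb : ∑ s, Q s z * (w + v) s = b + r := by
    simp only [Pi.add_apply, mul_add, Finset.sum_add_distrib, b, r]
  have ed : ∑ s, expTermDeriv P Q c₁ c₂ w s z * v s
      = Real.exp a * (u * (b * c₁ z + c₂ z) + r * c₁ z) := by
    simp only [u, r, Finset.sum_mul, ← Finset.sum_add_distrib, Finset.mul_sum]
    refine Finset.sum_congr rfl fun s _ => ?_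
    simp only [expTermDeriv, a, b]
    ring
  have e : expTerm P Q c₁ c₂ (w + v) z - expTerm P Q c₁ c₂ w z
      - ∑ s, expTermDeriv P Q c₁ c₂ w s z * v s
      = Real.exp a * ((Real.exp u - 1 - u) * (b * c₁ z + c₂ z)
        + (Real.exp u - 1) * (r * c₁ z)) := by
    rw [ed, expTerm, expTerm, ea, eb, Real.exp_add]
    ring
  have hu : |u| ≤ 2 * T := by
    have h1 := abs_sum_mul_le hB h.P_le hw
    have h2 := abs_sum_mul_le hB h.P_le hwv
    rw [ea] at h2
    have e1 : u = (a + u) - a := by ring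
    rw [e1]
    exact (abs_sub _ _).trans (by linarith)
  have hu2 : u ^ 2 ≤ N * B ^ 2 * S := by
    have := sq_sum_mul_le v h.P_le
    rwa [Fintype.card_fin] at this
  have hr2 : r ^ 2 ≤ N * B ^ 2 * S := by
    have := sq_sum_mul_le v h.Q_le
    rwa [Fintype.card_fin] at this
  have hur : |u| * |r| ≤ N * B ^ 2 * S := by
    nlinarith [sq_nonneg (|u| - |r|), sq_abs u, sq_abs r]
  have hexp : Real.exp |u| ≤ Real.exp (2 * T) := Real.exp_le_exp.2 hu
  have g1 : |(Real.exp u - 1 - u) * (b * c₁ z + c₂ z)|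
      ≤ N * B ^ 2 * S * Real.exp (2 * T) * (C * (T + 1)) := by
    rw [abs_mul]
    refine mul_le_mul ((abs_exp_sub_one_sub_le u).trans ?_) (h.abs_inner_le hB hw)
      (abs_nonneg _) (by positivity)
    gcongr
  have g2 : |(Real.exp u - 1) * (r * c₁ z)| ≤ N * B ^ 2 * S * Real.exp (2 * T) * C := by
    rw [abs_mul, abs_mul]
    calc _ ≤ |u| * Real.exp (2 * T) * (|r| * C) := by
          gcongr
          · exact (abs_exp_sub_one_le u).trans (by gcongr)
          · exact h.c₁_le
      _ = |u| * |r| * Real.exp (2 * T) * C := by ring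
      _ ≤ _ := by gcongr
  rw [e, abs_mul, Real.abs_exp]
  calc _ ≤ Real.exp T * (N * B ^ 2 * S * Real.exp (2 * T) * (C * (T + 1))
        + N * B ^ 2 * S * Real.exp (2 * T) * C) :=
        mul_le_mul (h.exp_le hB hw) ((abs_add_le _ _).trans (add_le_add g1 g2)) (abs_nonneg _)
          (Real.exp_pos _).le
    _ = Real.exp (3 * T) * (C * (T + 2)) * (N * B ^ 2) * S := by
        have : Real.exp (3 * T) = Real.exp T * Real.exp (2 * T) := by
          rw [← Real.exp_add]; ring_nf
        rw [this]; ring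
    _ ≤ expConst N B C M * S := by
        unfold expConst
        gcongr
        linarith

variable [MeasurableSpace Z] {ν : Measure Z}

/-- The integral of `expTerm`, as a function of `w`. -/
def expInt (ν : Measure Z) (P Q : Fin N → Z → ℝ) (c₁ c₂ : Z → ℝ) (w : Fin N → ℝ) : ℝ :=
  ∫ z, expTerm P Q c₁ c₂ w z ∂ν

/-- The derivative of `expInt` with respect to `w s`. -/
def expIntDeriv (ν : Measure Z) (P Q : Fin N → Z → ℝ) (c₁ c₂ : Z → ℝ) (w : Fin N → ℝ)
    (s : Fin N) : ℝ :=
  ∫ z, expTermDeriv P Q c₁ c₂ w s z ∂ν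

theorem measurable_expTerm (hP : ∀ s, Measurable (P s)) (hQ : ∀ s, Measurable (Q s))
    (hc₁ : Measurable c₁) (hc₂ : Measurable c₂) (w : Fin N → ℝ) :
    Measurable (expTerm P Q c₁ c₂ w) := by
  unfold expTerm
  exact ((Finset.measurable_sum _ fun s _ => (hP s).mul_const _).exp).mul
    (((Finset.measurable_sum _ fun s _ => (hQ s).mul_const _).mul hc₁).add hc₂)

theorem measurable_expTermDeriv (hP : ∀ s, Measurable (P s)) (hQ : ∀ s, Measurable (Q s))
    (hc₁ : Measurable c₁) (hc₂ : Measurable c₂) (w : Fin N → ℝ) (s : Fin N) :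
    Measurable (expTermDeriv P Q c₁ c₂ w s) := by
  unfold expTermDeriv
  exact ((Finset.measurable_sum _ fun s _ => (hP s).mul_const _).exp).mul
    (((hP s).mul (((Finset.measurable_sum _ fun s _ => (hQ s).mul_const _).mul hc₁).add hc₂)).add
      ((hQ s).mul hc₁))

variable [IsFiniteMeasure ν]

theorem integrable_expTerm (hP : ∀ s, Measurable (P s)) (hQ : ∀ s, Measurable (Q s))
    (hc₁ : Measurable c₁) (hc₂ : Measurable c₂) (h : ∀ᵐ z ∂ν, ExpBounds P Q c₁ c₂ B C z)
    (hB : 0 ≤ B) (hC : 0 ≤ C) (w : Fin N → ℝ) :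
    Integrable (expTerm P Q c₁ c₂ w) ν := by
  have hw : ∑ s, w s ^ 2 ≤ Real.sqrt (∑ s, w s ^ 2) ^ 2 :=
    (Real.sq_sqrt (Finset.sum_nonneg fun _ _ => sq_nonneg _)).ge
  refine Integrable.of_bound (measurable_expTerm hP hQ hc₁ hc₂ w).aestronglyMeasurable
    (expConst N B C (Real.sqrt (∑ s, w s ^ 2))) ?_
  filter_upwards [h] with z hz
  exact hz.abs_expTerm_le hB hC hw

theorem integrable_expTermDeriv (hP : ∀ s, Measurable (P s)) (hQ : ∀ s, Measurable (Q s))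
    (hc₁ : Measurable c₁) (hc₂ : Measurable c₂) (h : ∀ᵐ z ∂ν, ExpBounds P Q c₁ c₂ B C z)
    (hB : 0 ≤ B) (hC : 0 ≤ C) (w : Fin N → ℝ) (s : Fin N) :
    Integrable (expTermDeriv P Q c₁ c₂ w s) ν := by
  have hw : ∑ s, w s ^ 2 ≤ Real.sqrt (∑ s, w s ^ 2) ^ 2 :=
    (Real.sq_sqrt (Finset.sum_nonneg fun _ _ => sq_nonneg _)).ge
  refine Integrable.of_bound (measurable_expTermDeriv hP hQ hc₁ hc₂ w s).aestronglyMeasurable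
    (expConst N B C (Real.sqrt (∑ s, w s ^ 2))) ?_
  filter_upwards [h] with z hz
  exact hz.abs_expTermDeriv_le hB hC hw s

theorem abs_expInt_le (h : ∀ᵐ z ∂ν, ExpBounds P Q c₁ c₂ B C z) (hB : 0 ≤ B) (hC : 0 ≤ C)
    {w : Fin N → ℝ} (hw : ∑ s, w s ^ 2 ≤ M ^ 2) :
    |expInt ν P Q c₁ c₂ w| ≤ expConst N B C M * ν.real Set.univ :=
  norm_integral_le_of_norm_le_const (f := expTerm P Q c₁ c₂ w)
    (h.mono fun _ hz => hz.abs_expTerm_le hB hC hw)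

theorem abs_expIntDeriv_le (h : ∀ᵐ z ∂ν, ExpBounds P Q c₁ c₂ B C z) (hB : 0 ≤ B) (hC : 0 ≤ C)
    {w : Fin N → ℝ} (hw : ∑ s, w s ^ 2 ≤ M ^ 2) (s : Fin N) :
    |expIntDeriv ν P Q c₁ c₂ w s| ≤ expConst N B C M * ν.real Set.univ :=
  norm_integral_le_of_norm_le_const (f := expTermDeriv P Q c₁ c₂ w s)
    (h.mono fun _ hz => hz.abs_expTermDeriv_le hB hC hw s)

theorem expInt_taylor (hP : ∀ s, Measurable (P s)) (hQ : ∀ s, Measurable (Q s))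
    (hc₁ : Measurable c₁) (hc₂ : Measurable c₂) (h : ∀ᵐ z ∂ν, ExpBounds P Q c₁ c₂ B C z)
    (hB : 0 ≤ B) (hC : 0 ≤ C) {w v : Fin N → ℝ} (hw : ∑ s, w s ^ 2 ≤ M ^ 2)
    (hwv : ∑ s, (w + v) s ^ 2 ≤ M ^ 2) :
    |expInt ν P Q c₁ c₂ (w + v) - expInt ν P Q c₁ c₂ w
      - ∑ s, expIntDeriv ν P Q c₁ c₂ w s * v s|
      ≤ expConst N B C M * ν.real Set.univ * ∑ s, v s ^ 2 := by
  have i1 := integrable_expTerm hP hQ hc₁ hc₂ h hB hC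
  have i2 := integrable_expTermDeriv hP hQ hc₁ hc₂ h hB hC w
  have e : expInt ν P Q c₁ c₂ (w + v) - expInt ν P Q c₁ c₂ w
      - ∑ s, expIntDeriv ν P Q c₁ c₂ w s * v s
      = ∫ z, (expTerm P Q c₁ c₂ (w + v) z - expTerm P Q c₁ c₂ w z
        - ∑ s, expTermDeriv P Q c₁ c₂ w s z * v s) ∂ν := by
    have i3 : Integrable (fun z => expTerm P Q c₁ c₂ (w + v) z - expTerm P Q c₁ c₂ w z) ν :=
      (i1 _).sub (i1 _)
    rw [integral_sub i3 (integrable_finsetSum _ fun s _ => (i2 s).mul_const _),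
      integral_sub (i1 _) (i1 _), integral_finsetSum _ fun s _ => (i2 s).mul_const _]
    simp only [integral_mul_const]
    rfl
  rw [e]
  have := norm_integral_le_of_norm_le_const (μ := ν)
    (f := fun z => expTerm P Q c₁ c₂ (w + v) z - expTerm P Q c₁ c₂ w z
        - ∑ s, expTermDeriv P Q c₁ c₂ w s z * v s)
    (h.mono fun _ hz => hz.expTerm_taylor hB hC hw hwv)
  rw [Real.norm_eq_abs] at this
  linarith

/-- A Lipschitz estimate for `expInt`, squared. -/
theorem sq_expInt_sub_le (hP : ∀ s, Measurable (P s)) (hQ : ∀ s, Measurable (Q s))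
    (hc₁ : Measurable c₁) (hc₂ : Measurable c₂) (h : ∀ᵐ z ∂ν, ExpBounds P Q c₁ c₂ B C z)
    (hB : 0 ≤ B) (hC : 0 ≤ C) {w w' : Fin N → ℝ} (hw : ∑ s, w s ^ 2 ≤ M ^ 2)
    (hw' : ∑ s, w' s ^ 2 ≤ M ^ 2) :
    (expInt ν P Q c₁ c₂ w' - expInt ν P Q c₁ c₂ w) ^ 2
      ≤ (8 * M ^ 2 + 2 * N) * (expConst N B C M * ν.real Set.univ) ^ 2
        * ∑ s, (w' - w) s ^ 2 := by
  set E := expConst N B C M * ν.real Set.univ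
  have hE : 0 ≤ E := mul_nonneg (expConst_nonneg hB hC M) measureReal_nonneg
  set S := ∑ s, (w' - w) s ^ 2
  have hS : 0 ≤ S := Finset.sum_nonneg fun _ _ => sq_nonneg _
  have e : w + (w' - w) = w' := by abel
  have h1 := expInt_taylor hP hQ hc₁ hc₂ h hB hC (v := w' - w) hw (by rwa [e])
  rw [e] at h1
  have h2 := sq_sum_mul_le (w' - w) (fun s => abs_expIntDeriv_le h hB hC hw s)
  rw [Fintype.card_fin] at h2
  have h3 : S ≤ 4 * M ^ 2 := by
    calc S ≤ ∑ s, (2 * w' s ^ 2 + 2 * w s ^ 2) := Finset.sum_le_sum fun s _ => by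
          simp only [Pi.sub_apply]
          nlinarith [sq_nonneg (w' s + w s)]
      _ = 2 * (∑ s, w' s ^ 2) + 2 * ∑ s, w s ^ 2 := by
          rw [Finset.sum_add_distrib, Finset.mul_sum, Finset.mul_sum]
      _ ≤ _ := by linarith
  set L := ∑ s, expIntDeriv ν P Q c₁ c₂ w s * (w' - w) s
  set X := expInt ν P Q c₁ c₂ w' - expInt ν P Q c₁ c₂ w
  have h4 : (X - L) ^ 2 ≤ (E * S) ^ 2 := sq_le_sq' (by linarith [(abs_le.1 h1).1])
    (abs_le.1 h1).2
  have h5 : X ^ 2 ≤ 2 * (X - L) ^ 2 + 2 * L ^ 2 := by nlinarith [sq_nonneg (X - 2 * L)]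
  have h6 : (E * S) ^ 2 ≤ 4 * M ^ 2 * E ^ 2 * S := by
    have : E ^ 2 * S * S ≤ E ^ 2 * S * (4 * M ^ 2) := by gcongr
    nlinarith
  nlinarith

end ExpTerm

/-- Measurability of a parametric integral along a curve `w` that is continuous on `[a,b]` only.
Outside of this interval `w` is replaced by zero. -/
theorem aestronglyMeasurable_param {N : ℕ} {Z : Type*} [MeasurableSpace Z] {ν : Measure Z}
    [SFinite ν] {a b : ℝ} {f : (Fin N → ℝ) → ℝ → Z → ℝ}
    (hf : Measurable fun t : (Fin N → ℝ) × ℝ × Z => f t.1 t.2.1 t.2.2)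
    {w : Fin N → ℝ → ℝ} (hw : ∀ s, ContinuousOn (w s) (Set.Icc a b)) :
    AEStronglyMeasurable (fun y => ∫ z, f (fun s => w s y) y z ∂ν)
      (volume.restrict (Set.Ioo a b)) := by
  have hm : ∀ s, Measurable ((Set.Icc a b).indicator (w s)) := fun s => by
    rw [← Set.piecewise_eq_indicator]
    exact (hw s).measurable_piecewise continuousOn_const measurableSet_Icc
  have hm' : Measurable fun y => fun s => (Set.Icc a b).indicator (w s) y :=
    measurable_pi_lambda _ hm
  have h1 : Measurable fun t : ℝ × Z => f (fun s => (Set.Icc a b).indicator (w s) t.1) t.1 t.2 :=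
    hf.comp ((hm'.comp measurable_fst).prodMk (measurable_fst.prodMk measurable_snd))
  refine (h1.stronglyMeasurable.integral_prod_right' (ν := ν)).aestronglyMeasurable.congr ?_
  filter_upwards [ae_restrict_mem measurableSet_Ioo] with y hy
  have : (fun s => (Set.Icc a b).indicator (w s) y) = fun s => w s y :=
    funext fun s => Set.indicator_of_mem (Set.Ioo_subset_Icc_self hy) _
  simp only [this]

/-! ### The nonlinear term -/

namespace Model

variable {n : ℕ} {p : Model n} {N : ℕ}

theorem box_eq (p : Model n) : p.Box = (Set.univ.pi fun _ : Fin n => Set.Icc (-p.A) p.A) ×ˢ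
    (Set.Icc p.a p.b ×ˢ (Set.Icc (-p.d) p.d ×ˢ Set.Icc (-p.d) p.d)) := by
  ext z
  simp only [Box, Set.mem_ofPred_eq, Set.mem_prod, Set.mem_univ_pi, Set.mem_Icc]

theorem isClosed_Box (p : Model n) : IsClosed p.Box := by
  rw [box_eq]
  exact (isClosed_set_pi fun _ _ => isClosed_Icc).prod
    (isClosed_Icc.prod (isClosed_Icc.prod isClosed_Icc))

theorem uniqueDiffOn_Box (hA : 0 < p.A) (hd : 0 < p.d) (hab : p.a < p.b) :
    UniqueDiffOn ℝ p.Box := by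
  rw [box_eq]
  have h := uniqueDiffOn_Icc (neg_lt_self hd)
  exact (UniqueDiffOn.univ_pi fun _ => uniqueDiffOn_Icc (neg_lt_self hA)).prod
    ((uniqueDiffOn_Icc hab).prod (h.prod h))

open Classical in
theorem measurable_indicator_Box {f : (Fin n → ℝ) × ℝ × ℝ × ℝ → ℝ} (hf : ContinuousOn f p.Box) :
    Measurable (p.Box.indicator f) := by
  rw [← Set.piecewise_eq_indicator]
  exact hf.measurable_piecewise continuousOn_const p.isClosed_Box.measurableSet

/-- The phase function, extended by zero. -/
def Kext (p : Model n) (z : (Fin n → ℝ) × ℝ × ℝ × ℝ) : ℝ := p.Box.indicator p.K z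

/-- The derivative of the phase function with respect to `α`, extended by zero. -/
def KextDeriv (p : Model n) (z : (Fin n → ℝ) × ℝ × ℝ × ℝ) : ℝ :=
  p.Box.indicator (fun z => fderivWithin ℝ p.K p.Box z (0, 0, 1, 0)) z

/-- The open square of the source parameters `(α, β)`, with the Lebesgue measure. -/
def squareMeasure (p : Model n) : Measure (ℝ × ℝ) :=
  (volume.restrict (Set.Ioo (-p.d) p.d)).prod (volume.restrict (Set.Ioo (-p.d) p.d))

instance (p : Model n) : IsFiniteMeasure p.squareMeasure := by
  unfold squareMeasure; infer_instance

theorem squareMeasure_univ (hd : 0 < p.d) : p.squareMeasure.real Set.univ = (2 * p.d) ^ 2 := by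
  have h : (volume (Set.Ioo (-p.d) p.d)) = ENNReal.ofReal (2 * p.d) := by
    rw [Real.volume_Ioo]; congr 1; ring
  rw [squareMeasure, measureReal_def, ← Set.univ_prod_univ, Measure.prod_prod]
  simp only [Measure.restrict_apply_univ, h, ENNReal.toReal_mul]
  rw [ENNReal.toReal_ofReal (by linarith)]
  ring

theorem ae_squareMeasure (p : Model n) : ∀ᵐ z ∂p.squareMeasure,
    z.1 ∈ Set.Ioo (-p.d) p.d ∧ z.2 ∈ Set.Ioo (-p.d) p.d := by
  rw [squareMeasure, Measure.prod_restrict]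
  exact ae_restrict_mem (measurableSet_Ioo.prod measurableSet_Ioo)

/-- The exponent `Ψ_s(β) - Ψ_s(α)` in the integrals over the square. -/
def expP (p : Model n) (s : Fin N) (z : ℝ × ℝ) : ℝ := Psi p.d s z.2 - Psi p.d s z.1

/-- The factor `Ψ_s'(α)` in the integrals over the square. -/
def expQ (p : Model n) (s : Fin N) (z : ℝ × ℝ) : ℝ := deriv (Psi p.d s) z.1

/-- The factor of `w'(α) e^{w(β) - w(α)}` in the integral representation of `F_k`. -/
def coefF₁ (p : Model n) (k : Fin N) (x : Fin n → ℝ) (y : ℝ) (z : ℝ × ℝ) : ℝ :=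
  p.μs (x, y) * (dist0 x y z.1 / y) * p.Kext (x, y, z.1, z.2) * Psi p.d k z.1

/-- The factor of `e^{w(β) - w(α)}` in the integral representation of `F_k`. -/
def coefF₂ (p : Model n) (k : Fin N) (x : Fin n → ℝ) (y : ℝ) (z : ℝ × ℝ) : ℝ :=
  -(p.μs (x, y) * (dist0 x y z.1 / y) * p.KextDeriv (x, y, z.1, z.2) * Psi p.d k z.1)

/-- The factor of `e^{w(β) - w(α)}` in the scattering part of the recovered coefficient. -/
def coefS (p : Model n) (x : Fin n → ℝ) (y : ℝ) (z : ℝ × ℝ) : ℝ :=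
  p.μs (x, y) * p.Kext (x, y, z.1, z.2)

section Smooth

variable {h0 κ σ : ℝ} (hK : p.Admissible h0 κ σ)

include hK

theorem Admissible.measurable_Kext : Measurable p.Kext :=
  measurable_indicator_Box hK.K_smooth.continuousOn

theorem Admissible.abs_Kext_le (z : (Fin n → ℝ) × ℝ × ℝ × ℝ) : |p.Kext z| ≤ |κ| := by
  by_cases hz : z ∈ p.Box
  · rw [Kext, Set.indicator_of_mem hz]
    exact (hK.K_le z hz).trans (le_abs_self κ)
  · rw [Kext, Set.indicator_of_notMem hz]
    simp

theorem Admissible.abs_KextDeriv_le (z : (Fin n → ℝ) × ℝ × ℝ × ℝ) : |p.KextDeriv z| ≤ |κ| := by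
  by_cases hz : z ∈ p.Box
  · rw [KextDeriv, Set.indicator_of_mem hz]
    refine (ContinuousLinearMap.le_opNorm (fderivWithin ℝ p.K p.Box z)
      ((0, 0, 1, 0) : (Fin n → ℝ) × ℝ × ℝ × ℝ)).trans ?_
    have h1 : ‖((0, 0, 1, 0) : (Fin n → ℝ) × ℝ × ℝ × ℝ)‖ = 1 := by
      simp [Prod.norm_def]
    rw [h1, mul_one]
    exact (hK.K_deriv_le z hz).trans (le_abs_self κ)
  · rw [KextDeriv, Set.indicator_of_notMem hz]
    simp

theorem Admissible.abs_μs_le (z : (Fin n → ℝ) × ℝ) : |p.μs z| ≤ |σ| := by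
  rw [abs_of_nonneg (hK.μs_nonneg z)]
  exact (hK.μs_le z).trans (le_abs_self σ)

section Derivative

variable (hA : 0 < p.A) (hd : 0 < p.d) (hab : p.a < p.b)

include hA hd hab

theorem Admissible.measurable_KextDeriv : Measurable p.KextDeriv :=
  measurable_indicator_Box <| (hK.K_smooth.continuousOn_fderivWithin (uniqueDiffOn_Box hA hd hab)
    (by norm_num)).clm_apply continuousOn_const

variable {x : Fin n → ℝ} {y : ℝ} (hx : ∀ i, -p.A ≤ x i ∧ x i ≤ p.A) (hy : y ∈ Set.Ioo p.a p.b)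

omit hK hA hd hab in
include hx hy in
theorem mem_Box_of_mem {α β : ℝ} (hα : α ∈ Set.Ioo (-p.d) p.d) (hβ : β ∈ Set.Ioo (-p.d) p.d) :
    ((x, y, α, β) : (Fin n → ℝ) × ℝ × ℝ × ℝ) ∈ p.Box :=
  ⟨hx, ⟨hy.1.le, hy.2.le⟩, ⟨hα.1.le, hα.2.le⟩, ⟨hβ.1.le, hβ.2.le⟩⟩

include hx hy

omit hA hd hab in
theorem Admissible.hasDerivAt_Kext {α β : ℝ} (hα : α ∈ Set.Ioo (-p.d) p.d)
    (hβ : β ∈ Set.Ioo (-p.d) p.d) :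
    HasDerivAt (fun t => p.Kext (x, y, t, β)) (p.KextDeriv (x, y, α, β)) α := by
  have hz := mem_Box_of_mem hx hy hα hβ
  have h1 := ((hK.K_smooth.differentiableOn (by norm_num)) _ hz).hasFDerivWithinAt
  have h2 : HasDerivAt (fun t : ℝ => ((x, y, t, β) : (Fin n → ℝ) × ℝ × ℝ × ℝ)) (0, 0, 1, 0) α :=
    (hasDerivAt_const α x).prodMk ((hasDerivAt_const α y).prodMk
      ((hasDerivAt_id α).prodMk (hasDerivAt_const α β)))
  have hev : ∀ᶠ t in nhds α, t ∈ Set.Ioo (-p.d) p.d := isOpen_Ioo.mem_nhds hα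
  have h3 := HasFDerivWithinAt.comp_hasDerivAt (x := α) h1 h2
    (hev.mono fun t ht => mem_Box_of_mem hx hy ht hβ)
  rw [KextDeriv, Set.indicator_of_mem hz]
  refine h3.congr_of_eventuallyEq (hev.mono fun t ht => ?_)
  exact Set.indicator_of_mem (mem_Box_of_mem hx hy ht hβ) _

/-- Differentiation of the scattering integral with respect to the position of the source. -/
theorem Admissible.hasDerivAt_scatter (w : Fin N → ℝ) {α : ℝ} (hα : α ∈ Set.Ioo (-p.d) p.d) :
    HasDerivAt (fun t => p.scatter w x y t)
      (∫ β in Set.Ioo (-p.d) p.d, Real.exp (p.series w β - p.series w α)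
        * (-(∑ s, w s * deriv (Psi p.d s) α) * p.Kext (x, y, α, β) + p.KextDeriv (x, y, α, β)))
      α := by
  have cw : Continuous (p.series w) := by
    have := continuous_Psi hd
    unfold series; fun_prop
  have dw : HasDerivAt (p.series w) (∑ s, w s * deriv (Psi p.d s) α) α := by
    unfold series
    exact HasDerivAt.fun_sum fun s _ => ((differentiable_Psi hd s) α).hasDerivAt.const_mul _
  set ν := volume.restrict (Set.Ioo (-p.d) p.d)
  have mK : ∀ t, Measurable fun β => p.Kext (x, y, t, β) := fun t =>
    hK.measurable_Kext.comp (by fun_prop)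
  have mK' : ∀ t, Measurable fun β => p.KextDeriv (x, y, t, β) := fun t =>
    (hK.measurable_KextDeriv hA hd hab).comp (by fun_prop)
  have me : Measurable fun β => Real.exp (p.series w β) := (Real.continuous_exp.comp cw).measurable
  have ie : Integrable (fun β => Real.exp (p.series w β)) ν :=
    ((Real.continuous_exp.comp cw).continuousOn.integrableOn_Icc
      (a := -p.d) (b := p.d)).mono_set Set.Ioo_subset_Icc_self
  have iK : ∀ t, Integrable (fun β => p.Kext (x, y, t, β) * Real.exp (p.series w β)) ν := fun t =>
    ie.bdd_mul (c := |κ|) (mK t).aestronglyMeasurable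
      (Filter.Eventually.of_forall fun β => hK.abs_Kext_le _)
  have iK' : ∀ t, Integrable (fun β => p.KextDeriv (x, y, t, β) * Real.exp (p.series w β)) ν :=
    fun t => ie.bdd_mul (c := |κ|) (mK' t).aestronglyMeasurable
      (Filter.Eventually.of_forall fun β => hK.abs_KextDeriv_le _)
  have h1 := (hasDerivAt_integral_of_dominated_loc_of_deriv_le (μ := ν)
    (F := fun t β => p.Kext (x, y, t, β) * Real.exp (p.series w β))
    (F' := fun t β => p.KextDeriv (x, y, t, β) * Real.exp (p.series w β))
    (bound := fun β => |κ| * Real.exp (p.series w β)) (isOpen_Ioo.mem_nhds hα)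
    (Filter.Eventually.of_forall fun t => ((mK t).mul me).aestronglyMeasurable) (iK α)
    ((mK' α).mul me).aestronglyMeasurable
    (Filter.Eventually.of_forall fun β t _ => by
      rw [norm_mul, Real.norm_eq_abs, Real.norm_eq_abs, Real.abs_exp]
      exact mul_le_mul_of_nonneg_right (hK.abs_KextDeriv_le _) (Real.exp_pos _).le)
    (ie.const_mul _)
    ((ae_restrict_mem measurableSet_Ioo).mono fun β hβ t ht =>
      (hK.hasDerivAt_Kext hx hy ht hβ).mul_const _)).2
  have h2 := dw.neg.exp.fun_mul h1
  have hev : ∀ᶠ t in nhds α, t ∈ Set.Ioo (-p.d) p.d := isOpen_Ioo.mem_nhds hα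
  refine (h2.congr_of_eventuallyEq (hev.mono fun t ht => ?_)).congr_deriv ?_
  · show p.scatter w x y t = Real.exp (-p.series w t) * _
    rw [scatter, interval_eq_integral_Ioo (by linarith)]
    congr 1
    refine setIntegral_congr_fun measurableSet_Ioo fun β hβ => ?_
    show _ = p.Kext _ * _
    rw [Kext, Set.indicator_of_mem (mem_Box_of_mem hx hy ht hβ)]
  · have e : ∀ β, Real.exp (p.series w β - p.series w α)
        * (-(∑ s, w s * deriv (Psi p.d s) α) * p.Kext (x, y, α, β) + p.KextDeriv (x, y, α, β))
        = Real.exp (-p.series w α) * -(∑ s, w s * deriv (Psi p.d s) α)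
            * (p.Kext (x, y, α, β) * Real.exp (p.series w β))
          + Real.exp (-p.series w α) * (p.KextDeriv (x, y, α, β) * Real.exp (p.series w β)) := by
      intro β
      rw [sub_eq_add_neg, Real.exp_add]
      ring
    simp_rw [e]
    rw [integral_add ((iK α).const_mul _) ((iK' α).const_mul _), integral_const_mul,
      integral_const_mul]
    rfl

end Derivative

end Smooth

/-- The factor `1/ν_{n+1}` is bounded by this constant. -/
def distBound (n : ℕ) (H b : ℝ) : ℝ := 1 + n * H ^ 2 + b ^ 2

theorem dist0_div_le {x : Fin n → ℝ} {y α b H : ℝ} (hy : 1 ≤ y) (hyb : y ≤ b)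
    (hs : ∀ i, |shift x α i| ≤ H) : |dist0 x y α / y| ≤ distBound n H b := by
  have hy0 : 0 < y := by linarith
  rw [abs_of_pos (div_pos (dist0_pos hy0) hy0)]
  refine (div_le_self (dist0_pos hy0).le hy).trans ?_
  have h1 : distSq x y α ≤ n * H ^ 2 + b ^ 2 := by
    unfold distSq
    gcongr
    calc _ ≤ ∑ _i : Fin n, H ^ 2 := Finset.sum_le_sum fun i _ => by
          rw [← sq_abs]; exact pow_le_pow_left₀ (abs_nonneg _) (hs i) 2
      _ = _ := by simp
  have h2 : dist0 x y α ≤ 1 + distSq x y α := by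
    rw [← dist0_sq hy0]
    nlinarith [sq_nonneg (dist0 x y α - 1)]
  unfold distBound
  linarith

section Representation

variable {h0 κ σ : ℝ} (hK : p.Admissible h0 κ σ)
variable (hA : 0 < p.A) (hd : 0 < p.d) (ha : 1 ≤ p.a) (hab : p.a < p.b)

/-- The bound for the factors in the integral representation of `F`. -/
def coefConst (n : ℕ) (A d b κ σ B : ℝ) : ℝ := |σ| * distBound n (A + d) b * |κ| * B

theorem coefConst_nonneg {n : ℕ} {A d b κ σ B : ℝ} (hB : 0 ≤ B) :
    0 ≤ coefConst n A d b κ σ B := by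
  unfold coefConst distBound; positivity

include hd in
theorem measurable_expP (s : Fin N) : Measurable (p.expP s) :=
  ((continuous_Psi hd s).measurable.comp measurable_snd).sub
    ((continuous_Psi hd s).measurable.comp measurable_fst)

include hd in
theorem measurable_expQ (s : Fin N) : Measurable (p.expQ s) :=
  (continuous_deriv_Psi hd s).measurable.comp measurable_fst

section Measurability

include hK hd

theorem Admissible.measurable_coefF₁ (k : Fin N) (x : Fin n → ℝ) :
    Measurable fun t : ℝ × ℝ × ℝ => p.coefF₁ k x t.1 t.2 := by
  have h1 : Measurable fun t : ℝ × ℝ × ℝ => p.μs (x, t.1) :=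
    hK.μs_smooth.continuous.measurable.comp (by fun_prop)
  have h2 : Measurable fun t : ℝ × ℝ × ℝ => dist0 x t.1 t.2.1 :=
    Measurable.comp (g := fun z : ℝ × ℝ => dist0 x z.1 z.2)
      (f := fun t : ℝ × ℝ × ℝ => (t.1, t.2.1)) (measurable_dist0 x) (by fun_prop)
  have h3 : Measurable fun t : ℝ × ℝ × ℝ => p.Kext (x, t.1, t.2.1, t.2.2) :=
    hK.measurable_Kext.comp (by fun_prop)
  have h4 : Measurable fun t : ℝ × ℝ × ℝ => Psi p.d k t.2.1 :=
    (continuous_Psi hd k).measurable.comp measurable_snd.fst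
  have h5 : Measurable fun t : ℝ × ℝ × ℝ => dist0 x t.1 t.2.1 / t.1 := h2.div measurable_fst
  have h6 := ((h1.mul h5).mul h3).mul h4
  exact h6

theorem Admissible.measurable_coefF₂ (hA : 0 < p.A) (hab : p.a < p.b) (k : Fin N)
    (x : Fin n → ℝ) : Measurable fun t : ℝ × ℝ × ℝ => p.coefF₂ k x t.1 t.2 := by
  have h1 : Measurable fun t : ℝ × ℝ × ℝ => p.μs (x, t.1) :=
    hK.μs_smooth.continuous.measurable.comp (by fun_prop)
  have h2 : Measurable fun t : ℝ × ℝ × ℝ => dist0 x t.1 t.2.1 :=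
    Measurable.comp (g := fun z : ℝ × ℝ => dist0 x z.1 z.2)
      (f := fun t : ℝ × ℝ × ℝ => (t.1, t.2.1)) (measurable_dist0 x) (by fun_prop)
  have h3 : Measurable fun t : ℝ × ℝ × ℝ => p.KextDeriv (x, t.1, t.2.1, t.2.2) :=
    (hK.measurable_KextDeriv hA hd hab).comp (by fun_prop)
  have h4 : Measurable fun t : ℝ × ℝ × ℝ => Psi p.d k t.2.1 :=
    (continuous_Psi hd k).measurable.comp measurable_snd.fst
  have h5 : Measurable fun t : ℝ × ℝ × ℝ => dist0 x t.1 t.2.1 / t.1 := h2.div measurable_fst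
  have h6 := ((h1.mul h5).mul h3).mul h4
  exact h6.neg

omit hd in
theorem Admissible.measurable_coefS (x : Fin n → ℝ) :
    Measurable fun t : ℝ × ℝ × ℝ => p.coefS x t.1 t.2 := by
  have h1 : Measurable fun t : ℝ × ℝ × ℝ => p.μs (x, t.1) :=
    hK.μs_smooth.continuous.measurable.comp (by fun_prop)
  have h3 : Measurable fun t : ℝ × ℝ × ℝ => p.Kext (x, t.1, t.2.1, t.2.2) :=
    hK.measurable_Kext.comp (by fun_prop)
  exact h1.mul h3

end Measurability

variable {x : Fin n → ℝ} {y B : ℝ} (hx : ∀ i, -p.A ≤ x i ∧ x i ≤ p.A) (hy : y ∈ Set.Ioo p.a p.b)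
variable (hB0 : 1 ≤ B) (hB : ∀ s : Fin N, ∀ α ∈ Set.Icc (-p.d) p.d,
  |Psi p.d s α| ≤ B ∧ |deriv (Psi p.d s) α| ≤ B)

omit hd in
include hB0 hB in
theorem abs_expP_le {z : ℝ × ℝ} (hz : z.1 ∈ Set.Ioo (-p.d) p.d ∧ z.2 ∈ Set.Ioo (-p.d) p.d)
    (s : Fin N) : |p.expP s z| ≤ 2 * B ∧ |p.expQ s z| ≤ 2 * B := by
  have h1 := hB s z.1 (Set.Ioo_subset_Icc_self hz.1)
  have h2 := hB s z.2 (Set.Ioo_subset_Icc_self hz.2)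
  refine ⟨(abs_sub _ _).trans ?_, h1.2.trans ?_⟩ <;> linarith [h1.1, h2.1]

include hK hd ha hx hy hB0 hB

/-- The bounds of the data in the integral representation of `F_k`. They are uniform in `Ω`, and
depend on `K` only through its `C¹` norm. -/
theorem Admissible.expBounds_F (k : Fin N) : ∀ᵐ z ∂p.squareMeasure,
    ExpBounds (p.expP (N := N)) p.expQ (p.coefF₁ k x y) (p.coefF₂ k x y) (2 * B)
      (coefConst n p.A p.d p.b κ σ B) z := by
  filter_upwards [p.ae_squareMeasure] with z hz
  have hz1 := Set.Ioo_subset_Icc_self hz.1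
  have hs := fun i => abs_shift_le (x := x) hd.le hx hz1 i
  have h1 := dist0_div_le (ha.trans hy.1.le) hy.2.le hs
  have h2 := hK.abs_μs_le (x, y)
  have h3 := (hB k z.1 hz1).1
  have h4 : 0 ≤ distBound n (p.A + p.d) p.b := by unfold distBound; positivity
  refine ⟨fun s => (abs_expP_le hB0 hB hz s).1, fun s => (abs_expP_le hB0 hB hz s).2, ?_, ?_⟩
  · have h5 := hK.abs_Kext_le (x, y, z.1, z.2)
    rw [coefF₁, abs_mul, abs_mul, abs_mul, coefConst]
    gcongr
  · have h5 := hK.abs_KextDeriv_le (x, y, z.1, z.2)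
    rw [coefF₂, abs_neg, abs_mul, abs_mul, abs_mul, coefConst]
    gcongr

omit hd ha hx hy in
theorem Admissible.expBounds_S : ∀ᵐ z ∂p.squareMeasure,
    ExpBounds (p.expP (N := N)) p.expQ (fun _ => 0) (p.coefS x y) (2 * B)
      (coefConst n p.A p.d p.b κ σ B) z := by
  filter_upwards [p.ae_squareMeasure] with z hz
  have h2 := hK.abs_μs_le (x, y)
  have h4 : 1 ≤ distBound n (p.A + p.d) p.b := by
    unfold distBound
    have h5 : 0 ≤ n * (p.A + p.d) ^ 2 := by positivity
    linarith [sq_nonneg p.b]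
  refine ⟨fun s => (abs_expP_le hB0 hB hz s).1, fun s => (abs_expP_le hB0 hB hz s).2, ?_, ?_⟩
  · rw [abs_zero]
    exact coefConst_nonneg (by linarith)
  · rw [coefS, abs_mul, coefConst]
    have h5 := hK.abs_Kext_le (x, y, z.1, z.2)
    calc _ ≤ |σ| * |κ| := mul_le_mul h2 h5 (abs_nonneg _) (abs_nonneg _)
      _ ≤ |σ| * |κ| * (distBound n (p.A + p.d) p.b * B) :=
          le_mul_of_one_le_right (by positivity) (one_le_mul_of_one_le_of_one_le h4 hB0)
      _ = _ := by ring

include hA hab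

/-- The nonlinear term as an integral of exponential type over the square: differentiate
`∫ K e^{w(β) - w(α)} dβ` with respect to `α` under the integral, which moves the derivative to `K`
and to `e^{-w(α)}`. -/
theorem Admissible.F_eq (w : Fin N → ℝ) (k : Fin N) :
    p.F w x y k = expInt p.squareMeasure p.expP p.expQ (p.coefF₁ k x y) (p.coefF₂ k x y) w := by
  have hC : 0 ≤ coefConst n p.A p.d p.b κ σ B := coefConst_nonneg (by linarith)
  have hi : Integrable (expTerm p.expP p.expQ (p.coefF₁ k x y) (p.coefF₂ k x y) w)
      p.squareMeasure := integrable_expTerm (measurable_expP hd) (measurable_expQ hd)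
    ((hK.measurable_coefF₁ hd k x).comp measurable_prodMk_left)
    ((hK.measurable_coefF₂ hd hA hab k x).comp measurable_prodMk_left)
    (hK.expBounds_F hd ha hx hy hB0 hB k) (by linarith) hC w
  rw [expInt, squareMeasure]
  rw [squareMeasure] at hi
  rw [integral_prod _ hi, F, interval_eq_integral_Ioo (by linarith)]
  refine setIntegral_congr_fun measurableSet_Ioo fun α hα => ?_
  show _ * deriv (fun t => p.scatter w x y t) α * _ = _
  rw [(hK.hasDerivAt_scatter hA hd hab hx hy w hα).deriv, ← integral_const_mul,
    ← integral_mul_const]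
  refine integral_congr_ae (Filter.Eventually.of_forall fun β => ?_)
  have e1 : p.series w β - p.series w α = ∑ s, p.expP s (α, β) * w s := by
    unfold series expP
    rw [← Finset.sum_sub_distrib]
    exact Finset.sum_congr rfl fun s _ => by ring
  have e2 : ∑ s, w s * deriv (Psi p.d s) α = ∑ s, p.expQ s (α, β) * w s :=
    Finset.sum_congr rfl fun s _ => mul_comm _ _
  simp only [expTerm, coefF₁, coefF₂, nuLast, e1, e2, ← div_mul_eq_mul_div, div_div_eq_mul_div]
  ring

omit hab hA ha in
/-- The scattering part of the coefficient as an integral of exponential type over the square. -/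
theorem Admissible.integral_scatter_eq (w : Fin N → ℝ) :
    ∫ α in (-p.d)..p.d, p.μs (x, y) * p.scatter w x y α
      = expInt p.squareMeasure p.expP p.expQ (fun _ => 0) (p.coefS x y) w := by
  have hC : 0 ≤ coefConst n p.A p.d p.b κ σ B := coefConst_nonneg (by linarith)
  have hi : Integrable (expTerm p.expP p.expQ (fun _ => 0) (p.coefS x y) w) p.squareMeasure :=
    integrable_expTerm (measurable_expP hd) (measurable_expQ hd)
    measurable_const ((hK.measurable_coefS x).comp measurable_prodMk_left)
    (hK.expBounds_S hB0 hB) (by linarith) hC w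
  rw [expInt, squareMeasure]
  rw [squareMeasure] at hi
  rw [integral_prod _ hi, interval_eq_integral_Ioo (by linarith)]
  refine setIntegral_congr_fun measurableSet_Ioo fun α hα => ?_
  show _ * p.scatter w x y α = _
  rw [scatter, interval_eq_integral_Ioo (by linarith), ← mul_assoc, ← integral_const_mul]
  refine setIntegral_congr_fun measurableSet_Ioo fun β hβ => ?_
  have e1 : Real.exp (∑ s, p.expP s (α, β) * w s)
      = Real.exp (-p.series w α) * Real.exp (p.series w β) := by
    rw [← Real.exp_add]
    congr 1
    unfold series expP
    rw [← Finset.sum_neg_distrib, ← Finset.sum_add_distrib]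
    exact Finset.sum_congr rfl fun s _ => by ring
  simp only [expTerm, coefS, e1, Kext, Set.indicator_of_mem (mem_Box_of_mem hx hy hα hβ)]
  ring

end Representation

/-- The derivative of `F` with respect to `w`, at the grid points. -/
def dF (p : Model n) (g : p.Grid) (w : Fin N → ℝ) (y : ℝ) (k s : Fin N) : ℝ :=
  expIntDeriv p.squareMeasure p.expP p.expQ (p.coefF₁ k (p.pt g) y) (p.coefF₂ k (p.pt g) y) w s

/-- The bound for the matrices of the linear part. -/
def matConst (A d B : ℝ) : ℝ :=
  2 * d * ((B + (A + d) * B) * B)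
    + 2 * d * (((A + d) * B + (1 + (A + d) * (A + d)) * B) * B)

/-- The bound for `F`, its derivative and its Taylor remainder. -/
def nonlinConst (n N : ℕ) (A d b κ σ B M : ℝ) : ℝ :=
  expConst N (2 * B) (coefConst n A d b κ σ B) M * (2 * d) ^ 2

/-- The coefficients of the admissible models have the regularity that the convexity of `J_λ` is
based on, with constants that depend on the parameters only. -/
theorem Admissible.regular {h0 κ σ B m₀ : ℝ} (hK : p.Admissible h0 κ σ) (hh0 : 0 < h0)
    (hA : 0 < p.A) (hd : 0 < p.d) (ha : 1 ≤ p.a) (hab : p.a < p.b) (hB0 : 1 ≤ B)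
    (hB : ∀ s : Fin N, ∀ α ∈ Set.Icc (-p.d) p.d,
      |Psi p.d s α| ≤ B ∧ |deriv (Psi p.d s) α| ≤ B) (hm₀ : 0 < m₀)
    (hM : ∀ v : Fin N → ℝ, m₀ * ∑ s, v s ^ 2
      ≤ ∑ k : Fin N, (∑ s : Fin N, (∫ t in (-p.d)..p.d,
        deriv (Psi p.d s) t * Psi p.d k t) * v s) ^ 2)
    (ha' : 4 * (N * N * (2 * p.d * ((p.A + p.d) * B ^ 2)) ^ 2) / m₀ ≤ p.a) :
    p.Regular N (m₀ / 4) (matConst p.A p.d B) h0 (nonlinConst n N p.A p.d p.b κ σ B) p.dF := by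
  have hB1 : 0 ≤ B := by linarith
  have hB2 : 0 ≤ 2 * B := by linarith
  have hC : 0 ≤ coefConst n p.A p.d p.b κ σ B := coefConst_nonneg hB1
  have hH : 0 ≤ p.A + p.d := by linarith
  have hx : ∀ g : p.Grid, ∀ i, -p.A ≤ p.pt g i ∧ p.pt g i ≤ p.A := fun g =>
    pt_mem hA hK.one_lt_m g
  have hs : ∀ g : p.Grid, ∀ α ∈ Set.Icc (-p.d) p.d, ∀ i, |shift (p.pt g) α i| ≤ p.A + p.d :=
    fun g α hα i => abs_shift_le hd.le (hx g) hα i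
  have hy1 : ∀ y ∈ Set.Ioo p.a p.b, 1 ≤ y := fun y hy => ha.trans hy.1.le
  have hnn1 : 0 ≤ 2 * p.d * ((B + (p.A + p.d) * B) * B) := by positivity
  have hnn2 : 0 ≤ 2 * p.d * (((p.A + p.d) * B + (1 + (p.A + p.d) * (p.A + p.d)) * B) * B) := by
    positivity
  have mP := measurable_expP (p := p) (N := N) hd
  have mQ := measurable_expQ (p := p) (N := N) hd
  have m1 := fun (k : Fin N) (g : p.Grid) (y : ℝ) =>
    (hK.measurable_coefF₁ hd k (p.pt g)).comp (measurable_prodMk_left (x := y))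
  have m2 := fun (k : Fin N) (g : p.Grid) (y : ℝ) =>
    (hK.measurable_coefF₂ hd hA hab k (p.pt g)).comp (measurable_prodMk_left (x := y))
  have hbd := fun (k : Fin N) (g : p.Grid) (y : ℝ) (hy : y ∈ Set.Ioo p.a p.b) =>
    hK.expBounds_F hd ha (hx g) hy hB0 hB k
  have hF := fun (k : Fin N) (g : p.Grid) (y : ℝ) (hy : y ∈ Set.Ioo p.a p.b) (w : Fin N → ℝ) =>
    hK.F_eq hA hd ha hab (hx g) hy hB0 hB w k
  have hvol := squareMeasure_univ hd
  have mw : ∀ s : Fin N, Measurable fun t : (Fin N → ℝ) × ℝ × ℝ × ℝ => t.1 s := fun s =>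
    (measurable_pi_apply s).comp measurable_fst
  have mP' : ∀ s : Fin N, Measurable fun t : (Fin N → ℝ) × ℝ × ℝ × ℝ => p.expP s t.2.2 :=
    fun s => (mP s).comp measurable_snd.snd
  have mQ' : ∀ s : Fin N, Measurable fun t : (Fin N → ℝ) × ℝ × ℝ × ℝ => p.expQ s t.2.2 :=
    fun s => (mQ s).comp measurable_snd.snd
  have m1' : ∀ (k : Fin N) (g : p.Grid), Measurable fun t : (Fin N → ℝ) × ℝ × ℝ × ℝ =>
      p.coefF₁ k (p.pt g) t.2.1 t.2.2 := fun k g =>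
    (hK.measurable_coefF₁ hd k (p.pt g)).comp measurable_snd
  have m2' : ∀ (k : Fin N) (g : p.Grid), Measurable fun t : (Fin N → ℝ) × ℝ × ℝ × ℝ =>
      p.coefF₂ k (p.pt g) t.2.1 t.2.2 := fun k g =>
    (hK.measurable_coefF₂ hd hA hab k (p.pt g)).comp measurable_snd
  refine
    { c₀_pos := by positivity
      h₀_pos := hh0
      h₀_le := hK.h0_le
      CF_nonneg := fun M => mul_nonneg (expConst_nonneg hB2 hC M) (by positivity)
      D_coercive := fun g _ y hy v => D_coercive hd hB1 hH (fun s α hα => (hB s α hα).1) (hs g)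
        hm₀ hM (hy1 y hy) (ha'.trans hy.1.le) v
      D_le := fun g _ y hy k s =>
        (abs_D_le hd hB1 hH hB (hs g) (hy1 y hy) k s).trans (le_add_of_nonneg_right hnn2)
      A_le := fun g _ y hy i k s =>
        (abs_Amat_le hd hB1 hH hB (hs g) (hy1 y hy) i k s).trans (le_add_of_nonneg_left hnn1)
      D_meas := fun g _ k s => aestronglyMeasurable_D hd (by linarith) k s
      A_meas := fun g _ i k s => aestronglyMeasurable_Amat hd (by linarith) i k s
      F_le := fun M g _ y hy w hw k => ?_
      DF_le := fun M g _ y hy w hw k s => ?_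
      F_taylor := fun M g _ y hy w v hw hwv k => ?_
      F_meas := fun g _ w hw k => ?_
      DF_meas := fun g _ w hw k s => ?_ }
  · rw [hF k g y hy]
    have := abs_expInt_le (hbd k g y hy) hB2 hC hw
    rwa [hvol] at this
  · have := abs_expIntDeriv_le (hbd k g y hy) hB2 hC hw s
    rwa [hvol] at this
  · rw [hF k g y hy, hF k g y hy]
    have := expInt_taylor mP mQ (m1 k g y) (m2 k g y) (hbd k g y hy) hB2 hC hw hwv
    rwa [hvol] at this
  · have h1 := aestronglyMeasurable_param (ν := p.squareMeasure) (f := fun w y z =>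
      expTerm p.expP p.expQ (p.coefF₁ k (p.pt g) y) (p.coefF₂ k (p.pt g) y) w z)
      ((Finset.measurable_sum _ fun s _ => (mP' s).mul (mw s)).exp.mul
        (((Finset.measurable_sum _ fun s _ => (mQ' s).mul (mw s)).mul (m1' k g)).add
          (m2' k g))) hw
    refine h1.congr ?_
    filter_upwards [ae_restrict_mem measurableSet_Ioo] with y hy
    exact (hF k g y hy _).symm
  · exact aestronglyMeasurable_param (ν := p.squareMeasure) (f := fun w y z =>
      expTermDeriv p.expP p.expQ (p.coefF₁ k (p.pt g) y) (p.coefF₂ k (p.pt g) y) w s z)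
      ((Finset.measurable_sum _ fun s _ => (mP' s).mul (mw s)).exp.mul
        (((mP' s).mul (((Finset.measurable_sum _ fun s _ => (mQ' s).mul (mw s)).mul
          (m1' k g)).add (m2' k g))).add ((mQ' s).mul (m1' k g)))) hw

end Model

/-! ### The recovered coefficient -/

theorem measurable_nu {n : ℕ} (x : Fin n → ℝ) (i : Fin n) :
    Measurable fun z : ℝ × ℝ => nu x z.1 z.2 i :=
  ((measurable_shift x i).comp measurable_snd).div (measurable_dist0 x)

theorem measurable_nuLast {n : ℕ} (x : Fin n → ℝ) :
    Measurable fun z : ℝ × ℝ => nuLast x z.1 z.2 :=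
  measurable_fst.div (measurable_dist0 x)

namespace Model

variable {n : ℕ} {p : Model n} {N : ℕ}

/-- The average `∫ ν_i Ψ_s`, the coefficient of `∂_{x_i} w_s` in `a^h`. -/
def avgNu (p : Model n) (x : Fin n → ℝ) (y : ℝ) (i : Fin n) (s : Fin N) : ℝ :=
  ∫ α in (-p.d)..p.d, nu x y α i * Psi p.d s α

/-- The average `∫ ν_{n+1} Ψ_s`, the coefficient of `∂_y w_s` in `a^h`. -/
def avgNuLast (p : Model n) (x : Fin n → ℝ) (y : ℝ) (s : Fin N) : ℝ :=
  ∫ α in (-p.d)..p.d, nuLast x y α * Psi p.d s α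

/-- The part of `a^h` that is linear in the derivatives, up to a factor. -/
def transport (p : Model n) (W : p.GridFun N) (g : p.Grid) (y : ℝ) : ℝ :=
  (∑ i, ∑ s, avgNu p (p.pt g) y i s * p.dx W i g s y)
    + ∑ s, avgNuLast p (p.pt g) y s * deriv (W g s) y

/-- The part of `a^h` that depends on the values of `W`, up to a factor. -/
def scatterPart (p : Model n) (W : p.GridFun N) (g : p.Grid) (y : ℝ) : ℝ :=
  ∫ α in (-p.d)..p.d, p.μs (p.pt g, y) * p.scatter (fun s => W g s y) (p.pt g) y α

theorem coeff_eq (hd : 0 < p.d) (W : p.GridFun N) (g : p.Grid) {y : ℝ} (hy : 0 < y) :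
    p.coeff W g y = -(1 / (2 * p.d)) * p.transport W g y
      + 1 / (2 * p.d) * p.scatterPart W g y := by
  have cP : ∀ s, Continuous (Psi p.d s) := continuous_Psi hd
  have c1 : ∀ i, Continuous fun α => nu (p.pt g) y α i := fun i =>
    (continuous_shift i).div (continuous_dist0 hy) fun α => (dist0_pos hy).ne'
  have c2 : Continuous fun α => nuLast (p.pt g) y α :=
    continuous_const.div (continuous_dist0 hy) fun α => (dist0_pos hy).ne'
  have e : (∫ α in (-p.d)..p.d,
      (∑ i, nu (p.pt g) y α i * p.series (fun s => p.dx W i g s y) α)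
        + nuLast (p.pt g) y α * p.series (fun s => deriv (W g s) y) α) = p.transport W g y := by
    have e1 : ∀ α, (∑ i, nu (p.pt g) y α i * p.series (fun s => p.dx W i g s y) α)
        + nuLast (p.pt g) y α * p.series (fun s => deriv (W g s) y) α
        = (∑ i, ∑ s : Fin N, nu (p.pt g) y α i * Psi p.d s α * p.dx W i g s y)
          + ∑ s : Fin N, nuLast (p.pt g) y α * Psi p.d s α * deriv (W g s) y := by
      intro α
      simp only [series, Finset.mul_sum]
      congr 1
      · exact Finset.sum_congr rfl fun i _ => Finset.sum_congr rfl fun s _ => by ring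
      · exact Finset.sum_congr rfl fun s _ => by ring
    simp_rw [e1]
    have i1 : ∀ i (s : Fin N), IntervalIntegrable
        (fun α => nu (p.pt g) y α i * Psi p.d s α * p.dx W i g s y) volume (-p.d) p.d :=
      fun i s => (((c1 i).mul (cP s)).mul_const _).intervalIntegrable _ _
    have i2 : ∀ s : Fin N, IntervalIntegrable
        (fun α => nuLast (p.pt g) y α * Psi p.d s α * deriv (W g s) y) volume (-p.d) p.d :=
      fun s => ((c2.mul (cP s)).mul_const _).intervalIntegrable _ _
    have i3 : ∀ i, IntervalIntegrable (fun α => ∑ s : Fin N,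
        nu (p.pt g) y α i * Psi p.d s α * p.dx W i g s y) volume (-p.d) p.d := fun i =>
      (continuous_finsetSum _ fun (s : Fin N) _ =>
        ((c1 i).mul (cP s)).mul_const _).intervalIntegrable _ _
    have i4 : IntervalIntegrable (fun α => ∑ i, ∑ s : Fin N,
        nu (p.pt g) y α i * Psi p.d s α * p.dx W i g s y) volume (-p.d) p.d :=
      (continuous_finsetSum _ fun i _ => continuous_finsetSum _ fun (s : Fin N) _ =>
        ((c1 i).mul (cP s)).mul_const _).intervalIntegrable _ _
    have i5 : IntervalIntegrable (fun α => ∑ s : Fin N,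
        nuLast (p.pt g) y α * Psi p.d s α * deriv (W g s) y) volume (-p.d) p.d :=
      (continuous_finsetSum _ fun (s : Fin N) _ =>
        (c2.mul (cP s)).mul_const _).intervalIntegrable _ _
    rw [intervalIntegral.integral_add i4 i5, intervalIntegral.integral_finsetSum fun i _ => i3 i,
      intervalIntegral.integral_finsetSum fun s _ => i2 s]
    simp only [transport, avgNu, avgNuLast, ← intervalIntegral.integral_mul_const]
    congr 1
    exact Finset.sum_congr rfl fun i _ =>
      intervalIntegral.integral_finsetSum fun s _ => i1 i s
  rw [coeff, e, scatterPart]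

section Bounds

variable (hd : 0 < p.d) {B : ℝ} (hB : ∀ s : Fin N, ∀ α ∈ Set.Icc (-p.d) p.d, |Psi p.d s α| ≤ B)

include hd hB

theorem abs_avgNu_le (x : Fin n → ℝ) {y : ℝ} (hy : 0 < y) (i : Fin n) (s : Fin N) :
    |avgNu p x y i s| ≤ 2 * p.d * B :=
  abs_intervalIntegral_le hd fun α hα => by
    rw [abs_mul]
    exact (mul_le_of_le_one_left (abs_nonneg _) (abs_nu_le_one hy i)).trans (hB s α hα)

theorem abs_avgNuLast_le (x : Fin n → ℝ) {y : ℝ} (hy : 0 < y) (s : Fin N) :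
    |avgNuLast p x y s| ≤ 2 * p.d * B :=
  abs_intervalIntegral_le hd fun α hα => by
    rw [abs_mul]
    exact (mul_le_of_le_one_left (abs_nonneg _) (abs_nuLast_le_one hy)).trans (hB s α hα)

omit hB in
theorem aestronglyMeasurable_avgNu (x : Fin n → ℝ) (i : Fin n) (s : Fin N) :
    AEStronglyMeasurable (fun y => avgNu p x y i s) p.mu :=
  (stronglyMeasurable_intervalIntegral p.d (f := fun y α => nu x y α i * Psi p.d s α)
    ((measurable_nu x i).mul
      ((continuous_Psi hd s).measurable.comp measurable_snd))).aestronglyMeasurable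

omit hB in
theorem aestronglyMeasurable_avgNuLast (x : Fin n → ℝ) (s : Fin N) :
    AEStronglyMeasurable (fun y => avgNuLast p x y s) p.mu :=
  (stronglyMeasurable_intervalIntegral p.d (f := fun y α => nuLast x y α * Psi p.d s α)
    ((measurable_nuLast x).mul
      ((continuous_Psi hd s).measurable.comp measurable_snd))).aestronglyMeasurable

theorem memLp_transport (ha : 0 ≤ p.a) {W : p.GridFun N} (hW : p.MemH1 W) {g : p.Grid}
    (hg : p.Interior g) : MemLp (p.transport W g) 2 p.mu := by
  have h1 : ∀ i (s : Fin N), MemLp (fun y => avgNu p (p.pt g) y i s) ⊤ p.mu := fun i s =>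
    memLp_top_of_bound (aestronglyMeasurable_avgNu hd _ i s) (2 * p.d * B) (by
      filter_upwards [ae_restrict_mem measurableSet_Ioo] with y hy
      exact abs_avgNu_le hd hB _ (ha.trans_lt hy.1) i s)
  have h2 : ∀ s : Fin N, MemLp (fun y => avgNuLast p (p.pt g) y s) ⊤ p.mu := fun s =>
    memLp_top_of_bound (aestronglyMeasurable_avgNuLast hd _ s) (2 * p.d * B) (by
      filter_upwards [ae_restrict_mem measurableSet_Ioo] with y hy
      exact abs_avgNuLast_le hd hB _ (ha.trans_lt hy.1) s)
  exact (memLp_finsetSum _ fun i _ => memLp_finsetSum _ fun s _ =>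
    (hW.memLp_dx hg i s).mul (h1 i s)).add
    (memLp_finsetSum _ fun s _ => (hW.memLp_deriv hg s).mul (h2 s))

theorem sq_transport_le (U : p.GridFun N) (g : p.Grid) {y : ℝ} (hy : 0 < y) :
    p.transport U g y ^ 2
      ≤ 2 * (n * N + N) * (2 * p.d * B) ^ 2 * (p.derivSq U g y + p.diffSq U g y) := by
  set C := 2 * p.d * B
  have h1 : (∑ i, ∑ s, avgNu p (p.pt g) y i s * p.dx U i g s y) ^ 2
      ≤ n * (N * C ^ 2) * p.diffSq U g y := by
    have h := sq_sum_mul_le (a := fun _ : Fin n => (1 : ℝ)) (C := 1)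
      (fun i => ∑ s, avgNu p (p.pt g) y i s * p.dx U i g s y) (fun _ => by simp)
    simp only [one_mul, one_pow, mul_one, Fintype.card_fin] at h
    refine h.trans ?_
    rw [mul_assoc, diffSq, Finset.mul_sum (a := N * C ^ 2)]
    gcongr with i
    have := sq_sum_mul_le (fun s => p.dx U i g s y) (fun s => abs_avgNu_le hd hB (p.pt g) hy i s)
    rwa [Fintype.card_fin] at this
  have h2 : (∑ s, avgNuLast p (p.pt g) y s * deriv (U g s) y) ^ 2
      ≤ N * C ^ 2 * p.derivSq U g y := by
    have := sq_sum_mul_le (fun s => deriv (U g s) y)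
      (fun s => abs_avgNuLast_le hd hB (p.pt g) hy s)
    rwa [Fintype.card_fin] at this
  have h3 := derivSq_nonneg U g y
  have h4 := diffSq_nonneg U g y
  have h5 : 0 ≤ n * (N * C ^ 2) * p.derivSq U g y := by positivity
  have h6 : 0 ≤ N * C ^ 2 * p.diffSq U g y := by positivity
  unfold transport
  refine (add_sq_le).trans ?_
  linarith

end Bounds

theorem transport_sub {V W : p.GridFun N} [Fact (p.a < p.b)] (hV : p.MemH1 V) (hW : p.MemH1 W) :
    ∀ᵐ y ∂p.mu, ∀ g, p.Interior g →
      p.transport (W - V) g y = p.transport W g y - p.transport V g y := by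
  filter_upwards [ae_deriv_add (hW.sub hV) hV] with y hy g hg
  rw [sub_add_cancel] at hy
  have h1 : ∀ s, deriv ((W - V) g s) y = deriv (W g s) y - deriv (V g s) y := fun s => by
    rw [hy g hg s]; ring
  have h2 : ∀ i s, p.dx (W - V) i g s y = p.dx W i g s y - p.dx V i g s y := fun i s => by
    simp only [dx, Pi.sub_apply]; ring
  simp only [transport, h1, h2, mul_sub, Finset.sum_sub_distrib]
  ring

/-- The square of the Lipschitz constant of `a^h` on the ball of radius `R`. -/
def coeffConst (n N : ℕ) (A d a b κ σ B R : ℝ) : ℝ :=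
  2 * (1 / (2 * d)) ^ 2 * (2 * (n * N + N) * (2 * d * B) ^ 2
    + (8 * supBound a b R ^ 2 + 2 * N) * nonlinConst n N A d b κ σ B (supBound a b R) ^ 2)

theorem coeffConst_nonneg (n N : ℕ) (A d a b κ σ B R : ℝ) :
    0 ≤ coeffConst n N A d a b κ σ B R := by
  unfold coeffConst; positivity

section Lipschitz

variable {h0 κ σ B : ℝ} (hK : p.Admissible h0 κ σ) (hA : 0 < p.A) (hd : 0 < p.d) (ha : 1 ≤ p.a)
variable [hab : Fact (p.a < p.b)]
variable (hB0 : 1 ≤ B) (hB : ∀ s : Fin N, ∀ α ∈ Set.Icc (-p.d) p.d,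
  |Psi p.d s α| ≤ B ∧ |deriv (Psi p.d s) α| ≤ B)

include hK hA hd ha hB0 hB

omit hab ha in
theorem Admissible.scatterPart_eq (W : p.GridFun N) (g : p.Grid) {y : ℝ}
    (hy : y ∈ Set.Ioo p.a p.b) : p.scatterPart W g y
      = expInt p.squareMeasure p.expP p.expQ (fun _ => 0) (p.coefS (p.pt g) y)
        (fun s => W g s y) :=
  hK.integral_scatter_eq hd (pt_mem hA hK.one_lt_m g) hy hB0 hB _

theorem Admissible.memLp_coeff (hn : 1 ≤ n) {W : p.GridFun N} (hW : p.MemH1 W) :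
    p.MemL2 (p.coeff W) := by
  intro g hg
  have hC : 0 ≤ coefConst n p.A p.d p.b κ σ B := coefConst_nonneg (by linarith)
  have ha0 : 0 ≤ p.a := by linarith
  have h1 := memLp_transport hd (fun s α hα => (hB s α hα).1) ha0 hW hg
  have h2 : MemLp (p.scatterPart W g) 2 p.mu := by
    refine MemLp.of_bound ?_ (expConst N (2 * B) (coefConst n p.A p.d p.b κ σ B)
      (supBound p.a p.b (p.normH1 W)) * p.squareMeasure.real Set.univ) ?_
    · have mP : ∀ s : Fin N, Measurable fun t : (Fin N → ℝ) × ℝ × ℝ × ℝ => p.expP s t.2.2 :=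
        fun s => (measurable_expP hd s).comp measurable_snd.snd
      have mQ : ∀ s : Fin N, Measurable fun t : (Fin N → ℝ) × ℝ × ℝ × ℝ => p.expQ s t.2.2 :=
        fun s => (measurable_expQ hd s).comp measurable_snd.snd
      have mw : ∀ s : Fin N, Measurable fun t : (Fin N → ℝ) × ℝ × ℝ × ℝ => t.1 s := fun s =>
        (measurable_pi_apply s).comp measurable_fst
      have mS : Measurable fun t : (Fin N → ℝ) × ℝ × ℝ × ℝ => p.coefS (p.pt g) t.2.1 t.2.2 :=
        (hK.measurable_coefS (p.pt g)).comp measurable_snd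
      have h3 := aestronglyMeasurable_param (ν := p.squareMeasure) (f := fun w y z =>
        expTerm p.expP p.expQ (fun _ => 0) (p.coefS (p.pt g) y) w z)
        ((Finset.measurable_sum _ fun s _ => (mP s).mul (mw s)).exp.mul
          (((Finset.measurable_sum _ fun s _ => (mQ s).mul (mw s)).mul measurable_const).add
            mS)) (fun s => hW.continuousOn hg s)
      refine h3.congr ?_
      filter_upwards [ae_restrict_mem measurableSet_Ioo] with y hy
      exact (hK.scatterPart_eq hA hd hB0 hB W g hy).symm
    · filter_upwards [ae_restrict_mem measurableSet_Ioo] with y hy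
      rw [Real.norm_eq_abs, hK.scatterPart_eq hA hd hB0 hB W g hy]
      exact abs_expInt_le (hK.expBounds_S hB0 hB) (by linarith) hC
        (valSq_le_supBound hn hW hg le_rfl (Set.Ioo_subset_Icc_self hy))
  refine ((h1.const_mul (-(1 / (2 * p.d)))).add (h2.const_mul (1 / (2 * p.d)))).ae_eq ?_
  filter_upwards [ae_restrict_mem measurableSet_Ioo] with y hy
  exact (coeff_eq hd W g (ha0.trans_lt hy.1)).symm

theorem Admissible.sq_coeff_sub_le (hn : 1 ≤ n) {V W : p.GridFun N} (hV : p.MemH1 V)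
    (hW : p.MemH1 W) {R : ℝ} (hVR : p.normH1 V ≤ R) (hWR : p.normH1 W ≤ R) :
    ∀ᵐ y ∂p.mu, ∀ g, p.Interior g → (p.coeff W g y - p.coeff V g y) ^ 2
      ≤ coeffConst n N p.A p.d p.a p.b κ σ B R * p.dens (W - V) (W - V) g y := by
  have hC : 0 ≤ coefConst n p.A p.d p.b κ σ B := coefConst_nonneg (by linarith)
  filter_upwards [transport_sub hV hW, ae_restrict_mem measurableSet_Ioo] with y hT hy g hg
  have hy0 : 0 < y := by linarith [hy.1]
  set M := supBound p.a p.b R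
  set E := nonlinConst n N p.A p.d p.b κ σ B M
  set T := p.transport W g y - p.transport V g y
  set S := p.scatterPart W g y - p.scatterPart V g y
  have e : p.coeff W g y - p.coeff V g y = 1 / (2 * p.d) * (S - T) := by
    rw [coeff_eq hd W g hy0, coeff_eq hd V g hy0]; ring
  have h1 : T ^ 2 ≤ 2 * (n * N + N) * (2 * p.d * B) ^ 2
      * (p.derivSq (W - V) g y + p.diffSq (W - V) g y) := by
    have := sq_transport_le hd (fun s α hα => (hB s α hα).1) (W - V) g hy0
    rwa [hT g hg] at this
  have h2 : S ^ 2 ≤ (8 * M ^ 2 + 2 * N) * E ^ 2 * p.valSq (W - V) g y := by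
    have h := sq_expInt_sub_le (ν := p.squareMeasure) (measurable_expP hd) (measurable_expQ hd)
      measurable_const ((hK.measurable_coefS (p.pt g)).comp measurable_prodMk_left)
      (hK.expBounds_S (x := p.pt g) (y := y) hB0 hB) (by linarith) hC
      (valSq_le_supBound hn hV hg hVR (Set.Ioo_subset_Icc_self hy))
      (valSq_le_supBound hn hW hg hWR (Set.Ioo_subset_Icc_self hy))
    rw [squareMeasure_univ hd] at h
    have e2 : S = expInt p.squareMeasure p.expP p.expQ (fun _ => 0) (p.coefS (p.pt g) y)
        (fun s => W g s y) - expInt p.squareMeasure p.expP p.expQ (fun _ => 0)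
        (p.coefS (p.pt g) y) (fun s => V g s y) := by
      simp only [S]
      rw [hK.scatterPart_eq hA hd hB0 hB W g hy, hK.scatterPart_eq hA hd hB0 hB V g hy]
    rw [e2]
    exact h
  have h3 := densities_le_dens hn (W - V) g y
  have h4 := derivSq_nonneg (W - V) g y
  have h5 := diffSq_nonneg (W - V) g y
  have h6 := valSq_nonneg (W - V) g y
  set X := 2 * (n * N + N) * (2 * p.d * B) ^ 2
  set Y := (8 * M ^ 2 + 2 * N) * E ^ 2
  have hX : 0 ≤ X := by positivity
  have hY : 0 ≤ Y := by positivity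
  have h7 : (S - T) ^ 2 ≤ 2 * ((X + Y) * p.dens (W - V) (W - V) g y) := by
    have h8 : (S - T) ^ 2 ≤ 2 * S ^ 2 + 2 * T ^ 2 := by nlinarith [sq_nonneg (S + T)]
    have h9 := mul_le_mul_of_nonneg_left h3 (add_nonneg hX hY)
    have h10 : 0 ≤ X * p.valSq (W - V) g y := mul_nonneg hX h6
    have h11 : 0 ≤ Y * (p.derivSq (W - V) g y + p.diffSq (W - V) g y) :=
      mul_nonneg hY (add_nonneg h4 h5)
    linarith
  rw [e, mul_pow]
  calc _ ≤ (1 / (2 * p.d)) ^ 2 * (2 * ((X + Y) * p.dens (W - V) (W - V) g y)) := by gcongr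
    _ = _ := by simp only [coeffConst, X, Y, E, M]; ring

/-- The recovered coefficient depends on `W` in a Lipschitz continuous way. -/
theorem Admissible.normL2_coeff_sub_le (hn : 1 ≤ n) {V W : p.GridFun N} (hV : p.MemH1 V)
    (hW : p.MemH1 W) {R : ℝ} (hVR : p.normH1 V ≤ R) (hWR : p.normH1 W ≤ R) :
    p.normL2 (p.coeff W - p.coeff V)
      ≤ Real.sqrt (coeffConst n N p.A p.d p.a p.b κ σ B R) * p.normH1 (W - V) := by
  have hL := coeffConst_nonneg n N p.A p.d p.a p.b κ σ B R
  set L := coeffConst n N p.A p.d p.a p.b κ σ B R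
  have hN : 0 ≤ p.normH1 (W - V) := Real.sqrt_nonneg _
  rw [normL2, Real.sqrt_le_left (by positivity), mul_pow, Real.sq_sqrt hL,
    normH1_sq (hW.sub hV), Finset.mul_sum]
  refine Finset.sum_le_sum fun g hg => ?_
  rw [mem_interiorPts] at hg
  rw [interval_eq_integral_Ioo hab.out.le, ← integral_const_mul]
  refine integral_mono_of_nonneg (Filter.Eventually.of_forall fun y => sq_nonneg _)
    ((integrable_dens (hW.sub hV) (hW.sub hV) hg).const_mul L) ?_
  filter_upwards [hK.sq_coeff_sub_le hA hd ha hB0 hB hn hV hW hVR hWR] with y hy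
  exact hy g hg

end Lipschitz

end Model

end RTE

end

open RTE RTE.Model in
theorem theorem4p5 :
    ∀ (A d : ℝ) (N : ℕ), 0 < A → 0 < d → 1 ≤ N →
    ∃ a0 : ℝ, 1 < a0 ∧
    ∀ (n : ℕ), 1 ≤ n →
    ∀ (a b h0 κ σ : ℝ), a0 ≤ a → a < b → 0 < h0 →
    ∃ lam1 : ℝ → ℝ,
      -- `lam1 R` is a threshold for the strict convexity on balls of radius `R`
      (∀ R : ℝ, 0 < R → 1 ≤ lam1 R ∧ ∃ c : ℝ, 0 < c ∧
        ∀ p : RTE.Model n, p.A = A → p.d = d → p.a = a → p.b = b → p.Admissible h0 κ σ →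
        ∀ (P : p.GridFun N) (lam : ℝ), lam1 R ≤ lam → p.StrictlyConvex lam c R P) ∧
      ∀ R : ℝ, 0 < R → ∀ lam2 : ℝ, lam1 (2 * R) ≤ lam2 →
      ∃ C₃ : ℝ, 0 < C₃ ∧
        ∀ p : RTE.Model n, p.A = A → p.d = d → p.a = a → p.b = b → p.Admissible h0 κ σ →
        -- noisy and exact boundary data with their extensions, and the exact solution
        ∀ (P Pstar S Sstar Wstar : p.GridFun N) (δ ρ : ℝ),
          0 < δ → 0 < ρ → ρ < R →
          p.MemH1 S → p.BdryEq S P → p.normH1 S < R →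
          p.MemH1 Sstar → p.BdryEq Sstar Pstar → p.normH1 Sstar < R →
          p.normH1 (S - Sstar) < δ →
          Wstar ∈ p.Ball ((R - ρ) / 3) Pstar → p.Solves Wstar →
          C₃ * δ < ρ / 3 →
        ∃ Wmin : p.GridFun N, p.IsUniqueMin lam2 R P Wmin ∧
        ∃ γ0 : ℝ, 0 < γ0 ∧ ∀ γ : ℝ, 0 < γ → γ ≤ γ0 →
        ∃ θ : ℝ, 0 < θ ∧ θ < 1 ∧
        ∀ W0 ∈ p.Ball (R / 3) P, ∀ k : ℕ,
          -- the iterate `k` is in the open ball and the descent direction there is the gradient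
          p.descent lam2 γ W0 k ∈ p.Ball R P ∧
          p.IsGrad lam2 (p.descent lam2 γ W0 k) (p.grad lam2 (p.descent lam2 γ W0 k)) ∧
          p.normH1 (p.descent lam2 γ W0 k - Wmin) ≤ θ ^ k * p.normH1 (W0 - Wmin) ∧
          p.normH1 (p.descent lam2 γ W0 k - Wstar)
            ≤ C₃ * δ + θ ^ k * p.normH1 (W0 - Wmin) ∧
          p.MemL2 (p.coeff (p.descent lam2 γ W0 k)) ∧ p.MemL2 (p.coeff Wstar) ∧
          p.normL2 (p.coeff (p.descent lam2 γ W0 k) - p.coeff Wstar)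
            ≤ C₃ * δ + C₃ * θ ^ k * p.normH1 (W0 - Wmin) := by
  intro A d N hA hd _
  obtain ⟨B, hB0, hB⟩ := exists_Psi_bound hd N
  obtain ⟨m₀, hm₀, hM⟩ := exists_derivMatrix_coercive hd N
  -- From `y ≥ a ≥ Q` on, the deviation of `D_N` from `(∫ Ψ_s' Ψ_k)` is harmless.
  set Q : ℝ := 4 * (N * N * (2 * d * ((A + d) * B ^ 2)) ^ 2) / m₀
  have hQ : 0 ≤ Q := by positivity
  refine ⟨2 + Q, by linarith, fun n hn a b h0 κ σ ha hab hh0 => ?_⟩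
  have hreg : ∀ p : Model n, p.A = A → p.d = d → p.a = a → p.b = b → p.Admissible h0 κ σ →
      p.Regular N (m₀ / 4) (matConst A d B) h0 (nonlinConst n N A d b κ σ B) p.dF := by
    rintro p rfl rfl rfl rfl hK
    exact hK.regular hh0 hA hd (by linarith) hab hB0 hB hm₀ hM (by linarith)
  set C := matConst A d B
  set CF := nonlinConst n N A d b κ σ B
  refine ⟨lamConst n N a b h0 (m₀ / 4) C CF, fun R _ => ⟨le_max_left _ _,
    convConst n a b h0 (m₀ / 4), convConst_pos hn (by positivity), ?_⟩, fun R hR l hl => ?_⟩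
  · rintro p hpA hpd rfl rfl hK P lam hlam
    have : Fact (p.a < p.b) := ⟨hab⟩
    exact (hreg p hpA hpd rfl rfl hK).strictlyConvex hn hlam P
  -- `C₁` controls the minimizer, and `L` is a Lipschitz constant of `a^h`.
  set C₁ := stabConst n N a b h0 (m₀ / 4) C CF (2 * R) l
  have hC₁ : 0 < C₁ := add_pos_of_nonneg_of_pos (Real.sqrt_nonneg _) one_pos
  set L := Real.sqrt (coeffConst n N A d a b κ σ B R)
  have hL : 0 ≤ L := Real.sqrt_nonneg _
  refine ⟨C₁ + L * C₁ + L, by positivity, ?_⟩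
  rintro p hpA hpd rfl rfl hK P Pstar S Sstar Wstar δ ρ hδ hρ hρR hS hSP hSR hS' hSP' hSR' hSS
    hW hsol hδρ
  have : Fact (p.a < p.b) := ⟨hab⟩
  have hδ1 : C₁ * δ ≤ (C₁ + L * C₁ + L) * δ := by
    have : 0 ≤ (L * C₁ + L) * δ := by positivity
    linarith
  obtain ⟨Wmin, hmin, hWm, -, hstab, γ0, hγ0, hdesc⟩ :=
    (hreg p hpA hpd rfl rfl hK).gradient_descent hn hR hl hρ hρR hS hSP hSR hS' hSP' hSS hW hsol
      (hδ1.trans_lt hδρ)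
  refine ⟨Wmin, hmin, γ0, hγ0, fun γ hγ hγγ => ?_⟩
  obtain ⟨θ, hθ0, hθ1, hθ⟩ := hdesc γ hγ hγγ
  refine ⟨θ, hθ0, hθ1, fun W0 hW0 k => ?_⟩
  obtain ⟨h1, h2, h3⟩ := hθ W0 hW0 k
  set Wk := p.descent l γ W0 k
  set q := θ ^ k * p.normH1 (W0 - Wmin)
  have hq : 0 ≤ q := mul_nonneg (pow_nonneg hθ0.le k) (Real.sqrt_nonneg _)
  have h4 : p.normH1 (Wk - Wstar) ≤ C₁ * δ + q := by
    have h5 := normH1_add_le (h1.1.sub hWm) (hWm.sub hW.1)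
    rw [sub_add_sub_cancel] at h5
    exact h5.trans (by linarith)
  subst hpA hpd
  have ha1 : 1 ≤ p.a := by linarith
  refine ⟨h1, h2, h3, h4.trans (by linarith), hK.memLp_coeff hA hd ha1 hB0 hB hn h1.1,
    hK.memLp_coeff hA hd ha1 hB0 hB hn hW.1, ?_⟩
  have h6 : p.normL2 (p.coeff Wk - p.coeff Wstar) ≤ L * p.normH1 (Wk - Wstar) :=
    hK.normL2_coeff_sub_le hA hd ha1 hB0 hB hn hW.1 h1.1
      (hW.2.2.le.trans (by linarith)) h1.2.2.le
  refine h6.trans ((mul_le_mul_of_nonneg_left h4 hL).trans ?_)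
  have h7 : 0 ≤ (C₁ + L) * δ := by positivity
  have h8 : 0 ≤ (C₁ + L * C₁) * q := by positivity
  rw [mul_assoc (C₁ + L * C₁ + L)]
  linarith
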